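/- \textbf{Setting.} A Markov chain $M=(S,E,\delta)$ consists of a finite nonempty set $S$ of states, a distribution $\delta(s,\cdot)$ on $S$ for every $s\in S$, and the edge set $E=\{(s,s'):\delta(s,s')>0\}$; let $p_{\min}$ be the smallest positive transition probability. An objective has a target set $T\subseteq S$ of absorbing states and is of one of two kinds. \emph{Weighted reachability}, with weights $w\colon T\to[0,\infty)$: a play pays $w(s)$ if $s$ is the target state that it reaches, and $0$ if it reaches none. \emph{Stochastic shortest path} (SSP), with weights $w\colon S\to(0,\infty)$: a play pays the sum of the weights of its states up to and including the first target state, and $\infty$ if it reaches none. The value $\mathrm{val}_M(s)$ is the expected payoff from $s$. Let $w_{\max}$ be the largest weight (over $T$ for weighted reachability, over $S$ for SSP), $w_{\min}=\min_T w$. The Bellman update of a vector $v$ at a state $s\notin T$ is $\sum_{s'}\delta(s,s')v(s')$, plus $w(s)$ for SSP; at $s\in T$ it is $v(s)$. It is assumed that Bellman updates have a unique fixpoint $v$ with $v=w$ on $T$. \textbf{MarkToGuess.} Level $0$ consists of $T$ and all states that cannot reach $T$; the level of a state is its distance to level $0$; $k$ is the largest level. MarkToGuess$(S,E,T)$ returns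 $\emptyset$ if $k\le\sqrt{|S|}$. Otherwise it takes a level $i\in[k/3,2k/3]$ with the fewest states, and returns the set of states of this level together with the result of MarkToGuess for the target set enlarged by this level. \textbf{Guessing VI.} $M[s=\gamma]$ denotes $M$ with $s$ made a target of weight $\gamma$. Interval VI with error $\varepsilon$ starts from the lower bound $\underline v_0$ and the upper bound $\overline v_0$ that equal $w$ on $T$ and are, off $T$, $0$ and $w_{\max}$ for weighted reachability, and $w_{\min}$ and $w_{\max}(k+1)/p_{\min}^{k}$ for SSP; it applies the Bellman update at all states to both bounds until they differ by at most $\varepsilon$ everywhere. Guessing VI on $(M,\varepsilon,I)$ is interval VI if $I=\emptyset$. Otherwise it picks $s\in I$ and starts with the interval $[a,b]=[\underline v_0(s),\overline v_0(s)]$. While $b-a>\varepsilon/2$, it sets $\gamma=(a+b)/2$, computes bounds $(l,u)$ by a recursive call on $(M[s=\gamma],\ \tfrac14 p_{\min}^{|S|}\varepsilon,\ I\setminus\{s\})$, and sets $a:=\gamma$ if $\gamma$ is less than the Bellman update of $l$ at $s$; else $b:=\gamma$ if $\gamma$ is greater than the Bellman update of $u$ at $s$; else $[a,b]:=[\gamma-\varepsilon/4,\gamma+\varepsilon/4]$.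 Finally it returns the lower bound of a recursive call on $(M[s=a],\varepsilon/4,I\setminus\{s\})$ and the upper bound of a recursive call on $(M[s=b],\varepsilon/4,I\setminus\{s\})$. \textbf{Theorem.} There are a program for the word RAM and a universal constant $C$ with the following properties. (1) Given only a finite directed graph $(S,E)$, $S\neq\emptyset$, as a list of edges, and $T\subseteq S$ (no probabilities, weights or error), the program outputs a set $I$ that MarkToGuess can return, after at most $C(|S|+|E|)\log\max(2,|S|)$ steps and in linear space, i.e. it uses at most $C(|S|+|E|)$ memory words, apart from a fixed number of registers, and only numbers that are at most $C(|S|+|E|)$. (2) For every Markov chain $M=(S,E,\delta)$ with an objective as above, every $\varepsilon>0$, and every set $I$ that MarkToGuess can return on $(S,E,T)$, with the states of $I$ guessed in any order, Guessing VI terminates and returns $l\le\mathrm{val}_M\le u$ with $\|u-l\|_\infty\le\varepsilon$ (in particular $\mathrm{val}_M$ is finite, and $l$ and $u$ are $\varepsilon$-approximations of it), after at most $$\left(\frac{|S|\,\log\max(2,\,w_{\max}/\varepsilon)}{p_{\min}}\right)^{C\sqrt{|S|}}$$ Bellman updates, where every update at a single state is counted. -/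

import Mathlib

open MeasureTheory ProbabilityTheory

noncomputable section

/-! ## Markov chains, objectives and values -/

/-- A Markov chain on a state space `S`: every state has a distribution over its successors.
(A state with a unique successor is a state whose distribution is a point mass.) -/
structure MarkovChain (S : Type*) where
  /-- the transition function -/
  δ : S → PMF S

namespace MarkovChain

variable {S : Type*} (M : MarkovChain S)

/-- The transition probability `δ(s, s')` as a real number. -/
def prob (s s' : S) : ℝ := (M.δ s s').toReal

open Classical in
/-- The edges of the labeled graph: the pairs `(s, s')` with `δ(s, s') > 0`. -/
def edges [Fintype S] : Finset (S × S) := Finset.univ.filter fun e => 0 < M.prob e.1 e.2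

/-- The smallest positive transition probability. -/
def pmin : ℝ := sInf {q : ℝ | 0 < q ∧ ∃ s s', M.prob s s' = q}

variable [Countable S] [MeasurableSpace S] [DiscreteMeasurableSpace S]

/-- The one-step transition kernel. -/
def stepKernel : Kernel S S := Kernel.ofFunOfCountable fun s => (M.δ s).toMeasure

instance : IsMarkovKernel M.stepKernel :=
  ⟨fun s => inferInstanceAs (IsProbabilityMeasure (M.δ s).toMeasure)⟩

/-- The transition kernel given the history up to time `t`: it looks at the last state only. -/
def historyKernel (t : ℕ) : Kernel ((i : Finset.Iic t) → S) S :=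
  M.stepKernel.comap (fun h => h ⟨t, Finset.mem_Iic.2 le_rfl⟩) (measurable_pi_apply _)

instance (t : ℕ) : IsMarkovKernel (M.historyKernel t) := by
  unfold historyKernel; infer_instance

/-- The law `ℙ_s` of the infinite play `(s_0, s_1, …)` of the chain that starts in `s_0 = s`. -/
def pathMeasure (s : S) : Measure (ℕ → S) :=
  Kernel.trajMeasure (X := fun _ => S) (Measure.dirac s) M.historyKernel

end MarkovChain

/-- The two kinds of objectives: weighted reachability and stochastic shortest path. -/
inductive ObjectiveKind
  | reach
  | ssp

/-- An objective: its kind, its target set `T`, and its weights (for weighted reachability only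
the weights of target states matter). -/
structure Objective (S : Type*) where
  kind : ObjectiveKind
  T : Finset S
  w : S → ℝ

namespace Objective

variable {S : Type*} (O : Objective S)

/-- The set on which the weight function lives: `T` for weighted reachability, `S` for SSP. -/
def weightDomain : Set S :=
  match O.kind with
  | .reach => O.T
  | .ssp => Set.univ

/-- The largest weight. -/
def wMax : ℝ := sSup (O.w '' O.weightDomain)

/-- The smallest weight of a target state. -/
def wMin : ℝ := sInf (O.w '' (O.T : Set S))

open Classical in
/-- The payoff of a play. If the play reaches the target set, it is the weight of the first target
state (weighted reachability) or the sum of the weights up to and including the first target state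
(SSP); otherwise it is `0` (weighted reachability) or `∞` (SSP). -/
def payoff (ω : ℕ → S) : ENNReal :=
  match O.kind with
  | .reach =>
      if h : ∃ t, ω t ∈ O.T then ENNReal.ofReal (O.w (ω (Nat.find h))) else 0
  | .ssp =>
      if h : ∃ t, ω t ∈ O.T then
        ∑ t ∈ Finset.range (Nat.find h + 1), ENNReal.ofReal (O.w (ω t))
      else ⊤

/-- The value of state `s`: the expected payoff of the chain that starts in `s`. -/
def value [Countable S] [MeasurableSpace S] [DiscreteMeasurableSpace S]
    (M : MarkovChain S) (s : S) : ENNReal :=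
  ∫⁻ ω, O.payoff ω ∂(M.pathMeasure s)

/-- `O` is an objective on the chain `M`: target states are absorbing, and the weights are
nonnegative on `T` (weighted reachability) or positive on `S` (SSP). -/
def IsObjectiveOn [Fintype S] (M : MarkovChain S) : Prop :=
  (∀ t ∈ O.T, ∀ s', (t, s') ∈ M.edges ↔ s' = t) ∧
  match O.kind with
  | .reach => ∀ t ∈ O.T, 0 ≤ O.w t
  | .ssp => ∀ s, 0 < O.w s

/-- The weight that is collected when a nontarget state is left. -/
def stepCost (s : S) : ℝ :=
  match O.kind with
  | .reach => 0
  | .ssp => O.w s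

open Classical in
/-- The Bellman update of the vector `v` at the state `s`. -/
def bellmanUpdate [Fintype S] (M : MarkovChain S) (v : S → ℝ) (s : S) : ℝ :=
  if s ∈ O.T then v s else O.stepCost s + ∑ s', M.prob s s' * v s'

/-- Bellman updates have a unique fixpoint among the vectors that agree with `w` on `T`. -/
def HasUniqueFixpoint [Fintype S] (M : MarkovChain S) : Prop :=
  ∃! v : S → ℝ, (∀ t ∈ O.T, v t = O.w t) ∧ ∀ s, O.bellmanUpdate M v s = v s

open Classical in
/-- The objective of the reduced chain `M[s = γ]`: `s` becomes a target state of weight `γ`. -/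
def guess (s : S) (γ : ℝ) : Objective S where
  kind := O.kind
  T := insert s O.T
  w := Function.update O.w s γ

end Objective

/-! ## Levels and the choice of the states to guess -/

section Levels

variable {S : Type*} [Fintype S] (E : Finset (S × S))

/-- `PathOfLength E A d s`: the graph `E` has a path of length `d` from `s` to the set `A`. -/
def PathOfLength (A : Set S) : ℕ → S → Prop
  | 0, s => s ∈ A
  | d + 1, s => ∃ s', (s, s') ∈ E ∧ PathOfLength A d s'

/-- Level zero: the target states and all states that cannot reach a target state. -/
def levelZero (T : Finset S) : Set S :=
  {s | s ∈ T ∨ ∀ d, ¬ PathOfLength E (T : Set S) d s}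

/-- The level of a state: the length of a shortest path to level zero. -/
def level (T : Finset S) (s : S) : ℕ := sInf {d | PathOfLength E (levelZero E T) d s}

open Classical in
/-- The set of all states of level `i`. -/
def levelSet (T : Finset S) (i : ℕ) : Finset S := Finset.univ.filter fun s => level E T s = i

/-- The number `k` of levels, where the levels are `ℓ_0, ℓ_1, …, ℓ_k`. -/
def numLevels (T : Finset S) : ℕ := Finset.univ.sup (level E T)

open Classical in
/-- `MarkToGuess E T I`: on the graph `(S, E)` with target set `T`, the procedure MarkToGuess can
return `I`. If there are at most `√|S|` levels, no state is marked; otherwise a level `i` in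
`[k/3, 2k/3]` with the smallest number of states is marked, its states are added to the targets,
and the procedure is repeated. -/
inductive MarkToGuess : Finset S → Finset S → Prop
  | few (T : Finset S) (h : (numLevels E T : ℝ) ≤ √(Fintype.card S : ℝ)) : MarkToGuess T ∅
  | many (T I : Finset S) (i : ℕ)
      (h : √(Fintype.card S : ℝ) < (numLevels E T : ℝ))
      (hi : numLevels E T ≤ 3 * i ∧ 3 * i ≤ 2 * numLevels E T)
      (hmin : ∀ j, numLevels E T ≤ 3 * j → 3 * j ≤ 2 * numLevels E T →
        (levelSet E T i).card ≤ (levelSet E T j).card)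
      (hrec : MarkToGuess (T ∪ levelSet E T i) I) :
      MarkToGuess T (I ∪ levelSet E T i)

end Levels

/-! ## Interval value iteration and guessing value iteration -/

section GuessingVI

variable {S : Type*} [Fintype S] (M : MarkovChain S)

open Classical in
/-- The initial lower bound of value iteration. -/
def initLower (O : Objective S) (s : S) : ℝ :=
  if s ∈ O.T then O.w s else
    match O.kind with
    | .reach => 0
    | .ssp => O.wMin

open Classical in
/-- The initial upper bound of value iteration. -/
def initUpper (O : Objective S) (s : S) : ℝ :=
  if s ∈ O.T then O.w s else
    match O.kind with
    | .reach => O.wMax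
    | .ssp => O.wMax * (numLevels M.edges O.T + 1) / M.pmin ^ numLevels M.edges O.T

/-- The lower bound after `t` iterations of interval value iteration. -/
def iviLower (O : Objective S) (t : ℕ) : S → ℝ := (O.bellmanUpdate M)^[t] (initLower O)

/-- The upper bound after `t` iterations of interval value iteration. -/
def iviUpper (O : Objective S) (t : ℕ) : S → ℝ := (O.bellmanUpdate M)^[t] (initUpper M O)

/-- `IVI M O ε l u N`: interval value iteration stops with the bounds `l`, `u`, after `N` Bellman
updates. It stops as soon as all intervals have size at most `ε`; each iteration updates both
bounds at every state. -/
def IVI (O : Objective S) (ε : ℝ) (l u : S → ℝ) (N : ℕ) : Prop :=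
  ∃ t : ℕ, (∀ s, iviUpper M O t s - iviLower M O t s ≤ ε) ∧
    (∀ t' < t, ∃ s, ε < iviUpper M O t' s - iviLower M O t' s) ∧
    l = iviLower M O t ∧ u = iviUpper M O t ∧ N = t * (2 * Fintype.card S)

/-- `GuessLoop M O s ε solve a b a' b' N`: the loop that guesses the value of the state `s`, entered
with the interval `[a, b]`, ends with the interval `[a', b']`, after `N` Bellman updates. Here
`solve γ l u N` says that the recursive call on the reduced chain `M[s = γ]` returns `(l, u)` after
`N` Bellman updates. -/
inductive GuessLoop (O : Objective S) (s : S) (ε : ℝ)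
    (solve : ℝ → (S → ℝ) → (S → ℝ) → ℕ → Prop) : ℝ → ℝ → ℝ → ℝ → ℕ → Prop
  /-- The bounds are close enough. -/
  | done (a b : ℝ) (h : b - a ≤ ε / 2) : GuessLoop O s ε solve a b a b 0
  /-- The guess `γ = (a + b) / 2` is too small. -/
  | small (a b a' b' : ℝ) (l u : S → ℝ) (N N' : ℕ) (h : ε / 2 < b - a)
      (hsolve : solve ((a + b) / 2) l u N)
      (hl : (a + b) / 2 < O.bellmanUpdate M l s)
      (hrest : GuessLoop O s ε solve ((a + b) / 2) b a' b' N') :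
      GuessLoop O s ε solve a b a' b' (N + 1 + N')
  /-- The guess `γ = (a + b) / 2` is too large. -/
  | large (a b a' b' : ℝ) (l u : S → ℝ) (N N' : ℕ) (h : ε / 2 < b - a)
      (hsolve : solve ((a + b) / 2) l u N)
      (hl : ¬ (a + b) / 2 < O.bellmanUpdate M l s)
      (hu : O.bellmanUpdate M u s < (a + b) / 2)
      (hrest : GuessLoop O s ε solve a ((a + b) / 2) a' b' N') :
      GuessLoop O s ε solve a b a' b' (N + 2 + N')
  /-- The guess `γ = (a + b) / 2` is approximately correct. -/
  | close (a b a' b' : ℝ) (l u : S → ℝ) (N N' : ℕ) (h : ε / 2 < b - a)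
      (hsolve : solve ((a + b) / 2) l u N)
      (hl : ¬ (a + b) / 2 < O.bellmanUpdate M l s)
      (hu : ¬ O.bellmanUpdate M u s < (a + b) / 2)
      (hrest : GuessLoop O s ε solve ((a + b) / 2 - ε / 4) ((a + b) / 2 + ε / 4) a' b' N') :
      GuessLoop O s ε solve a b a' b' (N + 2 + N')

/-- `SolveWithGuessingSet M L O ε l u N`: guessing value iteration on the chain `M` with objective
`O`, error `ε`, and the marked states `L`, which are guessed in the order of the list, terminates
with the bounds `l`, `u`, after `N` Bellman updates. -/
def SolveWithGuessingSet : List S → Objective S → ℝ → (S → ℝ) → (S → ℝ) → ℕ → Prop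
  | [], O, ε, l, u, N => IVI M O ε l u N
  | s :: L, O, ε, l, u, N =>
      ∃ (a b : ℝ) (l' u' : S → ℝ) (N₁ N₂ N₃ : ℕ),
        GuessLoop M O s ε
          (fun γ => SolveWithGuessingSet L (O.guess s γ)
            (ε * (1 / 4 * M.pmin ^ Fintype.card S)))
          (initLower O s) (initUpper M O s) a b N₁ ∧
        SolveWithGuessingSet L (O.guess s a) (ε / 4) l u' N₂ ∧
        SolveWithGuessingSet L (O.guess s b) (ε / 4) l' u N₃ ∧
        N = N₁ + N₂ + N₃

end GuessingVI

end

/-! ## A word RAM with step counts -/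

/-- A state of the random access machine: registers and memory cells. -/
structure RAMState where
  reg : ℕ → ℕ
  mem : ℕ → ℕ

/-- Arithmetic expressions of the machine. -/
inductive RAMExpr
  | const (c : ℕ)
  | reg (x : ℕ)
  | load (addr : RAMExpr)
  | add (e f : RAMExpr)
  | sub (e f : RAMExpr)

namespace RAMExpr

/-- The value of an expression (subtraction is truncated). -/
def eval (σ : RAMState) : RAMExpr → ℕ
  | const c => c
  | reg x => σ.reg x
  | load e => σ.mem (e.eval σ)
  | add e f => e.eval σ + f.eval σ
  | sub e f => e.eval σ - f.eval σ

/-- The number of steps that the evaluation takes: one for each operation. -/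
def cost : RAMExpr → ℕ
  | const _ => 1
  | reg _ => 1
  | load e => e.cost + 1
  | add e f => e.cost + f.cost + 1
  | sub e f => e.cost + f.cost + 1

/-- The evaluation only produces numbers that are at most `B` and only reads memory cells whose
address is less than `B`. -/
def Fits (B : ℕ) (σ : RAMState) : RAMExpr → Prop
  | const c => c ≤ B
  | reg x => σ.reg x ≤ B
  | load e => e.Fits B σ ∧ e.eval σ < B ∧ σ.mem (e.eval σ) ≤ B
  | add e f => e.Fits B σ ∧ f.Fits B σ ∧ e.eval σ + f.eval σ ≤ B
  | sub e f => e.Fits B σ ∧ f.Fits B σ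

end RAMExpr

/-- Programs of the machine. The tests of `ite` and `while` are comparisons `e < f`. -/
inductive RAMProg
  | skip
  | assign (x : ℕ) (e : RAMExpr)
  | store (addr e : RAMExpr)
  | seq (p q : RAMProg)
  | ite (e f : RAMExpr) (p q : RAMProg)
  | while (e f : RAMExpr) (p : RAMProg)

/-- `RAMRuns B p σ σ' t`: started in `σ`, the program `p` halts in `σ'` after `t` steps, and during
the run it only touches the memory cells `0, …, B - 1` and only handles numbers that are at
most `B` (so it uses `B` memory words and the registers of `p`, with words of `O(log B)` bits). -/
inductive RAMRuns (B : ℕ) : RAMProg → RAMState → RAMState → ℕ → Prop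
  | skip (σ : RAMState) : RAMRuns B .skip σ σ 1
  | assign (σ : RAMState) (x : ℕ) (e : RAMExpr) (he : e.Fits B σ) :
      RAMRuns B (.assign x e) σ { σ with reg := Function.update σ.reg x (e.eval σ) } (e.cost + 1)
  | store (σ : RAMState) (a e : RAMExpr) (ha : a.Fits B σ) (he : e.Fits B σ)
      (haddr : a.eval σ < B) :
      RAMRuns B (.store a e) σ { σ with mem := Function.update σ.mem (a.eval σ) (e.eval σ) }
        (a.cost + e.cost + 1)
  | seq (p q : RAMProg) (σ σ' σ'' : RAMState) (t t' : ℕ)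
      (hp : RAMRuns B p σ σ' t) (hq : RAMRuns B q σ' σ'' t') :
      RAMRuns B (.seq p q) σ σ'' (t + t')
  | ite_true (e f : RAMExpr) (p q : RAMProg) (σ σ' : RAMState) (t : ℕ)
      (he : e.Fits B σ) (hf : f.Fits B σ) (h : e.eval σ < f.eval σ) (hp : RAMRuns B p σ σ' t) :
      RAMRuns B (.ite e f p q) σ σ' (e.cost + f.cost + 1 + t)
  | ite_false (e f : RAMExpr) (p q : RAMProg) (σ σ' : RAMState) (t : ℕ)
      (he : e.Fits B σ) (hf : f.Fits B σ) (h : ¬ e.eval σ < f.eval σ) (hq : RAMRuns B q σ σ' t) :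
      RAMRuns B (.ite e f p q) σ σ' (e.cost + f.cost + 1 + t)
  | while_true (e f : RAMExpr) (p : RAMProg) (σ σ' σ'' : RAMState) (t t' : ℕ)
      (he : e.Fits B σ) (hf : f.Fits B σ) (h : e.eval σ < f.eval σ) (hp : RAMRuns B p σ σ' t)
      (hrest : RAMRuns B (.while e f p) σ' σ'' t') :
      RAMRuns B (.while e f p) σ σ'' (e.cost + f.cost + 1 + t + t')
  | while_false (e f : RAMExpr) (p : RAMProg) (σ : RAMState)
      (he : e.Fits B σ) (hf : f.Fits B σ) (h : ¬ e.eval σ < f.eval σ) :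
      RAMRuns B (.while e f p) σ σ (e.cost + f.cost + 1)

/-- The initial memory for the graph on `{0, …, n - 1}` with the given list of edges and the target
set `T`: the number of states, the number of edges, one mark for each state (`1` for targets, `0`
otherwise), and the edges, each as its source followed by its end. All else is `0`. -/
def graphInput {n : ℕ} (T : Finset (Fin n)) (edges : List (Fin n × Fin n)) : RAMState where
  reg := fun _ => 0
  mem := fun a =>
    ([n, edges.length] ++ List.ofFn (fun i : Fin n => if i ∈ T then (1 : ℕ) else 0) ++
      edges.flatMap (fun e : Fin n × Fin n => [(e.1 : ℕ), (e.2 : ℕ)])).getD a 0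

/-- The final memory represents the set `I`: the marks of the states are now the marks of `I`. -/
def IsOutput {n : ℕ} (σ : RAMState) (I : Finset (Fin n)) : Prop :=
  ∀ i : Fin n, σ.mem (2 + i) = if i ∈ I then 1 else 0

/-! Value. A payoff is a sum over time of weights collected as long as no target was visited
earlier, so its expectation is the Neumann series of the chain killed on `T`. Uniqueness of the
Bellman fixpoint makes the linear map `I - P` (with identity rows on `T`) injective, hence
bijective, and this forces every state to reach `T` (`HasUniqueFixpoint.allReach`). From then on the
maximum principle gives existence, uniqueness and comparison of fixpoints, and the fixpoint is the
value (`Regular.value_eq`).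

Marking. Let n be the number of states. Among k ≥ 2 levels at least k/4 lie in the middle third, so
the smallest of these has at most 4n/k states, and marking it leaves at most 2k/3 levels. The marked
sizes are dominated by a geometric series whose last term has k > √n. Hence at most 12√n states are
marked (`MarkToGuess.card_le`), at most √n levels remain, and there are O(log n) rounds.

Guessing. Let p be the smallest probability. If s receives a wrong value γ, the fixpoint v' of the
reduced chain differs from v by a function that vanishes on `T`, is harmonic off `T` and s, and is
extremal at s. From s the chain reaches `T` without returning to s with probability at least pⁿ, so
the Bellman update of v' at s moves from γ towards v(s) by at least pⁿ|v(s) - γ|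
(`avg_le_of_harmonic`, `Regular.guess_small`, `Regular.guess_large`). Bounds for v' with error pⁿε/4
therefore either reveal on which side of v(s) the guess lies, or certify |v(s) - γ| ≤ ε/4. This
makes the bisection sound. A final interval [a, b] of length ε/2 around v(s) sandwiches v between
the fixpoints for a and b, which differ by at most b - a.

Counting. Interval iteration shrinks the gap by the factor 1 - pᵏ every k iterations, and k ≤ √n
once all marked states are targets. One recursive call multiplies the ratio of weights to error by
at most 4(n+1)/p²ⁿ, so the logarithms of all ratios stay below one Λ = O(log ρ + n²/p), where ρ =
max(2, w_max/ε). A bisection thus costs a factor of at most 4 + 2Λ, and the depth is at most 12√n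
(`solveWithGuessingSet_spec`, `pow_bound_of_updates`).

Program. A round is a breadth-first search against the edges, with linked lists of incoming edges,
followed by a few passes over the states, all in time O(n + m). It is verified in a small array
language that compiles to the word RAM with linear memory, and `roundBound` limits the number of
rounds. -/

noncomputable section

/-! ### The path measure and the chain killed on the targets -/

namespace MarkovChain

variable {S : Type*} [Fintype S] [MeasurableSpace S] [DiscreteMeasurableSpace S]
  (M : MarkovChain S)

theorem map_zero_pathMeasure (s : S) :
    (M.pathMeasure s).map (fun ω => ω 0) = Measure.dirac s := by
  have h : (M.pathMeasure s).map (Preorder.frestrictLe (π := fun _ : ℕ => S) 0) =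
      (Measure.dirac s).map (MeasurableEquiv.piUnique (fun _ : Finset.Iic 0 => S)).symm := by
    unfold pathMeasure Kernel.trajMeasure
    rw [Measure.map_comp _ _ (by fun_prop), Kernel.traj_map_frestrictLe,
      Kernel.partialTraj_self, Measure.id_comp]
  have h2 : (fun ω : ℕ → S => ω 0) =
      (fun x : (i : Finset.Iic 0) → S => x ⟨0, by simp⟩) ∘
        Preorder.frestrictLe (π := fun _ : ℕ => S) 0 := rfl
  rw [h2, ← Measure.map_map (by fun_prop) (by fun_prop), h,
    Measure.map_map (by fun_prop) (by fun_prop)]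
  convert Measure.map_id
  ext x
  rfl

/-- The Markov property. The joint law of the history and the next state is the law of the history
composed with the transition kernel, and this kernel only sees the last state. -/
theorem lintegral_pathMeasure_succ (s : S) (t : ℕ) (F : ((i : Finset.Iic t) → S) → S → ENNReal) :
    ∫⁻ ω, F (Preorder.frestrictLe (π := fun _ : ℕ => S) t ω) (ω (t + 1)) ∂(M.pathMeasure s) =
      ∫⁻ ω, ∑ s', M.δ (ω t) s' * F (Preorder.frestrictLe (π := fun _ : ℕ => S) t ω) s'
        ∂(M.pathMeasure s) := by
  have key := Kernel.map_frestrictLe_trajMeasure_compProd_eq_map_trajMeasure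
    (X := fun _ : ℕ => S) (μ₀ := Measure.dirac s) (κ := M.historyKernel) (a := t)
  have hF : Measurable (fun p : ((i : Finset.Iic t) → S) × S => F p.1 p.2) := .of_discrete
  have h1 := lintegral_map (μ := M.pathMeasure s) hF
    (g := fun ω => (Preorder.frestrictLe (π := fun _ : ℕ => S) t ω, ω (t + 1))) (by fun_prop)
  rw [← h1]
  unfold pathMeasure
  rw [← key, Measure.lintegral_compProd hF, lintegral_map .of_discrete (by fun_prop)]
  congr 1
  ext ω
  have : M.historyKernel t (Preorder.frestrictLe (π := fun _ : ℕ => S) t ω) =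
      (M.δ (ω t)).toMeasure := rfl
  rw [this, lintegral_fintype]
  refine Finset.sum_congr rfl fun x _ => ?_
  rw [PMF.toMeasure_apply_singleton _ _ (measurableSet_singleton x), mul_comm]

open Classical in
/-- One step of the chain that is killed on `T`. -/
def killedStep (T : Finset S) (f : S → ENNReal) (s : S) : ENNReal :=
  if s ∈ T then 0 else ∑ s', M.δ s s' * f s'

open Classical in
-- The induction varies `f`: conditioning on the history up to `t` replaces `f` by its killed step,
-- since survival up to then is determined by this history. Only times before `t` are tested, so the
-- first visited target still contributes.
theorem lintegral_alive (T : Finset S) (s : S) (t : ℕ) (f : S → ENNReal) :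
    ∫⁻ ω, (if ∀ i < t, ω i ∉ T then f (ω t) else 0) ∂(M.pathMeasure s) =
      (M.killedStep T)^[t] f s := by
  induction t generalizing f with
  | zero =>
    have h := lintegral_map (μ := M.pathMeasure s) (f := f) .of_discrete
      (g := fun ω => ω 0) (by fun_prop)
    simp [← h, map_zero_pathMeasure]
  | succ t ih =>
    have h := M.lintegral_pathMeasure_succ s t
      (fun h y => if ∀ i : Finset.Iic t, h i ∉ T then f y else 0)
    rw [Function.iterate_succ_apply, ← ih]
    refine Eq.trans ?_ (h.trans ?_)
    · congr 1
      ext ω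
      simp [Preorder.frestrictLe]
    · congr 1
      ext ω
      have e : (∀ i : Finset.Iic t, Preorder.frestrictLe (π := fun _ : ℕ => S) t ω i ∉ T) ↔
          (∀ i < t, ω i ∉ T) ∧ ω t ∉ T := by
        simp only [Subtype.forall, Finset.mem_Iic, Preorder.frestrictLe_apply]
        constructor
        · exact fun h => ⟨fun i hi => h i hi.le, h t le_rfl⟩
        · intro h i hi
          rcases hi.lt_or_eq with h' | rfl
          exacts [h.1 i h', h.2]
      simp only [e, killedStep]
      by_cases h1 : ∀ i < t, ω i ∉ T <;> by_cases h2 : ω t ∈ T <;> simp [h1, h2]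

end MarkovChain

/-! ### Payoffs and values as series -/

namespace Objective

variable {S : Type*} (O : Objective S)

open Classical in
/-- The weight that is collected in a state that is visited before leaving the first target. -/
def gain (s : S) : ℝ :=
  match O.kind with
  | .reach => if s ∈ O.T then O.w s else 0
  | .ssp => O.w s

open Classical in
-- The series runs up to the first visit to the targets, which brings both kinds of objectives into
-- one form. For reachability only its last term can be nonzero. An SSP play that avoids the targets
-- has terms bounded below by the smallest weight, which is positive, so its series diverges.
theorem payoff_eq_tsum [Finite S] (hw : O.kind = .ssp → ∀ s, 0 < O.w s) (ω : ℕ → S) :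
    O.payoff ω = ∑' t, if ∀ i < t, ω i ∉ O.T then ENNReal.ofReal (O.gain (ω t)) else 0 := by
  by_cases h : ∃ t, ω t ∈ O.T
  · have hlt : ∀ t, (∀ i < t, ω i ∉ O.T) ↔ t < Nat.find h + 1 := by
      intro t
      rw [Nat.lt_succ_iff, Nat.le_find_iff]
    simp only [hlt]
    rw [tsum_eq_sum (s := Finset.range (Nat.find h + 1)) (by simp +contextual)]
    rw [Finset.sum_congr rfl (g := fun t => ENNReal.ofReal (O.gain (ω t)))
      (fun t ht => if_pos (Finset.mem_range.1 ht))]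
    unfold payoff gain
    cases hk : O.kind
    · simp only [dif_pos h]
      rw [Finset.sum_range_succ, Finset.sum_eq_zero, if_pos (Nat.find_spec h), zero_add]
      · exact fun t ht => by simp [Nat.find_min h (Finset.mem_range.1 ht)]
    · simp only [dif_pos h]
  · have hall : ∀ t, ω t ∉ O.T := by simpa using h
    unfold payoff gain
    cases hk : O.kind
    · simp [hall]
    · simp only [hall, not_false_eq_true, implies_true, if_true]
      symm
      have : Nonempty S := ⟨ω 0⟩
      obtain ⟨s₀, hs₀⟩ := Finite.exists_min O.w
      have htop : ∑' _ : ℕ, ENNReal.ofReal (O.w s₀) = ⊤ :=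
        ENNReal.tsum_const_eq_top_of_ne_zero (by simpa using hw hk s₀)
      simp only [exists_false, dite_false]
      rw [← top_le_iff, ← htop]
      exact ENNReal.tsum_le_tsum fun t => ENNReal.ofReal_le_ofReal (hs₀ _)

open Classical in
theorem value_eq_tsum [Fintype S] [MeasurableSpace S] [DiscreteMeasurableSpace S]
    (M : MarkovChain S) (hw : O.kind = .ssp → ∀ s, 0 < O.w s) (s : S) :
    O.value M s =
      ∑' t, (M.killedStep O.T)^[t] (fun s => ENNReal.ofReal (O.gain s)) s := by
  unfold value
  simp only [O.payoff_eq_tsum hw]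
  rw [lintegral_tsum]
  · exact tsum_congr fun t => M.lintegral_alive O.T s t (fun s => ENNReal.ofReal (O.gain s))
  · intro t
    refine Measurable.aemeasurable (Measurable.ite ?_ ?_ measurable_const)
    · have h : {ω : ℕ → S | ∀ i < t, ω i ∉ O.T} =
          ⋂ i, ⋂ (_ : i < t), (fun ω : ℕ → S => ω i) ⁻¹' {x | x ∉ O.T} := by
        ext; simp
      rw [h]
      exact MeasurableSet.iInter fun i => MeasurableSet.iInter fun _ =>
        measurable_pi_apply i (MeasurableSet.of_discrete (s := {x | x ∉ O.T}))
    · exact (Measurable.of_discrete (f := fun s => ENNReal.ofReal (O.gain s))).comp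
        (measurable_pi_apply t)

end Objective

end

/-! ### Levels and the effect of marking one of them -/

section LevelLemmas

variable {S : Type*} (E : Finset (S × S))

theorem PathOfLength.mono {A B : Set S} (hAB : A ⊆ B) :
    ∀ {d : ℕ} {s : S}, PathOfLength E A d s → PathOfLength E B d s
  | 0, _, h => hAB h
  | _ + 1, _, ⟨s', he, h⟩ => ⟨s', he, PathOfLength.mono hAB h⟩

variable (T : Finset S)

theorem subset_levelZero : (T : Set S) ⊆ levelZero E T := fun _ h => Or.inl h

theorem pathOfLength_level (s : S) : PathOfLength E (levelZero E T) (level E T s) s := by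
  have hne : {d | PathOfLength E (levelZero E T) d s}.Nonempty := by
    by_cases h : ∃ d, PathOfLength E (T : Set S) d s
    · obtain ⟨d, hd⟩ := h
      exact ⟨d, hd.mono E (subset_levelZero E T)⟩
    · exact ⟨0, Or.inr (by simpa using h)⟩
  exact Nat.sInf_mem hne

theorem level_le {d : ℕ} {s : S} (h : PathOfLength E (levelZero E T) d s) : level E T s ≤ d :=
  Nat.sInf_le h

theorem level_eq_zero_iff {s : S} : level E T s = 0 ↔ s ∈ levelZero E T := by
  constructor
  · intro h
    have := pathOfLength_level E T s
    rwa [h] at this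
  · exact fun h => Nat.le_zero.1 (level_le E T (d := 0) h)

theorem level_le_succ {s s' : S} (h : (s, s') ∈ E) : level E T s ≤ level E T s' + 1 :=
  level_le E T ⟨s', h, pathOfLength_level E T s'⟩

theorem exists_edge_level {s : S} {d : ℕ} (h : level E T s = d + 1) :
    ∃ s', (s, s') ∈ E ∧ level E T s' = d := by
  have hp := pathOfLength_level E T s
  rw [h] at hp
  obtain ⟨s', he, hs'⟩ := hp
  have h1 := level_le E T hs'
  have h2 := level_le_succ E T he
  exact ⟨s', he, by omega⟩

theorem pathOfLength_levelSet [Fintype S] {i e : ℕ} {s : S} (h : level E T s = i + e) :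
    PathOfLength E (levelSet E T i : Set S) e s := by
  induction e generalizing s with
  | zero => simpa [PathOfLength, levelSet] using h
  | succ e ih =>
    obtain ⟨s', he, h'⟩ := exists_edge_level E T (d := i + e) h
    exact ⟨s', he, ih h'⟩

theorem exists_level_eq {s : S} {j : ℕ} (hj : j ≤ level E T s) : ∃ x, level E T x = j := by
  obtain ⟨e, he⟩ := Nat.exists_eq_add_of_le hj
  induction e generalizing s with
  | zero => exact ⟨s, by simpa using he⟩
  | succ e ih =>
    obtain ⟨s', -, h'⟩ := exists_edge_level E T (d := j + e) he
    exact ih (by omega) h'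

theorem level_lt_card [Fintype S] (s : S) : level E T s < Fintype.card S := by
  choose f hf using fun j : Fin (level E T s + 1) =>
    exists_level_eq E T (s := s) (Nat.lt_succ_iff.1 j.2)
  have hinj : Function.Injective f := fun a b hab => Fin.ext (by rw [← hf a, ← hf b, hab])
  simpa using Fintype.card_le_of_injective f hinj

theorem level_le_numLevels [Fintype S] (s : S) : level E T s ≤ numLevels E T :=
  Finset.le_sup (f := level E T) (Finset.mem_univ s)

theorem numLevels_le [Fintype S] {c : ℕ} (h : ∀ s, level E T s ≤ c) : numLevels E T ≤ c :=
  Finset.sup_le fun s _ => h s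

open Classical in
-- A state of level `i ≥ 1` reaches `T`, since otherwise it would have level zero. So every state
-- that reaches the enlarged target set also reaches `T`, and marking does not change which states
-- are cut off. The program therefore has to search for these only once.
theorem levelZero_union [Fintype S] {i : ℕ} (hi : 1 ≤ i) :
    levelZero E (T ∪ levelSet E T i) = levelZero E T ∪ levelSet E T i := by
  have hreach : ∀ s ∈ levelSet E T i, ∃ d, PathOfLength E (T : Set S) d s := by
    intro s hs
    by_contra! h
    have : level E T s = 0 := (level_eq_zero_iff E T).2 (Or.inr h)
    simp only [levelSet, Finset.mem_filter] at hs
    omega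
  ext s
  constructor
  · rintro (h | h)
    · rcases Finset.mem_union.1 h with h | h
      exacts [Or.inl (Or.inl h), Or.inr h]
    · exact Or.inl (Or.inr fun d hd => h d (hd.mono E (by simp)))
  · rintro ((h | h) | h)
    · exact Or.inl (Finset.mem_union_left _ h)
    · right
      intro d hd
      have : ∀ d s, PathOfLength E (↑(T ∪ levelSet E T i) : Set S) d s →
          ∃ d', PathOfLength E (T : Set S) d' s := by
        intro d
        induction d with
        | zero =>
          intro s hs
          rcases Finset.mem_union.1 hs with h | h
          exacts [⟨0, h⟩, hreach s h]
        | succ d ih =>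
          rintro s ⟨s', he, hs'⟩
          obtain ⟨d', hd'⟩ := ih s' hs'
          exact ⟨d' + 1, s', he, hd'⟩
      obtain ⟨d', hd'⟩ := this d s hd
      exact h d' hd'
    · exact Or.inl (Finset.mem_union_right _ h)

open Classical in
-- A state up to level `i` keeps its path to level zero, of length at most `i ≤ 2k/3`. A state above
-- has a path to the marked level, of length at most `k - i ≤ 2k/3`.
theorem three_mul_numLevels_union_le [Fintype S] {i : ℕ} (hi : 1 ≤ i)
    (h1 : numLevels E T ≤ 3 * i) (h2 : 3 * i ≤ 2 * numLevels E T) :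
    3 * numLevels E (T ∪ levelSet E T i) ≤ 2 * numLevels E T := by
  have hz := levelZero_union E T hi
  have : numLevels E (T ∪ levelSet E T i) ≤ 2 * numLevels E T / 3 := by
    refine numLevels_le _ _ fun s => ?_
    have hk := level_le_numLevels E T s
    rcases le_or_gt (level E T s) i with h | h
    · have := level_le E (T ∪ levelSet E T i) (s := s)
        ((pathOfLength_level E T s).mono E (by rw [hz]; exact Set.subset_union_left))
      omega
    · obtain ⟨e, he⟩ := Nat.exists_eq_add_of_le h.le
      have := level_le E (T ∪ levelSet E T i) (s := s)
        ((pathOfLength_levelSet E T he).mono E (by rw [hz]; exact Set.subset_union_right))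
      omega
  omega

open Classical in
-- Pigeonhole over the disjoint levels of the middle third. There are at least `k/4` of them, with
-- equality for `k = 4`; for `k = 1` there is none, whence the assumption `2 ≤ k`.
theorem numLevels_mul_card_le [Fintype S] {i : ℕ} (hk : 2 ≤ numLevels E T)
    (hmin : ∀ j, numLevels E T ≤ 3 * j → 3 * j ≤ 2 * numLevels E T →
        (levelSet E T i).card ≤ (levelSet E T j).card) :
    numLevels E T * (levelSet E T i).card ≤ 4 * Fintype.card S := by
  set k := numLevels E T
  let J := Finset.Icc ((k + 2) / 3) (2 * k / 3)
  have hJ : k ≤ 4 * J.card := by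
    simp only [J, Nat.card_Icc]; omega
  have hsum : ∑ j ∈ J, (levelSet E T j).card ≤ Fintype.card S := by
    rw [← Finset.card_biUnion]
    · exact Finset.card_le_univ _
    · intro a _ b _ hab
      rw [Function.onFun, Finset.disjoint_left]
      intro x hx hx'
      simp only [levelSet, Finset.mem_filter] at hx hx'
      exact hab (hx.2.symm.trans hx'.2)
  have hle : J.card * (levelSet E T i).card ≤ ∑ j ∈ J, (levelSet E T j).card := by
    rw [← smul_eq_mul]
    refine Finset.card_nsmul_le_sum _ _ _ fun j hj => ?_
    simp only [J, Finset.mem_Icc] at hj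
    exact hmin j (by omega) (by omega)
  calc k * (levelSet E T i).card ≤ 4 * J.card * (levelSet E T i).card :=
        Nat.mul_le_mul_right _ hJ
    _ = 4 * (J.card * (levelSet E T i).card) := by ring
    _ ≤ _ := by omega

/-! ### The number of marked states -/

namespace MarkToGuess

variable {E T} [Fintype S] {I : Finset S}

open Classical in
theorem numLevels_union_le (h : MarkToGuess E T I) :
    (numLevels E (T ∪ I) : ℝ) ≤ √(Fintype.card S : ℝ) := by
  induction h with
  | few T h => simpa using h
  | many T I i h hi hmin hrec ih => rwa [Finset.union_comm I, ← Finset.union_assoc]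

theorem two_le_of_sqrt_lt [Nonempty S] {k : ℕ} (h : √(Fintype.card S : ℝ) < k) : 2 ≤ k := by
  have h1 : (1 : ℝ) ≤ √(Fintype.card S : ℝ) :=
    Real.one_le_sqrt.2 (by exact_mod_cast Fintype.card_pos)
  have : (1 : ℝ) < k := h1.trans_lt h
  exact_mod_cast this

open Classical in
theorem disjoint [Nonempty S] (h : MarkToGuess E T I) : Disjoint I T := by
  induction h with
  | few => simp
  | many T I i h hi hmin hrec ih =>
    have hk := two_le_of_sqrt_lt h
    rw [Finset.disjoint_union_right] at ih
    refine Finset.disjoint_union_left.2 ⟨ih.1, Finset.disjoint_left.2 fun s hs hT => ?_⟩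
    have := (level_eq_zero_iff E T).2 (Or.inl hT)
    simp only [levelSet, Finset.mem_filter] at hs
    omega

open Classical in
-- A potential argument, with n states. A round with k levels marks at most 4n/k states and leaves
-- k' ≤ 2k/3 levels, so that 8n/k' ≥ 12n/k: the increase of 8n/k pays for the round. In the last
-- round n/k < √n, and the total 12n/k is below 12√n.
theorem card_le_aux [Nonempty S] (h : MarkToGuess E T I) :
    ((numLevels E T : ℝ) ≤ √(Fintype.card S : ℝ) → I = ∅) ∧
    (√(Fintype.card S : ℝ) < numLevels E T → (I.card : ℝ) ≤
      12 * √(Fintype.card S : ℝ) - 8 * Fintype.card S / numLevels E T) := by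
  induction h with
  | few T h => exact ⟨fun _ => rfl, fun h' => absurd h h'.not_ge⟩
  | many T I i h hi hmin hrec ih =>
    refine ⟨fun h' => absurd h h'.not_gt, fun _ => ?_⟩
    have hk := two_le_of_sqrt_lt h
    have hc := numLevels_mul_card_le E T hk hmin
    have hk' := three_mul_numLevels_union_le E T (by omega) hi.1 hi.2
    set r := √(Fintype.card S : ℝ)
    have hr2 : r * r = Fintype.card S := Real.mul_self_sqrt (by positivity)
    have hr : 0 < r := Real.sqrt_pos.2 (by exact_mod_cast Fintype.card_pos)
    have hk0 : (0 : ℝ) < numLevels E T := hr.trans h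
    have hci : ((levelSet E T i).card : ℝ) ≤ 4 * (Fintype.card S / numLevels E T) := by
      rw [← mul_div_assoc, le_div_iff₀ hk0]
      rw [mul_comm]
      exact_mod_cast hc
    have hun : ((I ∪ levelSet E T i).card : ℝ) ≤ I.card + (levelSet E T i).card := by
      exact_mod_cast Finset.card_union_le _ _
    have hnk : (Fintype.card S : ℝ) / numLevels E T ≤ r := by
      rw [div_le_iff₀ hk0, ← hr2]; gcongr
    rw [mul_div_assoc]
    rcases le_or_gt (numLevels E (T ∪ levelSet E T i) : ℝ) r with h' | h'
    · rw [ih.1 h', Finset.card_empty] at hun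
      rw [ih.1 h']
      push_cast at hun
      linarith
    · have := ih.2 h'
      have hk1 : (0 : ℝ) < numLevels E (T ∪ levelSet E T i) := hr.trans h'
      have h3 : 3 * (numLevels E (T ∪ levelSet E T i) : ℝ) ≤ 2 * numLevels E T := by
        exact_mod_cast hk'
      have : 12 * ((Fintype.card S : ℝ) / numLevels E T) ≤
          8 * Fintype.card S / numLevels E (T ∪ levelSet E T i) := by
        rw [← mul_div_assoc, div_le_div_iff₀ hk0 hk1]
        have : (0 : ℝ) ≤ Fintype.card S := by positivity
        nlinarith
      linarith

theorem card_le [Nonempty S] (h : MarkToGuess E T I) :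
    (I.card : ℝ) ≤ 12 * √(Fintype.card S : ℝ) := by
  obtain ⟨h1, h2⟩ := h.card_le_aux
  rcases le_or_gt (numLevels E T : ℝ) √(Fintype.card S : ℝ) with h' | h'
  · rw [h1 h']; simp
  · refine (h2 h').trans (sub_le_self _ (by positivity))

end MarkToGuess

end LevelLemmas

/-! ### Averages and the maximum principle -/

noncomputable section

namespace MarkovChain

variable {S : Type*} (M : MarkovChain S)

theorem prob_nonneg (s s' : S) : 0 ≤ M.prob s s' := ENNReal.toReal_nonneg

theorem ofReal_prob (s s' : S) : ENNReal.ofReal (M.prob s s') = M.δ s s' :=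
  ENNReal.ofReal_toReal ((M.δ s).apply_ne_top s')

theorem prob_le_one (s s' : S) : M.prob s s' ≤ 1 :=
  ENNReal.toReal_le_of_le_ofReal zero_le_one (by simpa using (M.δ s).coe_le_one s')

variable [Fintype S]

theorem sum_prob (s : S) : ∑ s', M.prob s s' = 1 := by
  unfold prob
  have h := (M.δ s).tsum_coe
  rw [tsum_fintype] at h
  rw [← ENNReal.toReal_sum fun s' _ => (M.δ s).apply_ne_top s', h, ENNReal.toReal_one]

theorem mem_edges {s s' : S} : (s, s') ∈ M.edges ↔ 0 < M.prob s s' := by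
  simp [edges]

theorem finite_setOf_prob : {q : ℝ | 0 < q ∧ ∃ s s', M.prob s s' = q}.Finite := by
  refine (Set.finite_range fun x : S × S => M.prob x.1 x.2).subset ?_
  rintro q ⟨-, s, s', rfl⟩
  exact ⟨(s, s'), rfl⟩

theorem pmin_le_prob {s s' : S} (h : 0 < M.prob s s') : M.pmin ≤ M.prob s s' :=
  csInf_le M.finite_setOf_prob.bddBelow ⟨h, s, s', rfl⟩

variable [Nonempty S]

theorem nonempty_setOf_prob : {q : ℝ | 0 < q ∧ ∃ s s', M.prob s s' = q}.Nonempty := by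
  obtain ⟨s⟩ := ‹Nonempty S›
  by_contra! h
  have : ∑ s', M.prob s s' = 0 := Finset.sum_eq_zero fun s' _ => by
    by_contra h0
    have : M.prob s s' ∈ {q : ℝ | 0 < q ∧ ∃ s s', M.prob s s' = q} :=
      ⟨lt_of_le_of_ne (M.prob_nonneg s s') (Ne.symm h0), s, s', rfl⟩
    simp [h] at this
  rw [M.sum_prob] at this
  exact one_ne_zero this

theorem pmin_pos : 0 < M.pmin := (M.nonempty_setOf_prob.csInf_mem M.finite_setOf_prob).1

theorem pmin_le_one : M.pmin ≤ 1 := by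
  obtain ⟨-, s, s', h⟩ := M.nonempty_setOf_prob.csInf_mem M.finite_setOf_prob
  exact h.symm.le.trans (M.prob_le_one s s')

omit [Nonempty S]

/-- The expected value of `f` after one step. -/
def avg (f : S → ℝ) (s : S) : ℝ := ∑ s', M.prob s s' * f s'

theorem avg_const (c : ℝ) (s : S) : M.avg (fun _ => c) s = c := by
  simp [avg, ← Finset.sum_mul, M.sum_prob]

theorem avg_mono {f g : S → ℝ} (h : ∀ s, f s ≤ g s) (s : S) : M.avg f s ≤ M.avg g s :=
  Finset.sum_le_sum fun s' _ => mul_le_mul_of_nonneg_left (h s') (M.prob_nonneg s s')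

theorem avg_sub (f g : S → ℝ) (s : S) : M.avg (fun x => f x - g x) s = M.avg f s - M.avg g s := by
  simp [avg, mul_sub]

theorem avg_neg (f : S → ℝ) (s : S) : M.avg (fun x => -f x) s = -M.avg f s := by
  simp [avg]

/-- One successor with a better bound is singled out. Iterated along a path of length `d`, this
shows that a gain at its end is felt at its start with weight at least `pmin ^ d`. -/
theorem avg_le {f : S → ℝ} {c b : ℝ} {s s' : S} (hf : ∀ x, f x ≤ c) (hb : f s' ≤ b) :
    M.avg f s ≤ M.prob s s' * b + (1 - M.prob s s') * c := by
  classical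
  have h := Finset.add_sum_erase Finset.univ (M.prob s) (Finset.mem_univ s')
  have h' := Finset.add_sum_erase Finset.univ (fun x => M.prob s x * f x) (Finset.mem_univ s')
  rw [M.sum_prob] at h
  rw [avg, ← h', ← h, add_sub_cancel_left, Finset.sum_mul]
  exact add_le_add (mul_le_mul_of_nonneg_left hb (M.prob_nonneg s s'))
    (Finset.sum_le_sum fun x _ => mul_le_mul_of_nonneg_left (hf x) (M.prob_nonneg s x))

/-- Every state reaches the set `A`. -/
def AllReach (A : Finset S) : Prop := ∀ s, ∃ d, PathOfLength M.edges (A : Set S) d s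

variable {M}

theorem AllReach.mono {A B : Finset S} (h : M.AllReach A) (hAB : A ⊆ B) : M.AllReach B :=
  fun s => (h s).imp fun _ hd => hd.mono _ hAB

theorem AllReach.levelZero_eq {A : Finset S} (h : M.AllReach A) :
    levelZero M.edges A = (A : Set S) := by
  ext s
  refine ⟨fun hs => hs.resolve_right fun h' => ?_, fun hs => Or.inl hs⟩
  obtain ⟨d, hd⟩ := h s
  exact h' d hd

/-- The maximum principle. -/
theorem AllReach.le_of_subharmonic {A : Finset S} (hA : M.AllReach A) {h : S → ℝ} {c : ℝ}
    (h0 : ∀ s ∈ A, h s ≤ c) (h1 : ∀ s ∉ A, h s ≤ M.avg h s) (s : S) : h s ≤ c := by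
  have : Nonempty S := ⟨s⟩
  obtain ⟨m, hm⟩ := Finite.exists_max h
  refine (hm s).trans ?_
  obtain ⟨d, hd⟩ := hA m
  -- At a maximum point off `A` every successor attains the maximum too, because otherwise the
  -- average would be smaller. A path into `A` thus carries the maximum to a state where `c` bounds
  -- it.
  have key : ∀ d x, PathOfLength M.edges (A : Set S) d x → h x = h m → h m ≤ c := by
    intro d
    induction d with
    | zero => exact fun x hx hxm => hxm ▸ h0 x hx
    | succ d ih =>
      rintro x ⟨y, hxy, hy⟩ hxm
      by_cases hx : x ∈ A
      · exact hxm ▸ h0 x hx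
      · refine ih y hy (le_antisymm (hm y) ?_)
        have h2 := h1 x hx
        have h3 := M.avg_le (s := x) hm (le_refl (h y))
        have hp := (M.mem_edges).1 hxy
        by_contra! hlt
        nlinarith
  exact key d m hd rfl

end MarkovChain

/-! ### Bellman fixpoints and their identification with the value -/

namespace Objective

open MarkovChain

variable {S : Type*} [Fintype S] (O : Objective S) (M : MarkovChain S)

/-- The vector `v` is a fixpoint of Bellman updates that agrees with the weights on the targets. -/
def IsFixpoint (v : S → ℝ) : Prop :=
  (∀ t ∈ O.T, v t = O.w t) ∧ ∀ s ∉ O.T, v s = O.stepCost s + M.avg v s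

variable {O M}

theorem bellmanUpdate_of_mem {v : S → ℝ} {s : S} (h : s ∈ O.T) : O.bellmanUpdate M v s = v s :=
  if_pos h

theorem bellmanUpdate_of_notMem {v : S → ℝ} {s : S} (h : s ∉ O.T) :
    O.bellmanUpdate M v s = O.stepCost s + M.avg v s := if_neg h

theorem isFixpoint_iff {v : S → ℝ} : O.IsFixpoint M v ↔
    (∀ t ∈ O.T, v t = O.w t) ∧ ∀ s, O.bellmanUpdate M v s = v s := by
  refine and_congr_right fun _ => ⟨fun h s => ?_, fun h s hs => ?_⟩
  · by_cases hs : s ∈ O.T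
    · exact bellmanUpdate_of_mem hs
    · rw [bellmanUpdate_of_notMem hs, h s hs]
  · rw [← bellmanUpdate_of_notMem hs, h s]

theorem bellmanUpdate_mono {f g : S → ℝ} (h : ∀ s, f s ≤ g s) (s : S) :
    O.bellmanUpdate M f s ≤ O.bellmanUpdate M g s := by
  by_cases hs : s ∈ O.T
  · simpa only [bellmanUpdate_of_mem hs] using h s
  · simpa only [bellmanUpdate_of_notMem hs, add_le_add_iff_left] using M.avg_mono h s

variable (O M) in
open Classical in
/-- The linear part `v ↦ v - P v` (off the targets) of the fixpoint equation. -/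
def fixpointMap : (S → ℝ) →ₗ[ℝ] S → ℝ where
  toFun v s := if s ∈ O.T then v s else v s - M.avg v s
  map_add' v w := by
    ext s
    by_cases h : s ∈ O.T <;> simp [h, avg, mul_add, Finset.sum_add_distrib]; ring
  map_smul' c v := by
    ext s
    by_cases h : s ∈ O.T <;> simp [h, avg, mul_sub, Finset.mul_sum, mul_left_comm]

open Classical in
theorem isFixpoint_iff_fixpointMap {v : S → ℝ} : O.IsFixpoint M v ↔
    O.fixpointMap M v = fun s => if s ∈ O.T then O.w s else O.stepCost s := by
  constructor
  · rintro ⟨h1, h2⟩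
    ext s
    by_cases h : s ∈ O.T
    · simp [fixpointMap, h, h1 s h]
    · simp [fixpointMap, h, sub_eq_iff_eq_add, ← h2 s h]
  · intro h
    refine ⟨fun s hs => ?_, fun s hs => ?_⟩
    · simpa [fixpointMap, hs] using congrFun h s
    · simpa [fixpointMap, hs, sub_eq_iff_eq_add] using congrFun h s

theorem HasUniqueFixpoint.exists_isFixpoint (h : O.HasUniqueFixpoint M) : ∃ v, O.IsFixpoint M v :=
  let ⟨v, hv, _⟩ := h
  ⟨v, isFixpoint_iff.2 hv⟩

/-- Uniqueness makes `fixpointMap` injective, hence surjective, so some `f` has image 1. The states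
that cannot reach `T` form a set closed under successors. At a minimum of `f` over this set the
average of `f` is at least `f`, against `f - P f = 1`. -/
theorem HasUniqueFixpoint.allReach (h : O.HasUniqueFixpoint M) : M.AllReach O.T := by
  classical
  obtain ⟨v, hv, huniq⟩ := h
  have hv := isFixpoint_iff_fixpointMap.1 (isFixpoint_iff.2 hv)
  have hinj : Function.Injective (O.fixpointMap M) := by
    rw [← LinearMap.ker_eq_bot, LinearMap.ker_eq_bot']
    intro f hf
    have : v + f = v := huniq _ (isFixpoint_iff.1
      (isFixpoint_iff_fixpointMap.2 (by rw [map_add, hf, add_zero, hv])))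
    simpa using this
  obtain ⟨f, hf⟩ := (LinearMap.injective_iff_surjective.1 hinj) fun _ => 1
  by_contra hr
  simp only [AllReach, not_forall, not_exists] at hr
  let Z : Finset S := Finset.univ.filter fun s => ∀ d, ¬ PathOfLength M.edges (O.T : Set S) d s
  have hZ : Z.Nonempty := hr.imp fun s hs => by simpa [Z] using hs
  obtain ⟨z, hz, hmin⟩ := Z.exists_min_image f hZ
  have hz' : ∀ d, ¬ PathOfLength M.edges (O.T : Set S) d z := by simpa [Z] using hz
  have hzT : z ∉ O.T := hz' 0
  have hfz : f z - M.avg f z = 1 := by simpa [fixpointMap, hzT] using congrFun hf z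
  have : f z ≤ M.avg f z := by
    rw [← M.avg_const (f z) z]
    refine Finset.sum_le_sum fun s' _ => ?_
    rcases (M.prob_nonneg z s').eq_or_lt with h0 | h0
    · simp [← h0]
    · refine mul_le_mul_of_nonneg_left (hmin s' ?_) h0.le
      simp only [Z, Finset.mem_filter, Finset.mem_univ, true_and]
      exact fun d hd => hz' (d + 1) ⟨s', M.mem_edges.2 h0, hd⟩
  linarith

/-- The maximum principle for `f` and `-f` shows that the kernel of `fixpointMap` is trivial, and an
injective endomorphism of a finite-dimensional space is surjective. -/
theorem exists_isFixpoint (h : M.AllReach O.T) : ∃ v, O.IsFixpoint M v := by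
  have hinj : Function.Injective (O.fixpointMap M) := by
    rw [← LinearMap.ker_eq_bot, LinearMap.ker_eq_bot']
    have key : ∀ f, O.fixpointMap M f = 0 → ∀ s, f s ≤ 0 := fun f hf =>
      h.le_of_subharmonic
        (fun s hs => by simpa [fixpointMap, hs] using (congrFun hf s).le)
        (fun s hs => by simpa [fixpointMap, hs] using (congrFun hf s).le)
    refine fun f hf => funext fun s => le_antisymm (key f hf s) ?_
    have := key (-f) (by simp [hf]) s
    simpa using this
  obtain ⟨f, hf⟩ := (LinearMap.injective_iff_surjective.1 hinj) _
  exact ⟨f, isFixpoint_iff_fixpointMap.2 hf⟩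

variable (O M)

/-- The objective has nonnegative (weighted reachability) or positive (SSP) weights, and all states
reach the targets. -/
structure Regular : Prop where
  allReach : M.AllReach O.T
  reach : O.kind = .reach → ∀ t ∈ O.T, 0 ≤ O.w t
  ssp : O.kind = .ssp → ∀ s, 0 < O.w s

/-- The recursion works with `Regular` because a guessed state keeps its transitions in `M`. The
reduced objectives thus lose the absorption of targets that `IsObjectiveOn` demands, whereas
`Regular` is inherited. -/
theorem Regular.of_isObjectiveOn {O : Objective S} {M : MarkovChain S} (h : O.IsObjectiveOn M)
    (hu : O.HasUniqueFixpoint M) : O.Regular M := by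
  refine ⟨hu.allReach, fun hk => ?_, fun hk => ?_⟩
  · have := h.2
    rwa [hk] at this
  · have := h.2
    rwa [hk] at this

variable {O M}

namespace Regular

variable (h : O.Regular M)
include h

theorem stepCost_nonneg (s : S) : 0 ≤ O.stepCost s := by
  unfold stepCost
  cases hk : O.kind
  exacts [le_rfl, (h.ssp hk s).le]

theorem isFixpoint_nonneg {v : S → ℝ} (hv : O.IsFixpoint M v) (s : S) : 0 ≤ v s := by
  have := h.allReach.le_of_subharmonic (h := fun s => -v s) (c := 0) (fun s hs => ?_)
    (fun s hs => ?_) s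
  · simpa using this
  · rw [hv.1 s hs, neg_nonpos]
    cases hk : O.kind
    exacts [h.reach hk s hs, (h.ssp hk s).le]
  · simp only [avg_neg, neg_le_neg_iff]
    rw [hv.2 s hs]
    linarith [h.stepCost_nonneg s]

theorem exists_path (s : S) :
    ∃ d ≤ numLevels M.edges O.T, PathOfLength M.edges (O.T : Set S) d s := by
  refine ⟨_, level_le_numLevels M.edges O.T s, ?_⟩
  rw [← h.allReach.levelZero_eq]
  exact pathOfLength_level M.edges O.T s

theorem nonempty [Nonempty S] : O.T.Nonempty := by
  obtain ⟨s⟩ := ‹Nonempty S›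
  obtain ⟨d, hd⟩ := h.allReach s
  have key : ∀ d s, PathOfLength M.edges (O.T : Set S) d s → O.T.Nonempty := by
    intro d
    induction d with
    | zero => exact fun s hs => ⟨s, hs⟩
    | succ d ih => exact fun s ⟨s', _, hs'⟩ => ih s' hs'
  exact key d s hd

end Regular

open Classical in
/-- One step of the chain that is killed on the targets, on real vectors. -/
def killed (O : Objective S) (M : MarkovChain S) (f : S → ℝ) (s : S) : ℝ :=
  if s ∈ O.T then 0 else M.avg f s

theorem killed_iterate_nonneg {f : S → ℝ} (hf : ∀ s, 0 ≤ f s) (t : ℕ) (s : S) :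
    0 ≤ (O.killed M)^[t] f s := by
  induction t generalizing s with
  | zero => exact hf s
  | succ t ih =>
    rw [Function.iterate_succ_apply', killed]
    split_ifs
    · exact le_rfl
    · exact Finset.sum_nonneg fun s' _ => mul_nonneg (M.prob_nonneg s s') (ih s')

theorem killed_iterate_le {f : S → ℝ} {c : ℝ} (hc : 0 ≤ c) (hf : ∀ s, f s ≤ c) (t : ℕ) (s : S) :
    (O.killed M)^[t] f s ≤ c := by
  induction t generalizing s with
  | zero => exact hf s
  | succ t ih =>
    rw [Function.iterate_succ_apply', killed]
    split_ifs
    · exact hc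
    · exact (M.avg_mono ih s).trans_eq (M.avg_const c s)

/-- With probability at least `pmin ^ d` the play follows the path to the targets, where nothing
positive remains; all other plays contribute at most `c`. Killing acts on leaving a target, so `f ≤
0` on the targets is needed for the case in which the time runs out on arrival. -/
theorem killed_iterate_le_of_path [Nonempty S] {f : S → ℝ} {c : ℝ} (hc : 0 ≤ c)
    (hf : ∀ s, f s ≤ c) (hT : ∀ s ∈ O.T, f s ≤ 0) {d t : ℕ} (hdt : d ≤ t) {s : S}
    (hd : PathOfLength M.edges (O.T : Set S) d s) :
    (O.killed M)^[t] f s ≤ (1 - M.pmin ^ d) * c := by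
  have hp := M.pmin_pos
  have hp1 := M.pmin_le_one
  have hpos : ∀ d, 0 ≤ (1 - M.pmin ^ d) * c := fun d =>
    mul_nonneg (sub_nonneg.2 (pow_le_one₀ hp.le hp1)) hc
  induction d generalizing s t with
  | zero =>
    have hs : s ∈ O.T := hd
    cases t with
    | zero => simpa using hT s hs
    | succ t =>
      rw [Function.iterate_succ_apply', killed, if_pos hs]
      exact hpos _
  | succ d ih =>
    obtain ⟨s', he, hd'⟩ := hd
    obtain ⟨t, rfl⟩ := Nat.exists_eq_add_of_le hdt
    have e : d + 1 + t = (d + t) + 1 := by omega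
    rw [e, Function.iterate_succ_apply', killed]
    split_ifs
    · exact hpos _
    · refine (M.avg_le (killed_iterate_le hc hf _) (ih (by omega) hd')).trans ?_
      have h1 := M.pmin_le_prob (M.mem_edges.1 he)
      have h2 : M.pmin * (M.pmin ^ d * c) ≤ M.prob s s' * (M.pmin ^ d * c) :=
        mul_le_mul_of_nonneg_right h1 (by positivity)
      rw [pow_succ]
      nlinarith

/-- Killing contracts by a constant factor every `numLevels` steps. -/
theorem Regular.killed_iterate_mul_le [Nonempty S] (h : O.Regular M) {f : S → ℝ} {c : ℝ}
    (hc : 0 ≤ c) (hf : ∀ s, f s ≤ c) (hT : ∀ s ∈ O.T, f s ≤ 0) (j : ℕ) (s : S) :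
    (O.killed M)^[numLevels M.edges O.T * j] f s ≤
      (1 - M.pmin ^ numLevels M.edges O.T) ^ j * c := by
  have hp := M.pmin_pos
  have hp1 := M.pmin_le_one
  set k := numLevels M.edges O.T
  have hk : 0 ≤ 1 - M.pmin ^ k := sub_nonneg.2 (pow_le_one₀ hp.le hp1)
  have hTall : ∀ t, ∀ s ∈ O.T, (O.killed M)^[t] f s ≤ 0 := by
    intro t s hs
    cases t with
    | zero => exact hT s hs
    | succ t => rw [Function.iterate_succ_apply', killed, if_pos hs]
  induction j generalizing s with
  | zero => simpa using hf s
  | succ j ih =>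
    obtain ⟨d, hdk, hd⟩ := h.exists_path s
    rw [mul_add, mul_one, add_comm, Function.iterate_add_apply]
    refine (killed_iterate_le_of_path (by positivity) ih (hTall _) hdk hd).trans ?_
    rw [pow_succ', mul_assoc]
    exact mul_le_mul_of_nonneg_right (sub_le_sub_left (pow_le_pow_of_le_one hp.le hp1 hdk) 1)
      (by positivity)

/-- The equation `v = gain + killed v` telescopes: a partial sum of the Neumann series is `v` minus
a killed iterate of `v`. These iterates tend to zero because every state reaches the targets. -/
theorem Regular.value_eq [Nonempty S] [MeasurableSpace S] [DiscreteMeasurableSpace S]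
    (h : O.Regular M) {v : S → ℝ} (hv : O.IsFixpoint M v) (s : S) :
    O.value M s = ENNReal.ofReal (v s) := by
  classical
  have hg : ∀ s, 0 ≤ O.gain s := by
    intro s
    unfold gain
    cases hk : O.kind
    · dsimp only
      split_ifs with hs
      exacts [h.reach hk s hs, le_rfl]
    · exact (h.ssp hk s).le
  have hkill : ∀ t s, (M.killedStep O.T)^[t] (fun s => ENNReal.ofReal (O.gain s)) s =
      ENNReal.ofReal ((O.killed M)^[t] O.gain s) := by
    intro t
    induction t with
    | zero => simp
    | succ t ih =>
      intro s
      rw [Function.iterate_succ_apply', Function.iterate_succ_apply', killedStep, killed]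
      split_ifs
      · simp
      · rw [avg, ENNReal.ofReal_sum_of_nonneg fun s' _ =>
          mul_nonneg (M.prob_nonneg s s') (killed_iterate_nonneg hg t s')]
        refine Finset.sum_congr rfl fun s' _ => ?_
        rw [ih, ENNReal.ofReal_mul (M.prob_nonneg s s'), M.ofReal_prob]
  have hfix : ∀ s, v s = O.gain s + O.killed M v s := by
    intro s
    unfold gain killed
    by_cases hs : s ∈ O.T
    · cases hk : O.kind <;> simp [hs, hv.1 s hs]
    · rw [hv.2 s hs]
      unfold stepCost
      cases hk : O.kind <;> simp [hs]
  have hlin : ∀ f g : S → ℝ, O.killed M (fun s => f s + g s) =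
      fun s => O.killed M f s + O.killed M g s := by
    intro f g
    ext s
    by_cases hs : s ∈ O.T <;> simp [killed, hs, avg, mul_add, Finset.sum_add_distrib]
  have hit : ∀ t s, (O.killed M)^[t] v s =
      (O.killed M)^[t] O.gain s + (O.killed M)^[t + 1] v s := by
    intro t
    induction t with
    | zero => exact fun s => hfix s
    | succ t ih =>
      intro s
      rw [Function.iterate_succ_apply', Function.iterate_succ_apply' _ t O.gain,
        Function.iterate_succ_apply' _ (t + 1), funext ih, hlin]
  have hsum : ∀ t, ∑ i ∈ Finset.range t, (O.killed M)^[i] O.gain s = v s - (O.killed M)^[t] v s := by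
    intro t
    induction t with
    | zero => simp
    | succ t ih => rw [Finset.sum_range_succ, ih, hit t s]; ring
  have hv0 := h.isFixpoint_nonneg hv
  have htend : Filter.Tendsto (fun t => (O.killed M)^[t] v s) Filter.atTop (nhds 0) := by
    obtain ⟨c, hc⟩ : ∃ c, ∀ s, v s ≤ c := by
      obtain ⟨m, hm⟩ := Finite.exists_max v
      exact ⟨_, hm⟩
    have hc0 : 0 ≤ c := (hv0 s).trans (hc s)
    set k := numLevels M.edges O.T
    -- shift by one step, after which the vector vanishes on the targets
    have hb : ∀ x, (O.killed M)^[1] v x ≤ c := killed_iterate_le hc0 hc 1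
    have hT : ∀ x ∈ O.T, (O.killed M)^[1] v x ≤ 0 := fun x hx => by
      simp [killed, hx]
    have hle := fun j => h.killed_iterate_mul_le hc0 hb hT j s
    -- The contraction is available at multiples of `k` only (shifted by one); monotonicity fills
    -- the gaps.
    have hanti : Antitone fun t => (O.killed M)^[t] v s := by
      refine antitone_nat_of_succ_le fun t => ?_
      rw [hit t s]
      linarith [killed_iterate_nonneg (O := O) (M := M) hg t s]
    have hq0 : 0 ≤ 1 - M.pmin ^ k := sub_nonneg.2 (pow_le_one₀ M.pmin_pos.le M.pmin_le_one)
    have hq1 : 1 - M.pmin ^ k < 1 := sub_lt_self _ (pow_pos M.pmin_pos k)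
    rw [Metric.tendsto_atTop]
    intro ε hε
    have hgeo := ((tendsto_pow_atTop_nhds_zero_of_lt_one hq0 hq1).mul_const c)
    rw [zero_mul] at hgeo
    obtain ⟨j, hj⟩ := ((hgeo.eventually_lt_const hε)).exists
    refine ⟨k * j + 1, fun t ht => ?_⟩
    rw [Real.dist_eq, sub_zero, abs_of_nonneg (killed_iterate_nonneg hv0 t s)]
    refine (hanti ht).trans_lt (lt_of_le_of_lt ?_ hj)
    have := hle j
    rwa [← Function.iterate_add_apply] at this
  rw [O.value_eq_tsum M h.ssp s]
  simp only [hkill]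
  have hs : HasSum (fun t => (O.killed M)^[t] O.gain s) (v s) := by
    rw [hasSum_iff_tendsto_nat_of_nonneg fun t => killed_iterate_nonneg hg t s]
    simp only [hsum]
    simpa using htend.const_sub (v s)
  rw [← ENNReal.ofReal_tsum_of_nonneg (fun t => killed_iterate_nonneg hg t s) hs.summable,
    hs.tsum_eq]

end Objective

end

/-! ### Initial bounds and convergence of interval value iteration -/

noncomputable section

namespace Objective

open MarkovChain

variable {S : Type*} [Fintype S] {O : Objective S} {M : MarkovChain S}

theorem w_le_wMax {s : S} (hs : s ∈ O.weightDomain) : O.w s ≤ O.wMax :=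
  le_csSup (Set.toFinite _).bddAbove ⟨s, hs, rfl⟩

omit [Fintype S] in
theorem mem_weightDomain_of_mem {s : S} (hs : s ∈ O.T) : s ∈ O.weightDomain := by
  unfold weightDomain
  cases O.kind
  exacts [hs, trivial]

theorem wMin_le {s : S} (hs : s ∈ O.T) : O.wMin ≤ O.w s :=
  csInf_le (Set.toFinite _).bddBelow ⟨s, hs, rfl⟩

omit [Fintype S] in
theorem initLower_of_mem {s : S} (hs : s ∈ O.T) : initLower O s = O.w s := if_pos hs

theorem initUpper_of_mem {s : S} (hs : s ∈ O.T) : initUpper M O s = O.w s := if_pos hs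

namespace Regular

variable [Nonempty S] (h : O.Regular M)
include h

theorem wMax_le {W : ℝ} (hW : ∀ s ∈ O.weightDomain, O.w s ≤ W) : O.wMax ≤ W := by
  obtain ⟨t, ht⟩ := h.nonempty
  refine csSup_le ⟨_, t, mem_weightDomain_of_mem ht, rfl⟩ ?_
  rintro _ ⟨s, hs, rfl⟩
  exact hW s hs

theorem wMax_nonneg : 0 ≤ O.wMax := by
  obtain ⟨t, ht⟩ := h.nonempty
  refine le_trans ?_ (w_le_wMax (mem_weightDomain_of_mem ht))
  cases hk : O.kind
  exacts [h.reach hk t ht, (h.ssp hk t).le]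

theorem wMin_pos (hk : O.kind = .ssp) : 0 < O.wMin := by
  have hne : (O.w '' (O.T : Set S)).Nonempty := (Finset.coe_nonempty.2 h.nonempty).image _
  obtain ⟨t, -, ht⟩ := hne.csInf_mem (Set.toFinite _)
  exact (h.ssp hk t).trans_eq ht

theorem initLower_nonneg (s : S) : 0 ≤ initLower O s := by
  unfold initLower
  split_ifs with hs
  · cases hk : O.kind
    exacts [h.reach hk s hs, (h.ssp hk s).le]
  · cases hk : O.kind
    exacts [le_rfl, (h.wMin_pos hk).le]

theorem initLower_pos (hk : O.kind = .ssp) (s : S) : 0 < initLower O s := by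
  unfold initLower
  split_ifs with hs
  · exact h.ssp hk s
  · simpa only [hk] using h.wMin_pos hk

omit [Nonempty S] in
-- For SSP the step costs are nonnegative, so `-v` is subharmonic off the targets, and the maximum
-- principle carries the bound `wMin` from the targets to all states.
theorem initLower_le {v : S → ℝ} (hv : O.IsFixpoint M v) (s : S) : initLower O s ≤ v s := by
  unfold initLower
  split_ifs with hs
  · exact (hv.1 s hs).ge
  · cases hk : O.kind
    · exact h.isFixpoint_nonneg hv s
    · have := h.allReach.le_of_subharmonic (h := fun s => -v s) (c := -O.wMin) (fun x hx => ?_)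
        (fun x hx => ?_) s
      · simpa using this
      · rw [hv.1 x hx, neg_le_neg_iff]
        exact wMin_le hx
      · simp only [avg_neg, neg_le_neg_iff]
        rw [hv.2 x hx]
        linarith [h.stepCost_nonneg x]

/-- For SSP let `m` maximize `v` and follow a path of length `d ≤ k` from `m` to the targets. At
most `d + 1` weights are paid along it, and it is left with probability at most `1 - pmin ^ d`,
after which `v m` bounds the remaining cost. Hence `pmin ^ d * v m ≤ (d + 1) * wMax`. -/
theorem le_initUpper {v : S → ℝ} (hv : O.IsFixpoint M v) (s : S) : v s ≤ initUpper M O s := by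
  unfold initUpper
  split_ifs with hs
  · exact (hv.1 s hs).le
  · cases hk : O.kind
    · refine h.allReach.le_of_subharmonic (fun x hx => ?_) (fun x hx => ?_) s
      · rw [hv.1 x hx]
        exact w_le_wMax (mem_weightDomain_of_mem hx)
      · simp [hv.2 x hx, stepCost, hk]
    · obtain ⟨m, hm⟩ := Finite.exists_max v
      have hp := M.pmin_pos
      have hp1 := M.pmin_le_one
      have hW := h.wMax_nonneg
      have hw : ∀ x, O.w x ≤ O.wMax := fun x => w_le_wMax (by simp [weightDomain, hk])
      have hv0 := h.isFixpoint_nonneg hv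
      have key : ∀ d x, PathOfLength M.edges (O.T : Set S) d x →
          v x ≤ (d + 1) * O.wMax + (1 - M.pmin ^ d) * v m := by
        intro d
        induction d with
        | zero =>
          intro x hx
          simpa [hv.1 x hx] using hw x
        | succ d ih =>
          rintro x ⟨y, he, hy⟩
          have hpd := pow_pos hp d
          have hpd1 := pow_le_one₀ (n := d + 1) hp.le hp1
          by_cases hx : x ∈ O.T
          · rw [hv.1 x hx]
            have := mul_nonneg (sub_nonneg.2 hpd1) (hv0 m)
            have := mul_nonneg (Nat.cast_nonneg (α := ℝ) (d + 1)) hW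
            linarith [hw x]
          · rw [hv.2 x hx]
            have h1 := M.avg_le (s := x) hm (ih y hy)
            have h2 := M.pmin_le_prob (M.mem_edges.1 he)
            have h3 := M.prob_le_one x y
            have h4 : O.stepCost x ≤ O.wMax := by simpa [stepCost, hk] using hw x
            have h5 : M.pmin * (M.pmin ^ d * v m) ≤ M.prob x y * (M.pmin ^ d * v m) :=
              mul_le_mul_of_nonneg_right h2 (mul_nonneg hpd.le (hv0 m))
            have h6 : M.prob x y * ((d + 1) * O.wMax) ≤ 1 * ((d + 1) * O.wMax) :=
              mul_le_mul_of_nonneg_right h3 (by positivity)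
            rw [pow_succ]
            push_cast
            nlinarith
      obtain ⟨d, hdk, hd⟩ := h.exists_path m
      refine (hm s).trans ?_
      set k := numLevels M.edges O.T
      dsimp only
      rw [le_div_iff₀ (pow_pos hp k)]
      have h1 := key d m hd
      have h2 : v m * M.pmin ^ k ≤ v m * M.pmin ^ d :=
        mul_le_mul_of_nonneg_left (pow_le_pow_of_le_one hp.le hp1 hdk) (hv0 m)
      have h3 : (d : ℝ) * O.wMax ≤ k * O.wMax :=
        mul_le_mul_of_nonneg_right (by exact_mod_cast hdk) hW
      nlinarith

/-- The number of levels is replaced by the number of states, so that the bound has the same form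
for all reduced chains of the recursion. -/
theorem initUpper_le {W : ℝ} (hW : ∀ s ∈ O.weightDomain, O.w s ≤ W) (s : S) :
    initUpper M O s ≤ W * (Fintype.card S + 1) / M.pmin ^ Fintype.card S := by
  have hp := M.pmin_pos
  have hp1 := M.pmin_le_one
  have hWm := h.wMax_le hW
  have hW0 : 0 ≤ W := h.wMax_nonneg.trans hWm
  have hle : W ≤ W * (Fintype.card S + 1) / M.pmin ^ Fintype.card S := by
    rw [le_div_iff₀ (pow_pos hp _)]
    refine mul_le_mul_of_nonneg_left ((pow_le_one₀ hp.le hp1).trans ?_) hW0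
    simp
  unfold initUpper
  split_ifs with hs
  · exact (hW s (mem_weightDomain_of_mem hs)).trans hle
  · cases hk : O.kind
    · exact hWm.trans hle
    · have hk : numLevels M.edges O.T ≤ Fintype.card S :=
        numLevels_le _ _ fun s => (level_lt_card _ _ s).le
      have h1 : (numLevels M.edges O.T : ℝ) + 1 ≤ Fintype.card S + 1 := by
        simpa using hk
      exact div_le_div₀ (by positivity) (mul_le_mul hWm h1 (by positivity) hW0)
        (pow_pos hp _) (pow_le_pow_of_le_one hp.le hp1 hk)

end Regular

theorem iviLower_le {v : S → ℝ} (hv : O.IsFixpoint M v) (h0 : ∀ s, initLower O s ≤ v s) (t : ℕ)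
    (s : S) : iviLower M O t s ≤ v s := by
  induction t generalizing s with
  | zero => exact h0 s
  | succ t ih =>
    rw [iviLower, Function.iterate_succ_apply']
    exact (bellmanUpdate_mono ih s).trans_eq ((isFixpoint_iff.1 hv).2 s)

theorem le_iviUpper {v : S → ℝ} (hv : O.IsFixpoint M v) (h0 : ∀ s, v s ≤ initUpper M O s) (t : ℕ)
    (s : S) : v s ≤ iviUpper M O t s := by
  induction t generalizing s with
  | zero => exact h0 s
  | succ t ih =>
    rw [iviUpper, Function.iterate_succ_apply']
    exact ((isFixpoint_iff.1 hv).2 s).ge.trans (bellmanUpdate_mono ih s)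

/-- Both updates add the same step cost, so the gap evolves under the killed linear part alone. On
the targets both bounds equal `w` at all times. -/
theorem iviUpper_sub_iviLower (t : ℕ) (s : S) : iviUpper M O t s - iviLower M O t s =
    (O.killed M)^[t] (fun s => initUpper M O s - initLower O s) s := by
  have key : ∀ t s, (s ∈ O.T → iviUpper M O t s = O.w s ∧ iviLower M O t s = O.w s) ∧
      iviUpper M O t s - iviLower M O t s =
        (O.killed M)^[t] (fun s => initUpper M O s - initLower O s) s := by
    intro t
    induction t with
    | zero => exact fun s => ⟨fun hs => ⟨initUpper_of_mem hs, initLower_of_mem hs⟩, rfl⟩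
    | succ t ih =>
      intro s
      unfold iviUpper iviLower at ih ⊢
      simp only [Function.iterate_succ_apply']
      by_cases hs : s ∈ O.T
      · simp [bellmanUpdate_of_mem hs, hs, killed, (ih s).1 hs]
      · refine ⟨fun h => absurd h hs, ?_⟩
        rw [bellmanUpdate_of_notMem hs, bellmanUpdate_of_notMem hs, add_sub_add_left_eq_sub,
          ← avg_sub, killed, if_neg hs]
        exact congrArg (fun f => M.avg f s) (funext fun x => (ih x).2)
  exact (key t s).2

namespace Regular

variable [Nonempty S] (h : O.Regular M)
include h

theorem exists_iterations_le {ε R : ℝ} (hε : 0 < ε) (hR : 1 ≤ R)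
    (hD : ∀ s, initUpper M O s ≤ R * ε) :
    ∃ t : ℕ, (∀ s, iviUpper M O t s - iviLower M O t s ≤ ε) ∧
      (t : ℝ) ≤ numLevels M.edges O.T * (Real.log R / M.pmin ^ numLevels M.edges O.T + 1) := by
  have hp := M.pmin_pos
  have hp1 := M.pmin_le_one
  set k := numLevels M.edges O.T with hk
  have hx := pow_pos hp k
  have hx1 := pow_le_one₀ (n := k) hp.le hp1
  have hlog := Real.log_nonneg hR
  -- Each block of `k` iterations contracts by `1 - pmin ^ k ≤ exp (-(pmin ^ k))`, so `log R / pmin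
  -- ^ k` blocks remove the factor `R`.
  refine ⟨k * ⌈Real.log R / M.pmin ^ k⌉₊, fun s => ?_, ?_⟩
  · rw [iviUpper_sub_iviLower]
    refine (h.killed_iterate_mul_le (c := R * ε) (by positivity) (fun s => ?_) (fun s hs => ?_)
      _ s).trans ?_
    · linarith [hD s, h.initLower_nonneg s]
    · rw [initUpper_of_mem hs, initLower_of_mem hs, sub_self]
    · set j := ⌈Real.log R / M.pmin ^ k⌉₊
      have hj : Real.log R ≤ M.pmin ^ k * j := by
        have := Nat.le_ceil (Real.log R / M.pmin ^ k)
        rw [div_le_iff₀ hx] at this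
        linarith
      have h1 : (1 - M.pmin ^ k) ^ j ≤ Real.exp (-(M.pmin ^ k)) ^ j :=
        pow_le_pow_left₀ (by linarith) (by linarith [Real.add_one_le_exp (-(M.pmin ^ k))]) j
      rw [← Real.exp_nat_mul] at h1
      have h2 : Real.exp (j * -(M.pmin ^ k)) ≤ R⁻¹ := by
        rw [← Real.exp_log (by positivity : (0 : ℝ) < R⁻¹), Real.exp_le_exp, Real.log_inv]
        linarith
      calc (1 - M.pmin ^ k) ^ j * (R * ε) ≤ R⁻¹ * (R * ε) := by
            gcongr
            exact h1.trans h2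
        _ = ε := by field_simp
  · push_cast
    gcongr
    exact (Nat.ceil_lt_add_one (by positivity)).le

end Regular

end Objective

/-! ### How a wrong guess shows up in one Bellman update -/

namespace Objective

open MarkovChain

variable {S : Type*} [Fintype S] {O : Objective S} {M : MarkovChain S}

open Classical in
/-- Harmonic vectors that vanish on the targets, with one further boundary state. -/
theorem avg_le_of_harmonic [Nonempty S] (hT : M.AllReach O.T) {s : S} (hs : s ∉ O.T) {f : S → ℝ}
    (h0 : ∀ x ∈ O.T, f x = 0) (hf : 0 ≤ f s) (hh : ∀ x ∉ insert s O.T, f x = M.avg f x) :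
    (∀ x, 0 ≤ f x) ∧ (∀ x, f x ≤ f s) ∧
      M.avg f s ≤ f s * (1 - M.pmin ^ Fintype.card S) := by
  have hp := M.pmin_pos
  have hp1 := M.pmin_le_one
  have hT' : M.AllReach (insert s O.T) := hT.mono (Finset.subset_insert _ _)
  have hle : ∀ x, f x ≤ f s := hT'.le_of_subharmonic
    (fun x hx => by
      rcases Finset.mem_insert.1 hx with rfl | hx
      exacts [le_rfl, (h0 x hx).trans_le hf])
    (fun x hx => (hh x hx).le)
  refine ⟨fun x => ?_, hle, ?_⟩
  · have := hT'.le_of_subharmonic (h := fun x => -f x) (c := 0)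
      (fun x hx => by
        rcases Finset.mem_insert.1 hx with rfl | hx
        exacts [by simpa using hf, by simp [h0 x hx]])
      (fun x hx => by rw [avg_neg, ← hh x hx]) x
    simpa using this
  -- The deficit of `f` against its maximum `f s` loses at most a factor `pmin` when it is passed
  -- back along an edge.
  · have step : ∀ x y d, (x, y) ∈ M.edges → f y ≤ f s * (1 - M.pmin ^ d) →
        M.avg f x ≤ f s * (1 - M.pmin ^ (d + 1)) := by
      intro x y d he hy
      have h1 := M.avg_le (s := x) hle hy
      have h2 : M.pmin * (M.pmin ^ d * f s) ≤ M.prob x y * (M.pmin ^ d * f s) :=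
        mul_le_mul_of_nonneg_right (M.pmin_le_prob (M.mem_edges.1 he)) (by positivity)
      rw [pow_succ]
      nlinarith
    -- The descent towards the targets only visits levels below that of `s`. It never meets `s`
    -- again, and `f` is harmonic along it until the targets are reached.
    have key : ∀ d x, level M.edges O.T x = d → d < level M.edges O.T s →
        f x ≤ f s * (1 - M.pmin ^ d) := by
      intro d
      induction d with
      | zero =>
        intro x hx _
        rw [level_eq_zero_iff, hT.levelZero_eq] at hx
        simp [h0 x hx]
      | succ d ih =>
        intro x hx hd
        obtain ⟨y, he, hy⟩ := exists_edge_level _ _ hx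
        have hxT : x ∉ insert s O.T := by
          rw [Finset.mem_insert, not_or]
          refine ⟨fun e => ?_, fun hxT => ?_⟩
          · rw [e] at hx; omega
          · have := (level_eq_zero_iff M.edges O.T).2 (Or.inl hxT); omega
        rw [hh x hxT]
        exact step x y d he (ih y hy (by omega))
    obtain ⟨d, hd⟩ : ∃ d, level M.edges O.T s = d + 1 := by
      refine Nat.exists_eq_succ_of_ne_zero fun h => hs ?_
      rwa [level_eq_zero_iff, hT.levelZero_eq] at h
    obtain ⟨y, he, hy⟩ := exists_edge_level _ _ hd
    refine (step s y d he (key d y hy (by omega))).trans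
      (mul_le_mul_of_nonneg_left (sub_le_sub_left (pow_le_pow_of_le_one hp.le hp1 ?_) 1) hf)
    have := level_lt_card M.edges O.T s
    omega

section Guess

variable {s : S} {γ : ℝ}

omit [Fintype S] in
theorem mem_guess_T {x : S} : x ∈ (O.guess s γ).T ↔ x = s ∨ x ∈ O.T := by
  simp [guess]

theorem IsFixpoint.guess_self {v : S → ℝ} (h : (O.guess s γ).IsFixpoint M v) : v s = γ := by
  simpa [guess] using h.1 s (mem_guess_T.2 (Or.inl rfl))

theorem IsFixpoint.guess_of_mem {v : S → ℝ} (h : (O.guess s γ).IsFixpoint M v) (hs : s ∉ O.T)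
    {x : S} (hx : x ∈ O.T) : v x = O.w x := by
  have := h.1 x (mem_guess_T.2 (Or.inr hx))
  have hne : x ≠ s := fun e => hs (e ▸ hx)
  simpa [guess, hne] using this

omit [Fintype S] in
theorem stepCost_guess {x : S} (hx : x ≠ s) : (O.guess s γ).stepCost x = O.stepCost x := by
  unfold stepCost guess
  cases O.kind <;> simp [hx]

theorem IsFixpoint.guess_of_notMem {v : S → ℝ} (h : (O.guess s γ).IsFixpoint M v)
    {x : S} (hx : x ∉ (O.guess s γ).T) : v x = O.stepCost x + M.avg v x := by
  rw [h.2 x hx, stepCost_guess fun e => hx (mem_guess_T.2 (Or.inl e))]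

theorem Regular.guess (h : O.Regular M) (hγ : 0 ≤ γ)
    (hγ' : O.kind = .ssp → 0 < γ) : (O.guess s γ).Regular M := by
  refine ⟨h.allReach.mono fun x hx => mem_guess_T.2 (Or.inr hx), fun hk t ht => ?_,
    fun hk t => ?_⟩
  · by_cases e : t = s
    · simpa [Objective.guess, e] using hγ
    · simpa [Objective.guess, e] using h.reach hk t ((mem_guess_T.1 ht).resolve_left e)
  · by_cases e : t = s
    · simpa [Objective.guess, e] using hγ' hk
    · simpa [Objective.guess, e] using h.ssp hk t

omit [Fintype S] in
theorem guess_w_le {W : ℝ} (hW : ∀ s ∈ O.weightDomain, O.w s ≤ W) (hγ : γ ≤ W) :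
    ∀ x ∈ (O.guess s γ).weightDomain, (O.guess s γ).w x ≤ W := by
  intro x hx
  by_cases e : x = s
  · simpa [guess, e] using hγ
  · suffices O.w x ≤ W by simpa [guess, e] using this
    refine hW x ?_
    unfold weightDomain guess at hx
    unfold weightDomain
    cases hk : O.kind <;> simp_all

/-- Comparison of the fixpoint with the fixpoint of the reduced chain for a guess that is too
small. -/
theorem Regular.guess_small [Nonempty S] (h : O.Regular M) (hs : s ∉ O.T) {v v' : S → ℝ}
    (hv : O.IsFixpoint M v) (hv' : (O.guess s γ).IsFixpoint M v') (hγ : γ ≤ v s) :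
    (∀ x, v' x ≤ v x) ∧ (∀ x, v x - v' x ≤ v s - γ) ∧
      (v s - γ) * M.pmin ^ Fintype.card S ≤ O.bellmanUpdate M v' s - γ := by
  -- The step costs of both chains agree away from `s`, so they cancel in the difference, which is
  -- harmonic off the targets and `s`.
  obtain ⟨h1, h2, h3⟩ := avg_le_of_harmonic h.allReach hs (f := fun x => v x - v' x)
    (fun x hx => by rw [hv.1 x hx, hv'.guess_of_mem hs hx, sub_self])
    (by simpa [hv'.guess_self] using hγ)
    (fun x hx => by
      rw [avg_sub, hv'.guess_of_notMem hx, hv.2 x fun h => hx ((mem_guess_T (γ := γ)).2 (Or.inr h))]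
      ring)
  rw [avg_sub] at h3
  rw [hv'.guess_self] at h2 h3
  refine ⟨fun x => sub_nonneg.1 (h1 x), h2, ?_⟩
  rw [bellmanUpdate_of_notMem hs]
  linarith [hv.2 s hs]

/-- Comparison of the fixpoint with the fixpoint of the reduced chain for a guess that is too
large. -/
theorem Regular.guess_large [Nonempty S] (h : O.Regular M) (hs : s ∉ O.T) {v v' : S → ℝ}
    (hv : O.IsFixpoint M v) (hv' : (O.guess s γ).IsFixpoint M v') (hγ : v s ≤ γ) :
    (∀ x, v x ≤ v' x) ∧ (∀ x, v' x - v x ≤ γ - v s) ∧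
      (γ - v s) * M.pmin ^ Fintype.card S ≤ γ - O.bellmanUpdate M v' s := by
  obtain ⟨h1, h2, h3⟩ := avg_le_of_harmonic h.allReach hs (f := fun x => v' x - v x)
    (fun x hx => by rw [hv.1 x hx, hv'.guess_of_mem hs hx, sub_self])
    (by simpa [hv'.guess_self] using hγ)
    (fun x hx => by
      rw [avg_sub, hv'.guess_of_notMem hx, hv.2 x fun h => hx ((mem_guess_T (γ := γ)).2 (Or.inr h))]
      ring)
  rw [avg_sub] at h3
  rw [hv'.guess_self] at h2 h3
  refine ⟨fun x => sub_nonneg.1 (h1 x), h2, ?_⟩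
  rw [bellmanUpdate_of_notMem hs]
  linarith [hv.2 s hs]

end Guess

end Objective

/-! ### The bisection loop -/

section Loop

variable {S : Type*} [Fintype S] {M : MarkovChain S} {O : Objective S} {s : S} {ε x : ℝ}
  {solve : ℝ → (S → ℝ) → (S → ℝ) → ℕ → Prop}

/-- Every call of `solve` with a guess in `[a, b]` is answered, with at most `m` updates, and the
answer compares the guess correctly with `x`. -/
structure SoundOn (M : MarkovChain S) (O : Objective S) (s : S) (ε x : ℝ)
    (solve : ℝ → (S → ℝ) → (S → ℝ) → ℕ → Prop) (m a b : ℝ) : Prop where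
  exists_run : ∀ γ, a ≤ γ → γ ≤ b → ∃ l u N, solve γ l u N
  small : ∀ γ l u N, a ≤ γ → γ ≤ b → solve γ l u N → γ < O.bellmanUpdate M l s → γ ≤ x
  large : ∀ γ l u N, a ≤ γ → γ ≤ b → solve γ l u N → O.bellmanUpdate M u s < γ → x ≤ γ
  close : ∀ γ l u N, a ≤ γ → γ ≤ b → solve γ l u N → ¬ γ < O.bellmanUpdate M l s →
    ¬ O.bellmanUpdate M u s < γ → |x - γ| ≤ ε / 4
  updates_le : ∀ γ l u N, a ≤ γ → γ ≤ b → solve γ l u N → (N : ℝ) ≤ m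

theorem SoundOn.mono {m a b a' b' : ℝ} (h : SoundOn M O s ε x solve m a b) (ha : a ≤ a')
    (hb : b' ≤ b) : SoundOn M O s ε x solve m a' b' :=
  ⟨fun γ h1 h2 => h.exists_run γ (ha.trans h1) (h2.trans hb),
    fun γ l u N h1 h2 => h.small γ l u N (ha.trans h1) (h2.trans hb),
    fun γ l u N h1 h2 => h.large γ l u N (ha.trans h1) (h2.trans hb),
    fun γ l u N h1 h2 => h.close γ l u N (ha.trans h1) (h2.trans hb),
    fun γ l u N h1 h2 => h.updates_le γ l u N (ha.trans h1) (h2.trans hb)⟩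

/-- The exponent `j` counts the halvings still available. The third case ends the loop at once,
because its new interval has length exactly `ε / 2`. -/
theorem SoundOn.exists_guessLoop {m a b : ℝ} (h : SoundOn M O s ε x solve m a b) (hε : 0 < ε)
    (j : ℕ) (hj : b - a ≤ ε / 2 * 2 ^ j) :
    ∃ a' b' N, GuessLoop M O s ε solve a b a' b' N := by
  induction j generalizing a b with
  | zero => exact ⟨a, b, 0, .done a b (by simpa using hj)⟩
  | succ j ih =>
    rcases le_or_gt (b - a) (ε / 2) with hd | hd
    · exact ⟨a, b, 0, .done a b hd⟩
    · obtain ⟨l, u, N, hrun⟩ := h.exists_run ((a + b) / 2) (by linarith) (by linarith)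
      rw [pow_succ] at hj
      by_cases hl : (a + b) / 2 < O.bellmanUpdate M l s
      · obtain ⟨a', b', N', h'⟩ := ih (h.mono (a' := (a + b) / 2) (by linarith) le_rfl)
          (by linarith)
        exact ⟨_, _, _, .small a b a' b' l u N N' hd hrun hl h'⟩
      · by_cases hu : O.bellmanUpdate M u s < (a + b) / 2
        · obtain ⟨a', b', N', h'⟩ := ih (h.mono (b' := (a + b) / 2) le_rfl (by linarith))
            (by linarith)
          exact ⟨_, _, _, .large a b a' b' l u N N' hd hrun hl hu h'⟩
        · exact ⟨_, _, _, .close a b _ _ l u N 0 hd hrun hl hu (.done _ _ (by linarith))⟩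

/-- Every interval contains `x`, and each iteration uses up one of the `j` halvings at a cost of at
most `m + 2`. In the third case `b - a > ε / 2` keeps `γ ± ε / 4` within the old interval, so later
guesses stay where `SoundOn` applies. -/
theorem SoundOn.guessLoop {m a b a' b' : ℝ} {N : ℕ} (h : SoundOn M O s ε x solve m a b)
    (hε : 0 < ε) (hm : 0 ≤ m) (hloop : GuessLoop M O s ε solve a b a' b' N)
    (ha : a ≤ x) (hb : x ≤ b) (j : ℕ) (hj : b - a ≤ ε / 2 * 2 ^ j) :
    a ≤ a' ∧ a' ≤ x ∧ x ≤ b' ∧ b' ≤ b ∧ b' - a' ≤ ε / 2 ∧ (N : ℝ) ≤ j * (m + 2) := by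
  induction hloop generalizing j with
  | done a b hd => exact ⟨le_rfl, ha, hb, le_rfl, hd, by push_cast; positivity⟩
  | small a b a' b' l u N N' hd hsolve hl _ ih =>
    cases j with
    | zero => simp at hj; linarith
    | succ j =>
      rw [pow_succ] at hj
      have hN := h.updates_le _ l u N (by linarith) (by linarith) hsolve
      obtain ⟨h1, h2, h3, h4, h5, h6⟩ := ih (h.mono (by linarith) le_rfl)
        (h.small _ l u N (by linarith) (by linarith) hsolve hl) hb j (by linarith)
      refine ⟨by linarith, h2, h3, h4, h5, ?_⟩
      push_cast
      linarith
  | large a b a' b' l u N N' hd hsolve hl hu _ ih =>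
    cases j with
    | zero => simp at hj; linarith
    | succ j =>
      rw [pow_succ] at hj
      have hN := h.updates_le _ l u N (by linarith) (by linarith) hsolve
      obtain ⟨h1, h2, h3, h4, h5, h6⟩ := ih (h.mono le_rfl (by linarith)) ha
        (h.large _ l u N (by linarith) (by linarith) hsolve hu) j (by linarith)
      refine ⟨h1, h2, h3, by linarith, h5, ?_⟩
      push_cast
      linarith
  | close a b a' b' l u N N' hd hsolve hl hu _ ih =>
    cases j with
    | zero => simp at hj; linarith
    | succ j =>
      have hN := h.updates_le _ l u N (by linarith) (by linarith) hsolve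
      have hx := abs_le.1 (h.close _ l u N (by linarith) (by linarith) hsolve hl hu)
      have hpow : (1 : ℝ) ≤ 2 ^ j := one_le_pow₀ (by norm_num)
      obtain ⟨h1, h2, h3, h4, h5, h6⟩ := ih (h.mono (by linarith) (by linarith))
        (by linarith) (by linarith) j (by nlinarith)
      refine ⟨by linarith, h2, h3, by linarith, h5, ?_⟩
      push_cast
      linarith

end Loop

end

/-! ### The recursion: correctness and number of updates -/

noncomputable section

open Objective MarkovChain

section Solve

variable {S : Type*} [Fintype S] [Nonempty S] (M : MarkovChain S)

/-- The growth of the ratio between weights and error from one recursive call to the next. -/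
def ratioGrowth : ℝ :=
  4 * (Fintype.card S + 1) / (M.pmin ^ Fintype.card S * M.pmin ^ Fintype.card S)

/-- This explains the form of `ratioGrowth`: a guess can exceed the old weights by the factor `(n +
1) / pmin ^ n` of the initial upper bound, while the error of the recursive call shrinks by `pmin ^
n / 4`. -/
theorem ratioGrowth_mul :
    ratioGrowth M * (1 / 4 * M.pmin ^ Fintype.card S) =
      (Fintype.card S + 1) / M.pmin ^ Fintype.card S := by
  have := pow_pos M.pmin_pos (Fintype.card S)
  unfold ratioGrowth
  field_simp

theorem le_ratioGrowth :
    (Fintype.card S + 1) / M.pmin ^ Fintype.card S ≤ ratioGrowth M / 4 := by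
  have h0 := pow_pos M.pmin_pos (Fintype.card S)
  have h1 : M.pmin ^ Fintype.card S ≤ 1 := pow_le_one₀ M.pmin_pos.le M.pmin_le_one
  have h2 : 0 ≤ ratioGrowth M := by unfold ratioGrowth; positivity
  rw [← ratioGrowth_mul]
  nlinarith

theorem four_le_ratioGrowth : 4 ≤ ratioGrowth M := by
  have h0 := pow_pos M.pmin_pos (Fintype.card S)
  have h1 : M.pmin ^ Fintype.card S ≤ 1 := pow_le_one₀ M.pmin_pos.le M.pmin_le_one
  have h2 : (1 : ℝ) ≤ (Fintype.card S + 1) / M.pmin ^ Fintype.card S := by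
    rw [le_div_iff₀ h0]
    have : (0 : ℝ) ≤ Fintype.card S := by positivity
    linarith
  linarith [le_ratioGrowth M]

variable {M}

/-- The ratio `ρ` of weights to error grows by at most `ratioGrowth M` per call while the list gets
shorter by one, so the single number `Λ` bounds the logarithms of the ratios at all depths. Likewise
`κ` bounds the levels at the leaves, where all of `L` has joined the targets. Existence of a run and
its correctness are proved together, because the loop terminates only when the recursive answers are
sound. The summand 4 absorbs the updates at `s` itself, which makes the recurrence purely
multiplicative. -/
theorem solveWithGuessingSet_spec (κ : ℕ) (Λ : ℝ) (L : List S) : ∀ (O : Objective S) (ε ρ : ℝ),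
    0 < ε → 1 ≤ ρ → O.Regular M → L.Nodup → (∀ s ∈ L, s ∉ O.T) →
    (∀ x ∈ O.weightDomain, O.w x ≤ ρ * ε) →
    (∀ T' : Finset S, (∀ x, x ∈ T' ↔ x ∈ O.T ∨ x ∈ L) → numLevels M.edges T' ≤ κ) →
    Real.log ρ + (L.length + 1) * Real.log (ratioGrowth M) ≤ Λ →
    (∃ l u N, SolveWithGuessingSet M L O ε l u N) ∧
    ∀ v, O.IsFixpoint M v → ∀ l u N, SolveWithGuessingSet M L O ε l u N →
      (∀ s, l s ≤ v s ∧ v s ≤ u s ∧ u s - l s ≤ ε) ∧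
      (N : ℝ) + 4 ≤ (4 + 2 * Λ) ^ L.length *
        (2 * Fintype.card S * κ * (Λ / M.pmin ^ κ + 1) + 4) := by
  have hp := M.pmin_pos
  have hp1 := M.pmin_le_one
  have hG := four_le_ratioGrowth M
  have hlogG : 0 ≤ Real.log (ratioGrowth M) := Real.log_nonneg (by linarith)
  have hpn := pow_pos hp (Fintype.card S)
  induction L with
  | nil =>
    intro O ε ρ hε hρ hO _ _ hw hκ hΛ
    have hρG : 1 ≤ ρ * ratioGrowth M := by nlinarith
    have hlog : Real.log (ρ * ratioGrowth M) ≤ Λ := by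
      rw [Real.log_mul (by positivity) (by positivity)]
      simpa using hΛ
    have hΛ0 : 0 ≤ Λ := (Real.log_nonneg hρG).trans hlog
    obtain ⟨t, ht, htle⟩ := hO.exists_iterations_le hε hρG fun s => by
      refine (hO.initUpper_le hw s).trans ?_
      rw [mul_div_assoc]
      have := mul_le_mul_of_nonneg_left (le_ratioGrowth M) (by positivity : 0 ≤ ρ * ε)
      have : 0 ≤ ρ * ε * ratioGrowth M := by positivity
      linarith
    have hex : ∃ t, ∀ s, iviUpper M O t s - iviLower M O t s ≤ ε := ⟨t, ht⟩
    refine ⟨?_, ?_⟩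
    · classical
      refine ⟨_, _, _, Nat.find hex, Nat.find_spec hex, fun t' ht' => ?_, rfl, rfl, rfl⟩
      simpa only [not_forall, not_le] using Nat.find_min hex ht'
    · rintro v hv l u N ⟨t', h1, h2, rfl, rfl, rfl⟩
      refine ⟨fun s => ⟨iviLower_le hv (hO.initLower_le hv) _ s,
        le_iviUpper hv (hO.le_initUpper hv) _ s, h1 s⟩, ?_⟩
      have ht' : t' ≤ t := by
        by_contra! hlt
        obtain ⟨s, hs⟩ := h2 t hlt
        exact (ht s).not_gt hs
      have hk : numLevels M.edges O.T ≤ κ := hκ _ (by simp)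
      have hb : (t' : ℝ) ≤ κ * (Λ / M.pmin ^ κ + 1) := by
        calc (t' : ℝ) ≤ t := by exact_mod_cast ht'
          _ ≤ _ := htle
          _ ≤ _ := by
            refine mul_le_mul (by exact_mod_cast hk) ?_ ?_ (by positivity)
            · have := pow_pos hp κ
              exact add_le_add_left (div_le_div₀ hΛ0 hlog this
                (pow_le_pow_of_le_one hp.le hp1 hk)) _
            · have := Real.log_nonneg hρG
              positivity
      push_cast
      simp only [List.length_nil, pow_zero, one_mul]
      have : (0 : ℝ) ≤ 2 * Fintype.card S := by positivity
      nlinarith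
  | cons s L ih =>
    intro O ε ρ hε hρ hO hnd hdisj hw hκ hΛ
    have hsT : s ∉ O.T := hdisj s (by simp)
    have hsL : s ∉ L := (List.nodup_cons.1 hnd).1
    have hρG : 1 ≤ ρ * ratioGrowth M := by nlinarith
    have hlogρ := Real.log_nonneg hρ
    have hΛ' : Real.log (ρ * ratioGrowth M) + (L.length + 1) * Real.log (ratioGrowth M) ≤ Λ := by
      rw [Real.log_mul (by positivity) (by positivity)]
      simp only [List.length_cons, Nat.cast_add, Nat.cast_one] at hΛ
      linarith
    have hlog : Real.log (ρ * ratioGrowth M) ≤ Λ := by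
      have : 0 ≤ (L.length + 1 : ℝ) * Real.log (ratioGrowth M) := by positivity
      linarith
    have hΛ0 : 0 ≤ Λ := (Real.log_nonneg hρG).trans hlog
    set ε₁ := ε * (1 / 4 * M.pmin ^ Fintype.card S) with hε₁
    set U := ρ * ε * ((Fintype.card S + 1) / M.pmin ^ Fintype.card S) with hU
    have hε₁0 : 0 < ε₁ := by positivity
    have hupper : ∀ x, initUpper M O x ≤ U := fun x =>
      (hO.initUpper_le hw x).trans_eq (mul_div_assoc _ _ _)
    have hU1 : U = ρ * ratioGrowth M * ε₁ := by
      rw [hU, ← ratioGrowth_mul, hε₁]; ring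
    have hU2 : U ≤ ρ * ratioGrowth M * (ε / 4) := by
      have := mul_le_mul_of_nonneg_left (le_ratioGrowth M) (by positivity : 0 ≤ ρ * ε)
      rw [hU]
      linarith
    have hwU : ∀ x ∈ O.weightDomain, O.w x ≤ U := fun x hx => by
      refine (hw x hx).trans (le_mul_of_one_le_right (by positivity) ?_)
      rw [le_div_iff₀ hpn]
      have := pow_le_one₀ (n := Fintype.card S) hp.le hp1
      have : (0 : ℝ) ≤ Fintype.card S := by positivity
      linarith
    -- All recursive calls satisfy the induction hypothesis with ratio `ρ * ratioGrowth M`: guesses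
    -- between the initial bounds are at most `U` (and positive for SSP), and `U` is small enough
    -- for both errors in use, `ε₁` and `ε / 4`.
    have hrec : ∀ γ, initLower O s ≤ γ → γ ≤ initUpper M O s → ∀ ε', 0 < ε' →
        U ≤ ρ * ratioGrowth M * ε' → _ := fun γ h1 h2 ε' hε' hUε =>
      ih (O.guess s γ) ε' (ρ * ratioGrowth M) hε' hρG
        (hO.guess ((hO.initLower_nonneg s).trans h1) fun hk => (hO.initLower_pos hk s).trans_le h1)
        (List.nodup_cons.1 hnd).2
        (fun x hx hx' => by
          rcases mem_guess_T.1 hx' with rfl | hx'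
          exacts [hsL hx, hdisj x (List.mem_cons_of_mem _ hx) hx'])
        (fun x hx => (guess_w_le hwU (h2.trans (hupper s)) x hx).trans hUε)
        (fun T' hT' => hκ T' fun x => by rw [hT', mem_guess_T, List.mem_cons]; tauto)
        hΛ'
    have hfix : ∀ γ, ∃ v', (O.guess s γ).IsFixpoint M v' := fun γ =>
      exists_isFixpoint (hO.allReach.mono fun x hx => mem_guess_T.2 (Or.inr hx))
    set B := (4 + 2 * Λ) ^ L.length *
        (2 * Fintype.card S * κ * (Λ / M.pmin ^ κ + 1) + 4) with hB
    have hB4 : 4 ≤ B := by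
      have h1 : 1 ≤ (4 + 2 * Λ) ^ L.length := one_le_pow₀ (by linarith)
      have h2 : (0 : ℝ) ≤ 2 * Fintype.card S * κ * (Λ / M.pmin ^ κ + 1) := by positivity
      nlinarith
    -- Existence of a run is claimed without a fixpoint at hand, so one is produced here. By the
    -- maximum principle it agrees with any fixpoint given later.
    obtain ⟨v, hv⟩ := exists_isFixpoint hO.allReach
    have hsound : SoundOn M O s ε (v s)
        (fun γ => SolveWithGuessingSet M L (O.guess s γ) ε₁) (B - 4)
        (initLower O s) (initUpper M O s) := by
      have avg_close : ∀ l u : S → ℝ, (∀ x, u x - l x ≤ ε₁) →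
          O.bellmanUpdate M u s - O.bellmanUpdate M l s ≤ ε₁ := by
        intro l u h
        rw [bellmanUpdate_of_notMem hsT, bellmanUpdate_of_notMem hsT, add_sub_add_left_eq_sub,
          ← avg_sub]
        exact (M.avg_mono h s).trans_eq (M.avg_const _ s)
      refine ⟨fun γ h1 h2 => (hrec γ h1 h2 ε₁ hε₁0 hU1.le).1, fun γ l u N h1 h2 hrun hlt => ?_,
        fun γ l u N h1 h2 hrun hlt => ?_, fun γ l u N h1 h2 hrun hl hu => ?_,
        fun γ l u N h1 h2 hrun => ?_⟩
      all_goals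
        obtain ⟨v', hv'⟩ := hfix γ
        obtain ⟨hb, hN⟩ := (hrec γ h1 h2 ε₁ hε₁0 hU1.le).2 v' hv' l u N hrun
        have hlv := bellmanUpdate_mono (O := O) (M := M) (fun x => (hb x).1) s
        have hvu := bellmanUpdate_mono (O := O) (M := M) (fun x => (hb x).2.1) s
      -- If `γ` exceeded `v s`, the update of `v'` at `s` would lie below `γ`, and so would the
      -- update of `l ≤ v'`.
      · by_contra! hcon
        obtain ⟨-, -, h⟩ := hO.guess_large hsT hv hv' hcon.le
        have := mul_pos (sub_pos.2 hcon) hpn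
        linarith
      · by_contra! hcon
        obtain ⟨-, -, h⟩ := hO.guess_small hsT hv hv' hcon.le
        have := mul_pos (sub_pos.2 hcon) hpn
        linarith
      -- If both tests fail, `γ` and the update of `v'` both lie between the updates of `l` and `u`,
      -- which differ by at most `ε₁`. Division by `pmin ^ n` turns `ε₁` into `ε / 4`.
      · have hd := avg_close l u fun x => (hb x).2.2
        have hfin : ∀ δ, δ * M.pmin ^ Fintype.card S ≤ ε₁ → δ ≤ ε / 4 := by
          intro δ h
          rw [hε₁, ← mul_assoc] at h
          have := le_of_mul_le_mul_right h hpn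
          linarith
        rcases le_total γ (v s) with hc | hc
        · obtain ⟨-, -, h⟩ := hO.guess_small hsT hv hv' hc
          rw [abs_of_nonneg (sub_nonneg.2 hc)]
          exact hfin _ (by linarith)
        · obtain ⟨-, -, h⟩ := hO.guess_large hsT hv hv' hc
          rw [abs_sub_comm, abs_of_nonneg (sub_nonneg.2 hc)]
          exact hfin _ (by linarith)
      · linarith
    -- The initial interval is at most `2 * (ρ * ratioGrowth M)` times as long as `ε / 2`. In the
    -- bound for `J`, one unit comes from the factor 2, one from rounding up, and `1 / log 2 < 2`
    -- gives the rest.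
    have hJ : ∃ J : ℕ, initUpper M O s - initLower O s ≤ ε / 2 * 2 ^ J ∧ (J : ℝ) ≤ 2 + 2 * Λ := by
      refine ⟨⌈Real.logb 2 (2 * (ρ * ratioGrowth M))⌉₊, ?_, ?_⟩
      · have h1 : 2 * (ρ * ratioGrowth M) ≤
            (2 : ℝ) ^ ⌈Real.logb 2 (2 * (ρ * ratioGrowth M))⌉₊ := by
          rw [← Real.rpow_natCast, ← Real.logb_le_iff_le_rpow (by norm_num) (by positivity)]
          exact Nat.le_ceil _
        have := hO.initLower_nonneg s
        have := mul_le_mul_of_nonneg_left h1 (by positivity : 0 ≤ ε / 2)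
        have : 0 ≤ ρ * ratioGrowth M * ε := by positivity
        linarith [hupper s]
      · have hl2 : 1 / 2 < Real.log 2 := by linarith [Real.log_two_gt_d9]
        have h0 : 0 ≤ Real.logb 2 (2 * (ρ * ratioGrowth M)) :=
          Real.logb_nonneg (by norm_num) (by linarith)
        refine (Nat.ceil_lt_add_one h0).le.trans ?_
        rw [Real.logb, Real.log_mul (by norm_num) (by positivity), add_div,
          div_self (by positivity)]
        have : Real.log (ρ * ratioGrowth M) / Real.log 2 ≤ 2 * Λ := by
          rw [div_le_iff₀ (by positivity)]
          nlinarith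
        linarith
    obtain ⟨J, hJ1, hJ2⟩ := hJ
    have hlo := hO.initLower_le hv s
    have hup := hO.le_initUpper hv s
    refine ⟨?_, ?_⟩
    · obtain ⟨a, b, N₁, hloop⟩ := hsound.exists_guessLoop hε J hJ1
      obtain ⟨ha, hav, hvb, hb, -, -⟩ := hsound.guessLoop hε (by linarith) hloop hlo hup J hJ1
      obtain ⟨l, u', N₂, h₂⟩ := (hrec a ha (by linarith) (ε / 4) (by linarith) hU2).1
      obtain ⟨l', u, N₃, h₃⟩ := (hrec b (by linarith) hb (ε / 4) (by linarith) hU2).1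
      exact ⟨l, u, _, a, b, l', u', N₁, N₂, N₃, hloop, h₂, h₃, rfl⟩
    · rintro v₂ hv₂ l u N ⟨a, b, l', u', N₁, N₂, N₃, hloop, h₂, h₃, rfl⟩
      have hvv : v₂ s = v s := by
        have hd : ∀ f g, O.IsFixpoint M f → O.IsFixpoint M g → ∀ x, f x ≤ g x := by
          intro f g hf hg x
          have := hO.allReach.le_of_subharmonic (h := fun x => f x - g x) (c := 0)
            (fun x hx => by rw [hf.1 x hx, hg.1 x hx, sub_self])
            (fun x hx => by rw [avg_sub, hf.2 x hx, hg.2 x hx, add_sub_add_left_eq_sub]) x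
          linarith
        exact le_antisymm (hd _ _ hv₂ hv s) (hd _ _ hv hv₂ s)
      obtain ⟨ha, hav, hvb, hb, hab, hN₁⟩ :=
        hsound.guessLoop hε (by linarith) hloop hlo hup J hJ1
      obtain ⟨va, hva⟩ := hfix a
      obtain ⟨vb, hvb'⟩ := hfix b
      obtain ⟨h₂b, h₂N⟩ :=
        (hrec a ha (by linarith) (ε / 4) (by linarith) hU2).2 va hva l u' N₂ h₂
      obtain ⟨h₃b, h₃N⟩ :=
        (hrec b (by linarith) hb (ε / 4) (by linarith) hU2).2 vb hvb' l' u N₃ h₃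
      obtain ⟨hs1, hs2, -⟩ := hO.guess_small hsT hv₂ hva (hav.trans_eq hvv.symm)
      obtain ⟨hl1, hl2, -⟩ := hO.guess_large hsT hv₂ hvb' (hvv.trans_le hvb)
      refine ⟨fun x => ⟨(h₂b x).1.trans (hs1 x), (hl1 x).trans (h₃b x).2.1, ?_⟩, ?_⟩
      -- Each final call contributes `ε / 4`. The fixpoints for `b` and `a` lie within `b - v s` and
      -- `v s - a` of `v`, together at most `b - a ≤ ε / 2`.
      · linarith [h₂b x, h₃b x, hs2 x, hl2 x]
      -- There are at most `J` iterations of cost `B - 4 + 2` and two final calls of cost `B - 4`.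
      -- With 4 added this is at most `(J + 2) * B`.
      · rw [List.length_cons, pow_succ', mul_assoc, ← hB]
        push_cast
        have : (J : ℝ) * (B - 4 + 2) ≤ (2 + 2 * Λ) * (B - 4 + 2) :=
          mul_le_mul_of_nonneg_right hJ2 (by linarith)
        linarith

end Solve

/-- Everything is measured in powers of `X = n * lam / p`, which is at least 1.38 because `n ≥ 2`
and `lam ≥ 0.69`. Constants up to 116 are thus absorbed by `X ^ 16`. This gives `X ^ 18` per guess
and `X ^ (36 + κ)` for a leaf, and the exponent is at most (18 · 12 + 36 + 1)√n = 253√n. -/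
theorem pow_bound_of_updates {n m κ : ℕ} {p lam Λ N : ℝ} (hn : 2 ≤ n) (hp : 0 < p) (hp1 : p ≤ 1)
    (hlam : 0.69 ≤ lam) (hΛ0 : 0 ≤ Λ) (hΛ : Λ ≤ lam + 12 * (n : ℝ) ^ 2 / p)
    (hκn : κ ≤ n) (hm : (m : ℝ) ≤ 12 * √(n : ℝ)) (hκ : (κ : ℝ) ≤ √(n : ℝ))
    (hN : N + 4 ≤ (4 + 2 * Λ) ^ m * (2 * n * κ * (Λ / p ^ κ + 1) + 4)) {C : ℕ} (hC : 253 ≤ C) :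
    N ≤ (n * lam / p) ^ (C * √(n : ℝ)) := by
  set X := n * lam / p with hX
  have hn' : (2 : ℝ) ≤ n := by exact_mod_cast hn
  have hXn : (n : ℝ) ≤ 2 * X := by
    rw [hX, ← mul_div_assoc, le_div_iff₀ hp]
    nlinarith
  have hX1 : 1.38 ≤ X := by
    rw [hX, le_div_iff₀ hp]
    nlinarith
  have hXp : 1 / p ≤ X := by
    rw [hX]
    gcongr
    nlinarith
  have h16 : 116 ≤ X ^ 16 := le_trans (by norm_num) (pow_le_pow_left₀ (by norm_num) hX1 16)
  have hn2 : (n : ℝ) ^ 2 * lam / p = n * X := by rw [hX]; ring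
  have hnX : n * X ≤ 2 * X ^ 2 := by nlinarith
  have hY : 4 + 2 * Λ ≤ X ^ 18 := by
    have h1 : (n : ℝ) ^ 2 / p ≤ 2 * ((n : ℝ) ^ 2 * lam / p) := by
      rw [← mul_div_assoc]
      gcongr
      nlinarith [sq_nonneg (n : ℝ)]
    have h2 : lam ≤ (n : ℝ) ^ 2 * lam / p := by
      rw [le_div_iff₀ hp]
      have h3 : lam * p ≤ lam := mul_le_of_le_one_right (by linarith) hp1
      have h4 : lam ≤ (n : ℝ) ^ 2 * lam :=
        le_mul_of_one_le_left (by linarith) (one_le_pow₀ (by linarith))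
      linarith
    have h3 : 12 * (n : ℝ) ^ 2 / p = 12 * ((n : ℝ) ^ 2 / p) := by ring
    have : 4 + 2 * Λ ≤ 116 * X ^ 2 := by linarith
    nlinarith [sq_nonneg X]
  have hX0 : 1 ≤ X := by linarith
  have hleaf : 2 * n * κ * (Λ / p ^ κ + 1) + 4 ≤ X ^ (36 + κ) := by
    have hpk : Λ / p ^ κ ≤ X ^ (18 + κ) := by
      rw [pow_add, div_eq_mul_one_div, ← one_div_pow]
      gcongr
      linarith
    have h1 : (1 : ℝ) ≤ X ^ (18 + κ) := one_le_pow₀ hX0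
    have h2 : 2 * (n : ℝ) * κ ≤ 8 * X ^ 2 := by
      have : (κ : ℝ) ≤ n := by exact_mod_cast hκn
      nlinarith
    have h3 : 1 ≤ X ^ 2 := one_le_pow₀ hX0
    have h0 : 0 ≤ Λ / p ^ κ := by positivity
    have h4 : 2 * (n : ℝ) * κ * (Λ / p ^ κ + 1) ≤ 8 * X ^ 2 * (2 * X ^ (18 + κ)) :=
      mul_le_mul h2 (by linarith) (by linarith) (by positivity)
    have h5 : 1 ≤ X ^ 2 * X ^ (18 + κ) := one_le_mul_of_one_le_of_one_le h3 h1
    have h6 : X ^ (36 + κ) = X ^ 16 * (X ^ 2 * X ^ (18 + κ)) := by ring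
    rw [h6]
    nlinarith
  have hfin : N ≤ X ^ (18 * m + (36 + κ)) := by
    rw [pow_add, pow_mul]
    have : (4 + 2 * Λ) ^ m * (2 * n * κ * (Λ / p ^ κ + 1) + 4) ≤
        (X ^ 18) ^ m * X ^ (36 + κ) :=
      mul_le_mul (pow_le_pow_left₀ (by linarith) hY m) hleaf (by positivity) (by positivity)
    linarith
  refine hfin.trans ?_
  rw [← Real.rpow_natCast]
  refine Real.rpow_le_rpow_of_exponent_le hX0 ?_
  have hs : 1 ≤ √(n : ℝ) := Real.one_le_sqrt.2 (by linarith)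
  have hC' : (253 : ℝ) ≤ C := by exact_mod_cast hC
  push_cast
  nlinarith

theorem guessingVI_spec {n : ℕ} (hn : 0 < n) (M : MarkovChain (Fin n)) (O : Objective (Fin n))
    {ε : ℝ} (hO : O.IsObjectiveOn M) (hu : O.HasUniqueFixpoint M) (hε : 0 < ε)
    {I : Finset (Fin n)} (hI : MarkToGuess M.edges O.T I) {L : List (Fin n)} (hL : L.Nodup)
    (hLI : ∀ s, s ∈ L ↔ s ∈ I) {C : ℕ} (hC : 253 ≤ C) :
    (∃ (l u : Fin n → ℝ) (N : ℕ), SolveWithGuessingSet M L O ε l u N) ∧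
    ∀ (l u : Fin n → ℝ) (N : ℕ), SolveWithGuessingSet M L O ε l u N →
      (∀ s, O.value M s ≠ ⊤ ∧ l s ≤ (O.value M s).toReal ∧ (O.value M s).toReal ≤ u s ∧
        u s - l s ≤ ε) ∧
      (N : ℝ) ≤ ((n : ℝ) * Real.log (max 2 (O.wMax / ε)) / M.pmin) ^ (C * √(n : ℝ)) := by
  have : Nonempty (Fin n) := ⟨⟨0, hn⟩⟩
  have hreg := Regular.of_isObjectiveOn hO hu
  have hp := M.pmin_pos
  have hp1 := M.pmin_le_one
  have hdisj := hI.disjoint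
  have hcard := hI.card_le
  have hlev : (numLevels M.edges (O.T ∪ I) : ℝ) ≤ √(Fintype.card (Fin n) : ℝ) := by
    convert hI.numLevels_union_le
  have hlen : L.length = I.card := by
    rw [← List.toFinset_card_of_nodup hL]
    congr 1
    ext s
    simp [hLI]
  rw [← hlen] at hcard
  simp only [Fintype.card_fin] at hcard hlev
  set κ := numLevels M.edges (O.T ∪ I) with hκ
  set ρ := max 2 (O.wMax / ε) with hρ
  set Λ := Real.log ρ + (L.length + 1) * Real.log (ratioGrowth M) with hΛ
  have hρ2 : 2 ≤ ρ := le_max_left _ _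
  have hw : ∀ x ∈ O.weightDomain, O.w x ≤ ρ * ε := fun x hx =>
    (w_le_wMax hx).trans ((div_le_iff₀ hε).1 (le_max_right _ _))
  obtain ⟨hex, hall⟩ := solveWithGuessingSet_spec κ Λ L O ε ρ hε (by linarith) hreg hL
    (fun s hs => Finset.disjoint_left.1 hdisj ((hLI s).1 hs)) hw
    (fun T' hT' => by
      have : T' = O.T ∪ I := by ext x; rw [hT', Finset.mem_union, hLI]
      rw [this]) le_rfl
  refine ⟨hex, fun l u N hrun => ?_⟩
  obtain ⟨v, hv⟩ := hu.exists_isFixpoint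
  obtain ⟨h1, h2⟩ := hall v hv l u N hrun
  refine ⟨fun s => ?_, ?_⟩
  · rw [hreg.value_eq hv, ENNReal.toReal_ofReal (hreg.isFixpoint_nonneg hv s)]
    exact ⟨ENNReal.ofReal_ne_top, h1 s⟩
  · rw [Fintype.card_fin] at h2
    have hlogρ : 0.69 ≤ Real.log ρ := by
      have := Real.log_le_log (by norm_num) hρ2
      linarith [Real.log_two_gt_d9]
    have hκn : κ < n := by
      have : κ ≤ n - 1 := numLevels_le _ _ fun s => by
        have := level_lt_card M.edges (O.T ∪ I) s
        rw [Fintype.card_fin] at this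
        omega
      omega
    have hlen_le : L.length ≤ n := by
      rw [hlen]
      simpa using I.card_le_univ
    -- For `n = 1` the base of the claimed bound can be below 1, so powers cannot absorb anything.
    -- In this case nothing is marked, there are no levels above zero, and no update is made.
    rcases Nat.lt_or_ge 1 n with hn1 | hn1
    · have hn1' : (1 : ℝ) ≤ n := by exact_mod_cast hn
      -- By `log x ≤ x - 1`, the terms log 4, log(n+1) and -2n log p are at most 3, n and 2n/p.
      have hG : Real.log (ratioGrowth M) ≤ 6 * n / M.pmin := by
        have hlp : -Real.log M.pmin ≤ 1 / M.pmin := by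
          rw [← Real.log_inv, ← one_div]
          linarith [Real.log_le_sub_one_of_pos (by positivity : 0 < 1 / M.pmin)]
        have hln := Real.log_le_sub_one_of_pos (by positivity : (0 : ℝ) < n + 1)
        have hl4 := Real.log_le_sub_one_of_pos (by norm_num : (0 : ℝ) < 4)
        have hp1' : 1 ≤ 1 / M.pmin := by rw [le_div_iff₀ hp]; linarith
        unfold ratioGrowth
        rw [Fintype.card_fin, Real.log_div (by positivity) (by positivity),
          Real.log_mul (by positivity) (by positivity),
          Real.log_mul (by positivity) (by positivity), Real.log_pow]
        have e : 6 * (n : ℝ) / M.pmin = 6 * n * (1 / M.pmin) := by ring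
        rw [e]
        nlinarith
      have hG0 : 0 ≤ Real.log (ratioGrowth M) :=
        Real.log_nonneg (by linarith [four_le_ratioGrowth M])
      have hΛ0 : 0 ≤ Λ := by positivity
      refine pow_bound_of_updates hn1 hp hp1 hlogρ hΛ0 ?_ hκn.le hcard hlev h2 hC
      have h3 : (L.length + 1 : ℝ) ≤ 2 * n := by
        have : (L.length : ℝ) ≤ n := by exact_mod_cast hlen_le
        linarith
      have h4 := mul_le_mul h3 hG hG0 (by positivity)
      have e : 2 * (n : ℝ) * (6 * n / M.pmin) = 12 * (n : ℝ) ^ 2 / M.pmin := by ring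
      rw [hΛ]
      linarith
    · have hκ0 : κ = 0 := by omega
      have hI0 : I = ∅ := by
        refine hI.card_le_aux.1 ?_
        have : numLevels M.edges O.T ≤ 0 := numLevels_le _ _ fun s => by
          have := level_lt_card M.edges O.T s
          rw [Fintype.card_fin] at this
          omega
        rw [Nat.le_zero.1 this]
        simp
      rw [hlen, hI0, hκ0] at h2
      have : (N : ℝ) ≤ 0 := by simpa using h2
      refine this.trans (Real.rpow_nonneg ?_ _)
      have : 0 ≤ Real.log ρ := by linarith
      positivity

end

/-! ### Array programs -/

/-- The variables of array programs. -/
inductive RegName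
  | n | m | root | square | idx | top | best | front | back | edge | cur | nbr
  deriving DecidableEq

/-- The arrays of array programs. -/
inductive ArrName
  | zero | dist | head | next | queue | count
  deriving DecidableEq

/-- The register that holds a variable; register `0` holds the length of the input. -/
def RegName.toNat (x : RegName) : ℕ := x.ctorIdx + 1

/-- The position of an array in the interleaved memory layout. -/
def ArrName.toNat (k : ArrName) : ℕ := k.ctorIdx

theorem RegName.toNat_injective : Function.Injective RegName.toNat := by
  intro x y h
  cases x <;> cases y <;> first | rfl | cases h

theorem RegName.toNat_ne_zero (x : RegName) : x.toNat ≠ 0 := by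
  cases x <;> simp [RegName.toNat]

theorem ArrName.toNat_injective : Function.Injective ArrName.toNat := by
  intro x y h
  cases x <;> cases y <;> first | rfl | cases h

theorem ArrName.toNat_lt (k : ArrName) : k.toNat < 6 := by
  cases k <;> decide

/-- A state of an array program: variables, input/output cells, and arrays. -/
structure ArrState where
  reg : RegName → ℕ
  inp : ℕ → ℕ
  arr : ArrName → ℕ → ℕ

/-- Expressions of array programs. -/
inductive ArrExpr
  | const (c : ℕ)
  | reg (x : RegName)
  | inp (a : ArrExpr)
  | arr (k : ArrName) (i : ArrExpr)
  | add (e f : ArrExpr)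
  | sub (e f : ArrExpr)

/-- Array programs. -/
inductive ArrProg
  | assign (x : RegName) (e : ArrExpr)
  | store (k : ArrName) (i e : ArrExpr)
  | output (a e : ArrExpr)
  | seq (p q : ArrProg)
  | ite (e f : ArrExpr) (p q : ArrProg)
  | loop (e f : ArrExpr) (p : ArrProg)
  | skip

/-- The memory address of an array cell, where the input has length `D`. -/
def cellAddr (D : ℕ) (c : ArrName × ℕ) : ℕ := D + c.1.toNat + 6 * c.2

/-- The six arrays are interleaved above the input with stride 6: the address minus `D` has the
array as residue and the index as quotient. An index up to a multiple of `D` thus gives an address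
linear in `D`. -/
theorem cellAddr_injective (D : ℕ) : Function.Injective (cellAddr D) := by
  rintro ⟨k, i⟩ ⟨l, j⟩ h
  have h1 := k.toNat_lt
  have h2 := l.toNat_lt
  simp only [cellAddr] at h
  have hkl : k = l := ArrName.toNat_injective (by omega)
  have hij : i = j := by omega
  rw [hkl, hij]

namespace ArrState

/-- The machine state that represents a state of an array program. -/
noncomputable def toRAM (D : ℕ) (s : ArrState) : RAMState where
  reg := Function.extend RegName.toNat s.reg fun x => if x = 0 then D else 0
  mem := Function.extend (cellAddr D) (fun c => s.arr c.1 c.2) s.inp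

/-- All stored numbers are at most `D`. -/
structure Bounded (D : ℕ) (s : ArrState) : Prop where
  reg : ∀ x, s.reg x ≤ D
  inp : ∀ a, s.inp a ≤ D
  arr : ∀ k i, s.arr k i ≤ D

variable (D : ℕ) (s : ArrState)

@[simp] theorem toRAM_reg (x : RegName) : (s.toRAM D).reg x.toNat = s.reg x := by
  simp only [toRAM, RegName.toNat_injective.extend_apply]

@[simp] theorem toRAM_reg_zero : (s.toRAM D).reg 0 = D := by
  simp only [toRAM]
  rw [Function.extend_apply' _ _ _ (by simpa using RegName.toNat_ne_zero), if_pos rfl]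

@[simp] theorem toRAM_mem (k : ArrName) (i : ℕ) :
    (s.toRAM D).mem (D + k.toNat + 6 * i) = s.arr k i := by
  simp only [toRAM]
  exact (cellAddr_injective D).extend_apply _ _ (k, i)

theorem toRAM_mem_of_lt {a : ℕ} (ha : a < D) : (s.toRAM D).mem a = s.inp a := by
  simp only [toRAM]
  refine Function.extend_apply' _ _ _ ?_
  rintro ⟨c, hc⟩
  simp only [cellAddr] at hc
  omega

/-- Assignment of a variable. -/
def setReg (x : RegName) (y : ℕ) : ArrState := { s with reg := Function.update s.reg x y }

/-- Assignment of an array cell. -/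
def setArr (k : ArrName) (i y : ℕ) : ArrState :=
  { s with arr := Function.update s.arr k (Function.update (s.arr k) i y) }

/-- Assignment of an output cell. -/
def setInp (a y : ℕ) : ArrState := { s with inp := Function.update s.inp a y }

theorem toRAM_setReg (x : RegName) (y : ℕ) : (s.setReg x y).toRAM D =
    { s.toRAM D with reg := Function.update (s.toRAM D).reg x.toNat y } := by
  unfold toRAM setReg
  congr 1
  funext a
  dsimp only
  by_cases h : ∃ z, RegName.toNat z = a
  · obtain ⟨z, rfl⟩ := h
    by_cases hz : z = x
    · simp [hz, RegName.toNat_injective.extend_apply]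
    · simp [hz, RegName.toNat_injective.extend_apply, RegName.toNat_injective.ne hz]
  · have hx : a ≠ x.toNat := fun e => h ⟨x, e.symm⟩
    rw [Function.update_of_ne hx, Function.extend_apply' _ _ _ h, Function.extend_apply' _ _ _ h]

theorem toRAM_setArr (k : ArrName) (i y : ℕ) : (s.setArr k i y).toRAM D =
    { s.toRAM D with
      mem := Function.update (s.toRAM D).mem (D + k.toNat + 6 * i) y } := by
  unfold toRAM setArr
  congr 1
  funext a
  dsimp only
  by_cases h : ∃ z, cellAddr D z = a
  · obtain ⟨⟨l, j⟩, rfl⟩ := h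
    have e : D + k.toNat + 6 * i = cellAddr D (k, i) := rfl
    rw [e]
    by_cases hz : (l, j) = (k, i)
    · rw [hz]
      simp [(cellAddr_injective D).extend_apply]
    · rw [Function.update_of_ne ((cellAddr_injective D).ne hz)]
      simp only [(cellAddr_injective D).extend_apply]
      by_cases hl : l = k
      · subst hl
        have : j ≠ i := fun e => hz (by rw [e])
        simp [this]
      · simp [hl]
  · have hx : a ≠ D + k.toNat + 6 * i := fun e => h ⟨(k, i), e.symm⟩
    rw [Function.update_of_ne hx, Function.extend_apply' _ _ _ h, Function.extend_apply' _ _ _ h]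

theorem toRAM_setInp {a : ℕ} (ha : a < D) (y : ℕ) : (s.setInp a y).toRAM D =
    { s.toRAM D with mem := Function.update (s.toRAM D).mem a y } := by
  unfold toRAM setInp
  congr 1
  funext b
  dsimp only
  by_cases h : ∃ z, cellAddr D z = b
  · obtain ⟨⟨l, j⟩, rfl⟩ := h
    have : cellAddr D (l, j) ≠ a := by simp only [cellAddr]; omega
    rw [Function.update_of_ne this]
    simp only [(cellAddr_injective D).extend_apply]
  · rw [Function.extend_apply' _ _ _ h]
    by_cases hb : b = a
    · simp [hb]
    · rw [Function.update_of_ne hb, Function.update_of_ne hb, Function.extend_apply' _ _ _ h]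

variable {D s}

theorem Bounded.setReg (h : s.Bounded D) (x : RegName) {y : ℕ} (hy : y ≤ D) :
    (s.setReg x y).Bounded D := by
  refine ⟨fun z => ?_, h.inp, h.arr⟩
  by_cases hz : z = x
  · simpa [ArrState.setReg, hz] using hy
  · simpa [ArrState.setReg, hz] using h.reg z

theorem Bounded.setInp (h : s.Bounded D) (a : ℕ) {y : ℕ} (hy : y ≤ D) :
    (s.setInp a y).Bounded D := by
  refine ⟨h.reg, fun b => ?_, h.arr⟩
  by_cases hb : b = a
  · simpa [ArrState.setInp, hb] using hy
  · simpa [ArrState.setInp, hb] using h.inp b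

theorem Bounded.setArr (h : s.Bounded D) (k : ArrName) (i : ℕ) {y : ℕ} (hy : y ≤ D) :
    (s.setArr k i y).Bounded D := by
  refine ⟨h.reg, h.inp, fun l j => ?_⟩
  by_cases hl : l = k
  · subst hl
    by_cases hj : j = i
    · simpa [ArrState.setArr, hj] using hy
    · simpa [ArrState.setArr, hj] using h.arr l j
  · simpa [ArrState.setArr, hl] using h.arr l j

end ArrState

namespace ArrExpr

/-- The value of an expression. -/
@[simp] def eval (s : ArrState) : ArrExpr → ℕ
  | const c => c
  | reg x => s.reg x
  | inp a => s.inp (a.eval s)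
  | arr k i => s.arr k (i.eval s)
  | add e f => e.eval s + f.eval s
  | sub e f => e.eval s - f.eval s

/-- Input cells are only read within the input. -/
@[simp] def Ok (D : ℕ) (s : ArrState) : ArrExpr → Prop
  | const _ => True
  | reg _ => True
  | inp a => a.Ok D s ∧ a.eval s < D
  | arr _ i => i.Ok D s
  | add e f => e.Ok D s ∧ f.Ok D s
  | sub e f => e.Ok D s ∧ f.Ok D s

/-- Twice an expression. -/
def dbl (e : RAMExpr) : RAMExpr := .add e e

/-- The address of an array cell. -/
def addr (k : ArrName) (i : RAMExpr) : RAMExpr :=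
  .add (.add (.reg 0) (.const k.toNat)) (.add (dbl (dbl i)) (dbl i))

/-- Compilation of expressions. -/
def compile : ArrExpr → RAMExpr
  | const c => .const c
  | reg x => .reg x.toNat
  | inp a => .load a.compile
  | arr k i => .load (addr k i.compile)
  | add e f => .add e.compile f.compile
  | sub e f => .sub e.compile f.compile

/-- The value of an expression is at most `mag` times the largest stored number. -/
def mag : ArrExpr → ℕ
  | const c => c
  | reg _ => 1
  | inp _ => 1
  | arr _ _ => 1
  | add e f => e.mag + f.mag
  | sub e _ => e.mag

/-- The evaluation produces numbers that are at most `req` times the largest stored number. -/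
def req : ArrExpr → ℕ
  | const c => c
  | reg _ => 1
  | inp a => a.req + 1
  | arr _ i => i.req + 6 * i.mag + 7
  | add e f => e.req + f.req + e.mag + f.mag
  | sub e f => e.req + f.req

/-- The number of steps of the evaluation. -/
def cost (e : ArrExpr) : ℕ := e.compile.cost

variable {B D : ℕ} {s : ArrState}

theorem eval_le (hD : 1 ≤ D) (hs : s.Bounded D) (e : ArrExpr) : e.eval s ≤ e.mag * D := by
  induction e with
  | const c => exact Nat.le_mul_of_pos_right c hD
  | reg x => simpa [mag] using hs.reg x
  | inp a => simpa [mag] using hs.inp _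
  | arr k i => simpa [mag] using hs.arr k _
  | add e f he hf => simp only [eval, mag, add_mul]; omega
  | sub e f he hf => simp only [eval, mag]; omega

theorem eval_addr (k : ArrName) (i : RAMExpr) :
    (addr k i).eval (s.toRAM D) = D + k.toNat + 6 * i.eval (s.toRAM D) := by
  simp only [addr, dbl, RAMExpr.eval, ArrState.toRAM_reg_zero]
  ring

theorem eval_compile (e : ArrExpr) (h : e.Ok D s) : e.compile.eval (s.toRAM D) = e.eval s := by
  induction e with
  | const c => rfl
  | reg x => exact s.toRAM_reg D x
  | inp a ih =>
    simp only [compile, RAMExpr.eval, eval, ih h.1]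
    exact s.toRAM_mem_of_lt D h.2
  | arr k i ih =>
    simp only [compile, RAMExpr.eval, eval, eval_addr, ih h, ArrState.toRAM_mem]
  | add e f he hf => simp [compile, RAMExpr.eval, he h.1, hf h.2]
  | sub e f he hf => simp [compile, RAMExpr.eval, he h.1, hf h.2]

/-- The machine has no multiplication, so `6 * i` is formed by doublings as `4i + 2i`. All
intermediate sums stay below `(6 * μ + 7) * D` because `D ≥ 1` and the offset of an array is at most
5. -/
theorem fits_addr (hD : 1 ≤ D) {v μ : ℕ} (hB : (6 * μ + 7) * D ≤ B) (k : ArrName) (i : RAMExpr)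
    (hi : i.Fits B (s.toRAM D)) (hv : i.eval (s.toRAM D) = v) (hvμ : v ≤ μ * D) :
    (addr k i).Fits B (s.toRAM D) ∧ (addr k i).eval (s.toRAM D) < B := by
  have hk := k.toNat_lt
  have h1 : (6 * μ + 7) * D = 6 * (μ * D) + 7 * D := by ring
  refine ⟨?_, by rw [eval_addr]; omega⟩
  simp only [addr, dbl, RAMExpr.Fits, RAMExpr.eval, ArrState.toRAM_reg_zero]
  refine ⟨⟨?_, ?_, ?_⟩, ⟨⟨⟨hi, hi, ?_⟩, ⟨hi, hi, ?_⟩, ?_⟩, ⟨hi, hi, ?_⟩, ?_⟩, ?_⟩ <;> omega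

theorem fits_compile (hD : 1 ≤ D) (hs : s.Bounded D) (e : ArrExpr) (h : e.Ok D s)
    (hB : e.req * D ≤ B) : e.compile.Fits B (s.toRAM D) := by
  induction e with
  | const c => exact (Nat.le_mul_of_pos_right c hD).trans hB
  | reg x =>
    simp only [compile, RAMExpr.Fits, ArrState.toRAM_reg]
    have := hs.reg x
    simp only [req] at hB
    omega
  | inp a ih =>
    have ha := h.2
    have := hs.inp (a.eval s)
    simp only [req, add_mul] at hB
    refine ⟨ih h.1 (by omega), ?_, ?_⟩
    · rw [eval_compile _ h.1]; omega
    · rw [eval_compile _ h.1, ArrState.toRAM_mem_of_lt _ _ ha]; omega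
  | arr k i ih =>
    have hi : i.req * D + (6 * i.mag + 7) * D ≤ B := by
      refine le_trans (le_of_eq ?_) hB
      simp only [req]
      ring
    obtain ⟨h1, h2⟩ := fits_addr hD (μ := i.mag) (by omega) k i.compile (ih h (by omega))
      (eval_compile i h) (eval_le hD hs i)
    refine ⟨h1, h2, ?_⟩
    rw [eval_addr, ArrState.toRAM_mem]
    have := hs.arr k (i.compile.eval (s.toRAM D))
    have : (6 * i.mag + 7) * D = 6 * (i.mag * D) + 7 * D := by ring
    omega
  | add e f he hf =>
    have h1 := eval_le hD hs e
    have h2 := eval_le hD hs f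
    simp only [req, add_mul] at hB
    refine ⟨he h.1 (by omega), hf h.2 (by omega), ?_⟩
    rw [eval_compile _ h.1, eval_compile _ h.2]
    omega
  | sub e f he hf =>
    simp only [req, add_mul] at hB
    exact ⟨he h.1 (by omega), hf h.2 (by omega)⟩

end ArrExpr

namespace ArrProg

open ArrExpr

/-- Compilation of programs. -/
def compile : ArrProg → RAMProg
  | assign x e => .assign x.toNat e.compile
  | store k i e => .store (addr k i.compile) e.compile
  | output a e => .store a.compile e.compile
  | seq p q => .seq p.compile q.compile
  | ite e f p q => .ite e.compile f.compile p.compile q.compile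
  | loop e f p => .while e.compile f.compile p.compile
  | skip => .skip

/-- The effect of a program without loops. -/
@[simp] def exec : ArrProg → ArrState → ArrState
  | assign x e, s => s.setReg x (e.eval s)
  | store k i e, s => s.setArr k (i.eval s) (e.eval s)
  | output a e, s => s.setInp (a.eval s) (e.eval s)
  | seq p q, s => q.exec (p.exec s)
  | ite e f p q, s => if e.eval s < f.eval s then p.exec s else q.exec s
  | loop _ _ _, s => s
  | skip, s => s

/-- The program has no loops, stores numbers that are at most `D`, and uses the input cells only
within the input. -/
@[simp] def Safe (D : ℕ) : ArrProg → ArrState → Prop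
  | assign _ e, s => e.Ok D s ∧ e.eval s ≤ D
  | store _ i e, s => i.Ok D s ∧ e.Ok D s ∧ e.eval s ≤ D
  | output a e, s => a.Ok D s ∧ e.Ok D s ∧ a.eval s < D ∧ e.eval s ≤ D
  | seq p q, s => p.Safe D s ∧ q.Safe D (p.exec s)
  | ite e f p q, s =>
      e.Ok D s ∧ f.Ok D s ∧ if e.eval s < f.eval s then p.Safe D s else q.Safe D s
  | loop _ _ _, _ => False
  | skip, _ => True

/-- A bound on the number of steps of a program without loops. -/
def cost : ArrProg → ℕ
  | assign _ e => e.cost + 1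
  | store k i e => (addr k i.compile).cost + e.cost + 1
  | output a e => a.cost + e.cost + 1
  | seq p q => p.cost + q.cost
  | ite e f p q => e.cost + f.cost + 1 + (p.cost + q.cost)
  | loop e f _ => e.cost + f.cost + 1
  | skip => 1

/-- The program handles numbers that are at most `req` times the largest stored number. -/
def req : ArrProg → ℕ
  | assign _ e => e.req
  | store k i e => (ArrExpr.arr k i).req + e.req
  | output a e => a.req + e.req + 1
  | seq p q => p.req + q.req
  | ite e f p q => e.req + f.req + p.req + q.req
  | loop e f p => e.req + f.req + p.req
  | skip => 0

/-- Within the memory bound `B`, the program `p` runs from `s` to a state that satisfies `Q`, in at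
most `b` steps. -/
def Runs (B D : ℕ) (p : ArrProg) (s : ArrState) (b : ℕ) (Q : ArrState → Prop) : Prop :=
  p.req * D ≤ B → s.Bounded D → ∃ s' t, RAMRuns B p.compile (s.toRAM D) (s'.toRAM D) t ∧ t ≤ b ∧
    s'.Bounded D ∧ Q s'

variable {B D : ℕ} {p q : ArrProg} {s : ArrState} {b c : ℕ} {Q R : ArrState → Prop}

theorem runs_exec (hD : 1 ≤ D) (hreq : p.req * D ≤ B) (hs : s.Bounded D) (hp : p.Safe D s) :
    ∃ t, RAMRuns B p.compile (s.toRAM D) ((p.exec s).toRAM D) t ∧ t ≤ p.cost ∧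
      (p.exec s).Bounded D := by
  induction p generalizing s with
  | assign x e =>
    have h := RAMRuns.assign (s.toRAM D) x.toNat e.compile (e.fits_compile hD hs hp.1 hreq)
    rw [e.eval_compile hp.1, ← s.toRAM_setReg] at h
    exact ⟨_, h, le_rfl, hs.setReg x hp.2⟩
  | store k i e =>
    obtain ⟨hi, he, hle⟩ := hp
    simp only [req, ArrExpr.req, add_mul] at hreq
    obtain ⟨h1, h2⟩ := fits_addr hD (B := B) (μ := i.mag) (by rw [add_mul]; omega) k i.compile
      (i.fits_compile hD hs hi (by omega)) (eval_compile i hi) (eval_le hD hs i)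
    have h := RAMRuns.store (s.toRAM D) (addr k i.compile) e.compile h1
      (e.fits_compile hD hs he (by omega)) h2
    rw [e.eval_compile he, eval_addr, eval_compile i hi, ← s.toRAM_setArr] at h
    exact ⟨_, h, le_rfl, hs.setArr k _ hle⟩
  | output a e =>
    obtain ⟨ha, he, had, hle⟩ := hp
    simp only [req, add_mul] at hreq
    have had' : a.compile.eval (s.toRAM D) < B := by
      rw [eval_compile a ha]
      omega
    have h := RAMRuns.store (s.toRAM D) a.compile e.compile
      (a.fits_compile hD hs ha (by omega)) (e.fits_compile hD hs he (by omega)) had'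
    rw [e.eval_compile he, eval_compile a ha, ← s.toRAM_setInp D had] at h
    exact ⟨_, h, le_rfl, hs.setInp _ hle⟩
  | seq p q ihp ihq =>
    simp only [req, add_mul] at hreq
    obtain ⟨t, h, ht, hs'⟩ := ihp (by omega) hs hp.1
    obtain ⟨t', h', ht', hs''⟩ := ihq (by omega) hs' hp.2
    exact ⟨_, .seq _ _ _ _ _ _ _ h h', add_le_add ht ht', hs''⟩
  | ite e f p q ihp ihq =>
    obtain ⟨he, hf, hpq⟩ := hp
    simp only [req, add_mul] at hreq
    have he' := e.fits_compile hD hs he (B := B) (by omega)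
    have hf' := f.fits_compile hD hs hf (B := B) (by omega)
    by_cases hef : e.eval s < f.eval s
    · rw [if_pos hef] at hpq
      obtain ⟨t, h, ht, hs'⟩ := ihp (by omega) hs hpq
      simp only [exec, if_pos hef]
      refine ⟨_, .ite_true _ _ _ _ _ _ _ he' hf' ?_ h, ?_, hs'⟩
      · rwa [e.eval_compile he, f.eval_compile hf]
      · simp only [cost, ArrExpr.cost]; omega
    · rw [if_neg hef] at hpq
      obtain ⟨t, h, ht, hs'⟩ := ihq (by omega) hs hpq
      simp only [exec, if_neg hef]
      refine ⟨_, .ite_false _ _ _ _ _ _ _ he' hf' ?_ h, ?_, hs'⟩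
      · rwa [e.eval_compile he, f.eval_compile hf]
      · simp only [cost, ArrExpr.cost]; omega
  | loop e f p => exact hp.elim
  | skip => exact ⟨1, .skip _, le_rfl, hs⟩

/-- Loop-free code is verified by symbolic execution: `exec` and `Safe` unfold by `simp`, and the
bound on the steps is read off the program text. -/
theorem Runs.of_exec (hD : 1 ≤ D) (hp : s.Bounded D → p.Safe D s) (hQ : s.Bounded D → Q (p.exec s)) :
    Runs B D p s p.cost Q := fun hreq hs =>
  let ⟨t, h, ht, hs'⟩ := runs_exec hD hreq hs (hp hs)
  ⟨_, t, h, ht, hs', hQ hs⟩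

theorem Runs.mono (h : Runs B D p s b Q) (hb : b ≤ c) (hQ : ∀ s', s'.Bounded D → Q s' → R s') :
    Runs B D p s c R := fun hreq hs =>
  let ⟨s', t, h, ht, hs', hq⟩ := h hreq hs
  ⟨s', t, h, ht.trans hb, hs', hQ s' hs' hq⟩

theorem Runs.seq (h : Runs B D p s b Q) (h' : ∀ s', Q s' → Runs B D q s' c R) :
    Runs B D (.seq p q) s (b + c) R := fun hreq hs => by
  simp only [req, add_mul] at hreq
  obtain ⟨s', t, h1, ht, hs', hq⟩ := h (by omega) hs
  obtain ⟨s'', t', h2, ht', hs'', hr⟩ := h' s' hq (by omega) hs'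
  exact ⟨s'', _, .seq _ _ _ _ _ _ _ h1 h2, add_le_add ht ht', hs'', hr⟩

/-- The rule for loops. The invariant is indexed by a bound on the number of remaining steps. -/
theorem Runs.loop (hD : 1 ≤ D) {e f : ArrExpr} {I : ℕ → ArrState → Prop}
    (hok : ∀ b s, I b s → e.Ok D s ∧ f.Ok D s)
    (hstep : ∀ b s, I b s → s.Bounded D → e.eval s < f.eval s →
      ∃ c b', b' + c + (e.cost + f.cost + 1) ≤ b ∧ Runs B D p s c (I b'))
    (hI : I b s) :
    Runs B D (.loop e f p) s (b + (e.cost + f.cost + 1))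
      (fun s' => (∃ b', I b' s') ∧ ¬ e.eval s' < f.eval s') := by
  -- The evaluation of the test alone takes a step, so `b'` is smaller than `b`: the time bound
  -- serves as termination measure.
  induction b using Nat.strong_induction_on generalizing s with
  | _ b ih =>
  intro hreq hs
  have hreq' := hreq
  simp only [req, add_mul] at hreq'
  obtain ⟨he, hf⟩ := hok b s hI
  have he' := e.fits_compile hD hs he (B := B) (by omega)
  have hf' := f.fits_compile hD hs hf (B := B) (by omega)
  by_cases hef : e.eval s < f.eval s
  · obtain ⟨c, b', hb, hp⟩ := hstep b s hI hs hef
    obtain ⟨s', t, h1, ht, hs', hI'⟩ := hp (by omega) hs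
    obtain ⟨s'', t', h2, ht', hs'', hq⟩ := ih b' (by omega) hI' hreq hs'
    refine ⟨s'', _, .while_true _ _ _ _ _ _ _ _ he' hf' ?_ h1 h2, ?_, hs'', hq⟩
    · rwa [e.eval_compile he, f.eval_compile hf]
    · simp only [ArrExpr.cost] at *; omega
  · refine ⟨s, _, .while_false _ _ _ _ he' hf' ?_, ?_, hs, ⟨b, hI⟩, hef⟩
    · rwa [e.eval_compile he, f.eval_compile hf]
    · simp only [ArrExpr.cost]; omega

/-- Increment of a variable. -/
def inc (x : RegName) : ArrProg := .assign x (.add (.reg x) (.const 1))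

/-- The loop that runs `body` for the values `0, 1, …` of `x` below `f`. -/
def forLoop (x : RegName) (f : ArrExpr) (body : ArrProg) : ArrProg :=
  .seq (.assign x (.const 0)) (.loop (.reg x) f (.seq body (inc x)))

/-- The rule for counting loops whose body has no loops. -/
theorem Runs.forLoop (hD : 1 ≤ D) {x : RegName} {f : ArrExpr} {N : ℕ} (hN : N ≤ D)
    {I : ℕ → ArrState → Prop}
    (hf : ∀ i s, I i s → s.reg x = i ∧ f.Ok D s ∧ f.eval s = N)
    (hstep : ∀ i s, I i s → i < N → s.Bounded D →
      p.Safe D s ∧ (p.exec s).reg x = i ∧ I (i + 1) ((inc x).exec (p.exec s)))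
    (hI : I 0 (s.setReg x 0)) :
    Runs B D (forLoop x f p) s
      ((N + 1) * (p.cost + f.cost + 7)) (I N) := by
  have h0 : Runs B D (.assign x (.const 0)) s (ArrProg.assign x (.const 0)).cost (I 0) :=
    .of_exec hD (fun _ => ⟨trivial, Nat.zero_le D⟩) (fun _ => hI)
  set w := (ArrExpr.reg x).cost + f.cost + 1 with hw
  set c := (ArrProg.seq p (inc x)).cost with hc
  have hw' : w = f.cost + 2 := by simp [hw, ArrExpr.cost, ArrExpr.compile, RAMExpr.cost]; omega
  have hc' : c = p.cost + 4 := rfl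
  refine (h0.seq fun s' hs' => (Runs.loop hD (b := N * (c + w))
    (I := fun b s => ∃ i ≤ N, I i s ∧ b = (N - i) * (c + w)) ?_ ?_ ?_)).mono ?_ ?_
  · rintro b s ⟨i, -, h, -⟩
    exact ⟨trivial, (hf i s h).2.1⟩
  · rintro b s ⟨i, hi, h, rfl⟩ hs hlt
    obtain ⟨h1, -, h2⟩ := hf i s h
    rw [h2] at hlt
    simp only [ArrExpr.eval, h1] at hlt
    refine ⟨c, (N - (i + 1)) * (c + w), ?_, .of_exec hD (fun _ => ?_) (fun _ => ?_)⟩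
    · obtain ⟨j, hj⟩ := Nat.exists_eq_add_of_lt hlt
      have e1 : N - i = j + 1 := by omega
      have e2 : N - (i + 1) = j := by omega
      rw [e1, e2, ← hw]
      ring_nf
      omega
    · obtain ⟨ha, hb, -⟩ := hstep i s h hlt hs
      refine ⟨ha, ⟨trivial, trivial⟩, ?_⟩
      simp only [ArrExpr.eval, hb]
      omega
    · exact ⟨i + 1, hlt, (hstep i s h hlt hs).2.2, rfl⟩
  · exact ⟨0, Nat.zero_le _, hs', by simp⟩
  · have : (ArrProg.assign x (.const 0)).cost = 2 := rfl
    rw [this, hw', hc']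
    ring_nf
    omega
  · rintro s' - ⟨⟨b, i, hi, h, -⟩, hlt⟩
    obtain ⟨h1, -, h2⟩ := hf i s' h
    rw [h2] at hlt
    simp only [ArrExpr.eval, h1] at hlt
    have : i = N := by omega
    exact this ▸ h

end ArrProg

/-! ### Breadth-first search -/

/-- The graph with edges `src e → tgt e` for `e < m` has a path of length `d` from a vertex to a
vertex of `A`. -/
def EdgePath (m : ℕ) (src tgt : ℕ → ℕ) (A : ℕ → Prop) : ℕ → ℕ → Prop
  | 0, u => A u
  | d + 1, u => ∃ e < m, src e = u ∧ EdgePath m src tgt A d (tgt e)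

/-- The edges below `m` that end in `v`. -/
def edgesInto (tgt : ℕ → ℕ) : ℕ → ℕ → List ℕ
  | 0, _ => []
  | m + 1, v => if tgt m = v then m :: edgesInto tgt m v else edgesInto tgt m v

theorem mem_edgesInto {tgt : ℕ → ℕ} {m v e : ℕ} :
    e ∈ edgesInto tgt m v ↔ e < m ∧ tgt e = v := by
  induction m with
  | zero => simp [edgesInto]
  | succ m ih =>
    by_cases h : tgt m = v
    · simp only [edgesInto, if_pos h, List.mem_cons, ih]
      constructor
      · rintro (rfl | h')
        exacts [⟨Nat.lt_succ_self _, h⟩, ⟨by omega, h'.2⟩]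
      · rintro ⟨h1, h2⟩
        rcases (Nat.lt_succ_iff_lt_or_eq).1 h1 with h' | h'
        exacts [Or.inr ⟨h', h2⟩, Or.inl h']
    · simp only [edgesInto, if_neg h, ih]
      constructor
      · exact fun h' => ⟨by omega, h'.2⟩
      · rintro ⟨h1, h2⟩
        rcases (Nat.lt_succ_iff_lt_or_eq).1 h1 with h' | h'
        exacts [⟨h', h2⟩, absurd (h' ▸ h2) h]

theorem sum_length_edgesInto {tgt : ℕ → ℕ} {n m : ℕ} (h : ∀ e < m, tgt e < n) :
    ∑ v ∈ Finset.range n, (edgesInto tgt m v).length = m := by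
  induction m with
  | zero => simp [edgesInto]
  | succ m ih =>
    have h1 : ∀ v, (edgesInto tgt (m + 1) v).length =
        (edgesInto tgt m v).length + if tgt m = v then 1 else 0 := by
      intro v
      by_cases hv : tgt m = v <;> simp [edgesInto, hv]
    simp only [h1, Finset.sum_add_distrib, ih fun e he => h e (by omega)]
    simp [h m (by omega)]

/-- The links `next`, started at `h`, run through the list; link `0` is the end, and link `e + 1`
points to `e`. -/
def IsLinked (next : ℕ → ℕ) : ℕ → List ℕ → Prop
  | h, [] => h = 0
  | h, e :: l => h = e + 1 ∧ IsLinked next (next e) l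

theorem IsLinked.congr {next next' : ℕ → ℕ} {l : List ℕ} (hl : ∀ e ∈ l, next e = next' e) :
    ∀ {h : ℕ}, IsLinked next h l → IsLinked next' h l := by
  induction l with
  | nil => exact fun h => h
  | cons e l ih =>
    rintro h ⟨h1, h2⟩
    refine ⟨h1, ?_⟩
    rw [← hl e (by simp)]
    exact ih (fun x hx => hl x (by simp [hx])) h2

/-- The invariant of breadth-first search towards the set `A`. The entry `dist u` is `0` for
unvisited vertices, and one more than the distance otherwise; `front` entries of the queue have
been taken out, and the edges of the list `l` into the last of these, `v`, are still to be
scanned. -/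
structure BFSInv (n m : ℕ) (src tgt : ℕ → ℕ) (A : ℕ → Prop) (dist queue : ℕ → ℕ)
    (front back : ℕ) (l : List ℕ) (v : ℕ) : Prop where
  front_le : front ≤ back
  queue_lt : ∀ j < back, queue j < n
  queue_inj : ∀ i j, i < j → j < back → queue i ≠ queue j
  visited : ∀ u < n, 0 < dist u → ∃ j < back, queue j = u
  queue_pos : ∀ j < back, 0 < dist (queue j)
  mono : ∀ i j, i ≤ j → j < back → dist (queue i) ≤ dist (queue j)
  dist_le : ∀ j < back, dist (queue j) ≤ j + 1
  close : ∀ i j, front ≤ i + 1 → i < back → j < back → dist (queue j) ≤ dist (queue i) + 1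
  sound : ∀ u < n, 0 < dist u → EdgePath m src tgt A (dist u - 1) u
  source : ∀ u < n, A u → dist u = 1
  done : ∀ e < m, (∃ i < front, queue i = tgt e) → e ∉ l →
    0 < dist (src e) ∧ dist (src e) ≤ dist (tgt e) + 1
  current : l ≠ [] → 0 < front ∧ v = queue (front - 1)
  edge : ∀ e ∈ l, e < m ∧ tgt e = v

namespace BFSInv

variable {n m : ℕ} {src tgt : ℕ → ℕ} {A : ℕ → Prop} {dist queue : ℕ → ℕ} {front back : ℕ}
  {l : List ℕ} {v : ℕ}

theorem back_le (h : BFSInv n m src tgt A dist queue front back l v) : back ≤ n := by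
  have hinj : Set.InjOn queue (Finset.range back : Set ℕ) := by
    intro i hi j hj hij
    simp only [Finset.coe_range, Set.mem_Iio] at hi hj
    rcases lt_trichotomy i j with h' | h' | h'
    · exact absurd hij (h.queue_inj i j h' hj)
    · exact h'
    · exact absurd hij.symm (h.queue_inj j i h' hi)
  have := Finset.card_le_card_of_injOn (t := Finset.range n) queue
    (fun i hi => by simpa using h.queue_lt i (by simpa using hi)) hinj
  simpa using this

theorem dist_le_card (h : BFSInv n m src tgt A dist queue front back l v) {u : ℕ} (hu : u < n) :
    dist u ≤ n := by
  rcases Nat.eq_zero_or_pos (dist u) with h0 | h0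
  · omega
  · obtain ⟨j, hj, rfl⟩ := h.visited u hu h0
    have := h.dist_le j hj
    have := h.back_le
    omega

/-- The edges into the new vertex violate no clause, since `done` exempts the edges that are still
in the list. -/
theorem pop (h : BFSInv n m src tgt A dist queue front back [] v) (hf : front < back) :
    BFSInv n m src tgt A dist queue (front + 1) back (edgesInto tgt m (queue front))
      (queue front) where
  front_le := hf
  queue_lt := h.queue_lt
  queue_inj := h.queue_inj
  visited := h.visited
  queue_pos := h.queue_pos
  mono := h.mono
  dist_le := h.dist_le
  close i j hi := h.close i j (by omega)
  sound := h.sound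
  source := h.source
  done e he := by
    rintro ⟨i, hi, hie⟩ hl
    rcases Nat.lt_succ_iff_lt_or_eq.1 hi with h' | rfl
    · exact h.done e he ⟨i, h', hie⟩ (by simp)
    · exact absurd (mem_edgesInto.2 ⟨he, hie.symm⟩) hl
  current _ := ⟨by omega, rfl⟩
  edge e he := mem_edgesInto.1 he

/-- The source is already in the queue, and `close` compares it with `v = queue (front - 1)`. This
is why `close` includes the entry just taken out, through `front ≤ i + 1`. -/
theorem scan_visited {e : ℕ} (h : BFSInv n m src tgt A dist queue front back (e :: l) v)
    (hsrc : src e < n) (hu : 0 < dist (src e)) :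
    BFSInv n m src tgt A dist queue front back l v := by
  obtain ⟨hf, hv⟩ := h.current (by simp)
  have hfb := h.front_le
  refine { h with
    done := fun e' he' hi hl => ?_
    current := fun _ => ⟨hf, hv⟩
    edge := fun e' he' => h.edge e' (List.mem_cons_of_mem _ he') }
  by_cases hee : e' = e
  · subst hee
    refine ⟨hu, ?_⟩
    obtain ⟨j, hj, hje⟩ := h.visited _ hsrc hu
    rw [(h.edge e' (by simp)).2, hv, ← hje]
    exact h.close _ _ (by omega) (by omega) hj
  · exact h.done e' he' hi (by simp [hee, hl])

/-- The new entry is `dist v + 1`. By `close` at `v` no queued entry is larger, so the queue stays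
sorted; entries from position `front - 1` on are at least `dist v`, so they still differ by at most
one. -/
theorem scan_unvisited {e : ℕ} (h : BFSInv n m src tgt A dist queue front back (e :: l) v)
    (hsrc : src e < n) (htgt : tgt e < n) (hu : dist (src e) = 0) :
    BFSInv n m src tgt A (Function.update dist (src e) (dist v + 1))
      (Function.update queue back (src e)) front (back + 1) l v := by
  obtain ⟨hf, hv⟩ := h.current (by simp)
  have hfb := h.front_le
  obtain ⟨hem, hev⟩ := h.edge e (by simp)
  have hq : ∀ j < back, Function.update queue back (src e) j = queue j := fun j hj =>
    Function.update_of_ne (by omega) _ _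
  have hne : ∀ j < back, queue j ≠ src e := fun j hj he => by
    have := h.queue_pos j hj
    rw [he] at this
    omega
  have hd : ∀ j < back, Function.update dist (src e) (dist v + 1)
      (Function.update queue back (src e) j) = dist (queue j) := fun j hj => by
    rw [hq j hj, Function.update_of_ne (hne j hj)]
  have hdb : Function.update dist (src e) (dist v + 1)
      (Function.update queue back (src e) back) = dist v + 1 := by simp
  have hvpos : 0 < dist v := hv ▸ h.queue_pos _ (by omega)
  have hvne : v ≠ src e := hv ▸ hne _ (by omega)
  have hlast : ∀ j < back, dist (queue j) ≤ dist v + 1 := fun j hj =>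
    hv ▸ h.close _ _ (by omega) (by omega) hj
  constructor
  · omega
  · intro j hj
    rcases Nat.lt_succ_iff_lt_or_eq.1 hj with h' | rfl
    · rw [hq j h']; exact h.queue_lt j h'
    · simpa using hsrc
  · intro i j hij hj
    rw [hq i (by omega)]
    rcases Nat.lt_succ_iff_lt_or_eq.1 hj with h' | rfl
    · rw [hq j h']; exact h.queue_inj i j hij h'
    · simpa using hne i hij
  · intro u hun hpos
    by_cases hus : u = src e
    · exact ⟨back, by omega, by simp [hus]⟩
    · rw [Function.update_of_ne hus] at hpos
      obtain ⟨j, hj, hju⟩ := h.visited u hun hpos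
      exact ⟨j, by omega, (hq j hj).trans hju⟩
  · intro j hj
    rcases Nat.lt_succ_iff_lt_or_eq.1 hj with h' | rfl
    · rw [hd j h']; exact h.queue_pos j h'
    · rw [hdb]; omega
  · intro i j hij hj
    rcases Nat.lt_succ_iff_lt_or_eq.1 hj with h' | rfl
    · rw [hd i (by omega), hd j h']; exact h.mono i j hij h'
    · rcases hij.lt_or_eq with h' | rfl
      · rw [hd i h', hdb]; exact hlast i h'
      · exact le_rfl
  · intro j hj
    rcases Nat.lt_succ_iff_lt_or_eq.1 hj with h' | rfl
    · rw [hd j h']; exact h.dist_le j h'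
    · rw [hdb]
      have := h.dist_le (front - 1) (by omega)
      rw [← hv] at this
      omega
  · intro i j hi hib hjb
    have hvi : dist v ≤ Function.update dist (src e) (dist v + 1)
        (Function.update queue back (src e) i) := by
      rcases Nat.lt_succ_iff_lt_or_eq.1 hib with h' | rfl
      · rw [hd i h', hv]; exact h.mono _ _ (by omega) h'
      · rw [hdb]; omega
    rcases Nat.lt_succ_iff_lt_or_eq.1 hjb with h' | rfl
    · rw [hd j h']
      have := hlast j h'
      omega
    · rw [hdb]; omega
  · intro u hun hpos
    by_cases hus : u = src e
    · subst hus
      rw [Function.update_self]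
      have hp := h.sound (tgt e) htgt (hev ▸ hvpos)
      obtain ⟨d, hdv⟩ : ∃ d, dist v = d + 1 := ⟨dist v - 1, by omega⟩
      rw [hev, hdv] at hp
      rw [hdv]
      exact ⟨e, hem, rfl, hev ▸ hp⟩
    · rw [Function.update_of_ne hus] at hpos ⊢
      exact h.sound u hun hpos
  · intro u hun hA
    have := h.source u hun hA
    rwa [Function.update_of_ne]
    rintro rfl
    omega
  · rintro e' he' ⟨i, hi, hie⟩ hl
    rw [hq i (by omega)] at hie
    have htne : tgt e' ≠ src e := hie ▸ hne i (by omega)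
    rw [Function.update_of_ne htne]
    by_cases hs : src e' = src e
    · rw [hs, Function.update_self]
      refine ⟨by omega, ?_⟩
      by_cases hee : e' = e
      · rw [hee, hev]
      · have := h.done e' he' ⟨i, hi, hie⟩ (by simp [hee, hl])
        rw [hs] at this
        omega
    · rw [Function.update_of_ne hs]
      exact h.done e' he' ⟨i, hi, hie⟩ (by
        rw [List.mem_cons, not_or]
        exact ⟨fun h => hs (by rw [h]), hl⟩)
  · exact fun _ => ⟨hf, by rw [hq _ (by omega), hv]⟩
  · exact fun e' he' => h.edge e' (List.mem_cons_of_mem _ he')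

/-- When the queue is exhausted, every visited vertex has been taken out and `done` holds for all
edges into visited vertices. Induction along the path then bounds `dist` by its length plus one. -/
theorem complete (h : BFSInv n m src tgt A dist queue back back [] v)
    (htgt : ∀ e < m, tgt e < n) {d u : ℕ} (hu : u < n)
    (hp : EdgePath m src tgt A d u) : 0 < dist u ∧ dist u ≤ d + 1 := by
  induction d generalizing u with
  | zero =>
    have := h.source u hu hp
    omega
  | succ d ih =>
    obtain ⟨e, he, rfl, hp⟩ := hp
    obtain ⟨h1, h2⟩ := ih (htgt e he) hp
    obtain ⟨j, hj⟩ := h.visited _ (htgt e he) h1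
    have := h.done e he ⟨j, hj⟩ (by simp)
    omega

end BFSInv

/-- The remaining work of breadth-first search. -/
def bfsPotential (n m : ℕ) (tgt queue : ℕ → ℕ) (front : ℕ) (l : List ℕ) : ℕ :=
  ∑ v ∈ Finset.range n with ∀ i < front, queue i ≠ v, (1 + (edgesInto tgt m v).length) + l.length

theorem bfsPotential_zero {n m : ℕ} {tgt queue : ℕ → ℕ} (h : ∀ e < m, tgt e < n) :
    bfsPotential n m tgt queue 0 [] = n + m := by
  simp [bfsPotential, Finset.sum_add_distrib, sum_length_edgesInto h]

theorem bfsPotential_scan {n m : ℕ} {tgt queue queue' : ℕ → ℕ} {front e : ℕ} {l : List ℕ}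
    (h : ∀ i < front, queue' i = queue i) :
    bfsPotential n m tgt queue' front l + 1 = bfsPotential n m tgt queue front (e :: l) := by
  unfold bfsPotential
  rw [List.length_cons, ← add_assoc]
  congr 3
  ext v
  simp only [Finset.mem_filter, and_congr_right_iff]
  exact fun _ => forall₂_congr fun i hi => by rw [h i hi]

/-- The vertex gives up one plus its indegree, and its indegree returns as the length of the list to
be scanned. The net loss of one pays for the step. -/
theorem bfsPotential_pop {n m : ℕ} {tgt queue : ℕ → ℕ} {front : ℕ} (hlt : queue front < n)
    (hne : ∀ i < front, queue i ≠ queue front) :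
    bfsPotential n m tgt queue (front + 1) (edgesInto tgt m (queue front)) + 1 =
      bfsPotential n m tgt queue front [] := by
  unfold bfsPotential
  have hmem : queue front ∈ (Finset.range n).filter fun v => ∀ i < front, queue i ≠ v := by
    simpa using ⟨hlt, hne⟩
  have : ((Finset.range n).filter fun v => ∀ i < front + 1, queue i ≠ v) =
      ((Finset.range n).filter fun v => ∀ i < front, queue i ≠ v).erase (queue front) := by
    ext v
    simp only [Finset.mem_filter, Finset.mem_erase]
    constructor
    · rintro ⟨h1, h2⟩
      exact ⟨(h2 front (by omega)).symm, h1, fun i hi => h2 i (by omega)⟩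
    · rintro ⟨h1, h2, h3⟩
      refine ⟨h2, fun i hi => ?_⟩
      rcases Nat.lt_succ_iff_lt_or_eq.1 hi with h' | rfl
      exacts [h3 i h', h1.symm]
  rw [this, ← Finset.add_sum_erase _ _ hmem, List.length_nil]
  ring

open ArrProg ArrExpr

namespace ArrState

@[simp] theorem setReg_reg (s : ArrState) (x z : RegName) (y : ℕ) :
    (s.setReg x y).reg z = if z = x then y else s.reg z := by
  simp [setReg, Function.update_apply]

@[simp] theorem setReg_inp (s : ArrState) (x : RegName) (y : ℕ) : (s.setReg x y).inp = s.inp := rfl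

@[simp] theorem setReg_arr (s : ArrState) (x : RegName) (y : ℕ) : (s.setReg x y).arr = s.arr := rfl

@[simp] theorem setArr_arr (s : ArrState) (k l : ArrName) (i y : ℕ) :
    (s.setArr k i y).arr l = if l = k then Function.update (s.arr k) i y else s.arr l := by
  simp [setArr, Function.update_apply]

@[simp] theorem setArr_reg (s : ArrState) (k : ArrName) (i y : ℕ) :
    (s.setArr k i y).reg = s.reg := rfl

@[simp] theorem setArr_inp (s : ArrState) (k : ArrName) (i y : ℕ) :
    (s.setArr k i y).inp = s.inp := rfl

@[simp] theorem setInp_inp (s : ArrState) (a y : ℕ) :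
    (s.setInp a y).inp = Function.update s.inp a y := rfl

@[simp] theorem setInp_reg (s : ArrState) (a y : ℕ) : (s.setInp a y).reg = s.reg := rfl

@[simp] theorem setInp_arr (s : ArrState) (a y : ℕ) : (s.setInp a y).arr = s.arr := rfl

end ArrState

/-- The address of the source of edge `e` in the input. -/
def srcAddr (e : ArrExpr) : ArrExpr := .add (.add (.const 2) (.reg .n)) (.add e e)

/-- The address of the end of edge `e` in the input. -/
def tgtAddr (e : ArrExpr) : ArrExpr := .add (srcAddr e) (.const 1)

/-- The state holds the graph: the sources of the edges, and, for every vertex, a linked list of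
the edges into it. -/
structure HoldsGraph (n m : ℕ) (src tgt : ℕ → ℕ) (s : ArrState) : Prop where
  reg_n : s.reg .n = n
  reg_m : s.reg .m = m
  reg_root : s.reg .root = Nat.sqrt n
  inp_src : ∀ e < m, s.inp (2 + n + (e + e)) = src e
  linked : ∀ v < n, IsLinked (s.arr .next) (s.arr .head v) (edgesInto tgt m v)

theorem HoldsGraph.congr {n m : ℕ} {src tgt : ℕ → ℕ} {s s' : ArrState}
    (h : HoldsGraph n m src tgt s) (h1 : s'.reg .n = s.reg .n) (h2 : s'.reg .m = s.reg .m)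
    (h3 : s'.reg .root = s.reg .root) (h4 : ∀ a, 2 + n ≤ a → s'.inp a = s.inp a)
    (h5 : s'.arr .next = s.arr .next) (h6 : s'.arr .head = s.arr .head) :
    HoldsGraph n m src tgt s' :=
  ⟨h1.trans h.reg_n, h2.trans h.reg_m, h3.trans h.reg_root,
    fun e he => (h4 _ (by omega)).trans (h.inp_src e he),
    fun v hv => by rw [h5, h6]; exact h.linked v hv⟩

/-- The entries `dist u` are `0` if no path leads from `u` to `A`, and one more than the length of
a shortest path otherwise. -/
def IsDist (n m : ℕ) (src tgt : ℕ → ℕ) (A : ℕ → Prop) (dist : ℕ → ℕ) : Prop :=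
  ∀ u < n, dist u ≤ n ∧ (0 < dist u → EdgePath m src tgt A (dist u - 1) u) ∧
    ∀ d, EdgePath m src tgt A d u → 0 < dist u ∧ dist u ≤ d + 1

/-- A vertex of the zero set enters the queue. -/
def bfsInitBody : ArrProg :=
  .ite (.const 0) (.arr .zero (.reg .idx))
    (.seq (.store .dist (.reg .idx) (.const 1))
      (.seq (.store .queue (.reg .back) (.reg .idx)) (inc .back)))
    (.store .dist (.reg .idx) (.const 0))

/-- Start of breadth-first search: the vertices of the zero set enter the queue. -/
def bfsInit : ArrProg :=
  .seq (.assign .back (.const 0)) (forLoop .idx (.reg .n) bfsInitBody)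

/-- One step of breadth-first search: scan an edge, or take a vertex out of the queue. -/
def bfsStep : ArrProg :=
  .ite (.const 0) (.reg .edge)
    (.seq (.assign .nbr (.inp (srcAddr (.sub (.reg .edge) (.const 1)))))
      (.seq (.assign .edge (.arr .next (.sub (.reg .edge) (.const 1))))
        (.ite (.arr .dist (.reg .nbr)) (.const 1)
          (.seq (.store .dist (.reg .nbr) (.add (.arr .dist (.reg .cur)) (.const 1)))
            (.seq (.store .queue (.reg .back) (.reg .nbr)) (inc .back)))
          .skip)))
    (.seq (.assign .cur (.arr .queue (.reg .front)))
      (.seq (inc .front) (.assign .edge (.arr .head (.reg .cur)))))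

/-- Breadth-first search from the zero set, against the edges. -/
def bfs : ArrProg :=
  .seq bfsInit (.seq (.assign .front (.const 0)) (.seq (.assign .edge (.const 0))
    (.loop (.reg .front) (.add (.reg .back) (.reg .edge)) bfsStep)))

section BFS

variable {n m : ℕ} {src tgt : ℕ → ℕ} {B : ℕ} {s : ArrState}

theorem runs_bfsInit (hs : HoldsGraph n m src tgt s) :
    Runs B (2 + n + 2 * m) bfsInit s (2 + (n + 1) * (bfsInitBody.cost + (ArrExpr.reg .n).cost + 7)) fun s' =>
      HoldsGraph n m src tgt s' ∧ s'.inp = s.inp ∧ s'.arr .zero = s.arr .zero ∧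
        BFSInv n m src tgt (fun u => 0 < s.arr .zero u) (s'.arr .dist) (s'.arr .queue) 0
          (s'.reg .back) [] 0 := by
  refine (Runs.of_exec (by omega) (Q := fun s' => s'.reg .back = 0 ∧ HoldsGraph n m src tgt s' ∧
    s'.inp = s.inp ∧ s'.arr .zero = s.arr .zero) ?_ ?_).seq fun s₁ hs₁ => ?_
  · simp
  · intro _
    refine ⟨by simp, hs.congr ?_ ?_ ?_ ?_ ?_ ?_, ?_, ?_⟩ <;> simp
  · obtain ⟨hb₁, hg₁, hi₁, hz₁⟩ := hs₁
    refine (Runs.forLoop (by omega) (N := n) (by omega) (I := fun i s' => s'.reg .idx = i ∧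
      HoldsGraph n m src tgt s' ∧ s'.inp = s.inp ∧ s'.arr .zero = s.arr .zero ∧ s'.reg .back ≤ i ∧
      (∀ u < i, s'.arr .dist u = if 0 < s.arr .zero u then 1 else 0) ∧
      (∀ j < s'.reg .back, s'.arr .queue j < i ∧ 0 < s.arr .zero (s'.arr .queue j)) ∧
      (∀ u < i, 0 < s.arr .zero u → ∃ j < s'.reg .back, s'.arr .queue j = u) ∧
      (∀ j j', j < j' → j' < s'.reg .back → s'.arr .queue j ≠ s'.arr .queue j'))
      ?_ ?_ ?_).mono le_rfl ?_
    · rintro i s' ⟨h1, h2, -⟩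
      exact ⟨h1, trivial, h2.reg_n⟩
    · rintro i s' ⟨h1, h2, h3, h4, h5, h6, h7, h8, h9⟩ hi hbd
      by_cases hz : 0 < s.arr .zero i
      · refine ⟨?_, ?_, ?_⟩
        · simp [bfsInitBody, h1, h4, hz, inc]; omega
        · simp [bfsInitBody, h1, h4, hz, inc]
        · simp only [bfsInitBody, inc, exec, eval, h1, h4, hz, if_true]
          refine ⟨by simp [h1], h2.congr ?_ ?_ ?_ ?_ ?_ ?_, ?_, ?_, ?_, ?_, ?_, ?_, ?_⟩
          any_goals simp [h3, h4, h5]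
          · intro u hu
            by_cases hui : u = i
            · simp [hui, hz]
            · simp [hui, h6 u (by omega)]
          · intro j hj
            by_cases hjb : j = s'.reg .back
            · simp [hjb, h1, hz]
            · have := h7 j (by omega)
              simp [hjb, this.2]
              omega
          · intro u hu hzu
            by_cases hui : u = i
            · exact ⟨s'.reg .back, by omega, by simp [hui, h1]⟩
            · obtain ⟨j, hj, hju⟩ := h8 u (by omega) hzu
              exact ⟨j, by omega, by rw [Function.update_of_ne (by omega), hju]⟩
          · intro j j' hjj hj'
            rw [Function.update_of_ne (show j ≠ s'.reg .back by omega)]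
            by_cases hjb : j' = s'.reg .back
            · have := (h7 j (by omega)).1
              simp [hjb]
              omega
            · rw [Function.update_of_ne hjb]
              exact h9 j j' hjj (by omega)
      · refine ⟨?_, ?_, ?_⟩
        · simp [bfsInitBody, h1, h4, hz]
        · simp [bfsInitBody, h1, h4, hz]
        · simp only [bfsInitBody, inc, exec, eval, h1, h4, hz, if_false]
          refine ⟨by simp [h1], h2.congr ?_ ?_ ?_ ?_ ?_ ?_, ?_, ?_, ?_, ?_, ?_, ?_, ?_⟩
          any_goals simp [h3, h4]
          · omega
          · intro u hu
            by_cases hui : u = i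
            · simp [hui]; omega
            · simp [hui, h6 u (by omega)]
          · exact fun j hj => ⟨by have := h7 j hj; omega, (h7 j hj).2⟩
          · intro u hu hzu
            by_cases hui : u = i
            · exact absurd (hui ▸ hzu) hz
            · exact h8 u (by omega) hzu
          · exact h9
    · refine ⟨by simp, hg₁.congr ?_ ?_ ?_ ?_ ?_ ?_, ?_⟩ <;> simp [hi₁, hz₁, hb₁]
    · rintro s' - ⟨h1, h2, h3, h4, h5, h6, h7, h8, h9⟩
      refine ⟨h2, h3, h4, ?_⟩
      have hq : ∀ j < s'.reg .back, s'.arr .dist (s'.arr .queue j) = 1 := fun j hj => by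
        rw [h6 _ (h7 j hj).1, if_pos (h7 j hj).2]
      refine ⟨Nat.zero_le _, fun j hj => (h7 j hj).1, h9, fun u hu hpos => h8 u hu ?_, ?_, ?_, ?_, ?_,
        fun u hu hpos => ?_, fun u hu hA => ?_, ?_, ?_, ?_⟩
      · by_contra hz
        rw [h6 u hu, if_neg hz] at hpos
        omega
      · intro j hj; rw [hq j hj]; omega
      · intro i j hij hj; rw [hq i (by omega), hq j hj]
      · intro j hj; rw [hq j hj]; omega
      · intro i j _ hi hj; rw [hq i hi, hq j hj]; omega
      · have hz : 0 < s.arr .zero u := by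
          by_contra hz
          rw [h6 u hu, if_neg hz] at hpos
          omega
        rw [h6 u hu, if_pos hz]
        exact hz
      · rw [h6 u hu, if_pos hA]
      · rintro e _ ⟨i, hi, _⟩
        omega
      · exact fun h => absurd rfl h
      · simp

/-- Since `front ≤ back`, the single test `front < back + edge` holds exactly if an edge is left to
scan or the queue is nonempty. Every step lowers `bfsPotential` by one, from the initial value `n +
m`. -/
theorem exists_runs_bfs : ∃ K, ∀ (n m B : ℕ) (src tgt : ℕ → ℕ) (s : ArrState),
    HoldsGraph n m src tgt s → (∀ e < m, src e < n) → (∀ e < m, tgt e < n) →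
    Runs B (2 + n + 2 * m) bfs s (K * (n + m + 1)) fun s' => HoldsGraph n m src tgt s' ∧
      s'.inp = s.inp ∧ s'.arr .zero = s.arr .zero ∧
      IsDist n m src tgt (fun u => 0 < s.arr .zero u) (s'.arr .dist) := by
  set c := bfsStep.cost + 6 with hc
  refine ⟨bfsInitBody.cost + c + 30, fun n m B src tgt s hs hsrc htgt => ?_⟩
  refine ((runs_bfsInit hs).seq fun s₁ hs₁ => (Runs.of_exec (by omega) (Q := fun s' =>
      HoldsGraph n m src tgt s' ∧ s'.inp = s.inp ∧ s'.arr .zero = s.arr .zero ∧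
        s'.reg .front = 0 ∧
        BFSInv n m src tgt (fun u => 0 < s.arr .zero u) (s'.arr .dist) (s'.arr .queue) 0
          (s'.reg .back) [] 0) ?_ ?_).seq fun s₂ hs₂ =>
      (Runs.of_exec (by omega) (Q := fun s' =>
      HoldsGraph n m src tgt s' ∧ s'.inp = s.inp ∧ s'.arr .zero = s.arr .zero ∧
        s'.reg .front = 0 ∧ s'.reg .edge = 0 ∧
        BFSInv n m src tgt (fun u => 0 < s.arr .zero u) (s'.arr .dist) (s'.arr .queue) 0
          (s'.reg .back) [] 0) ?_ ?_).seq fun s₃ hs₃ =>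
      (Runs.loop (by omega) (b := c * (n + m)) (I := fun b s' => HoldsGraph n m src tgt s' ∧
        s'.inp = s.inp ∧ s'.arr .zero = s.arr .zero ∧
        ∃ l, BFSInv n m src tgt (fun u => 0 < s.arr .zero u) (s'.arr .dist) (s'.arr .queue)
          (s'.reg .front) (s'.reg .back) l (s'.reg .cur) ∧
          IsLinked (s'.arr .next) (s'.reg .edge) l ∧
          b = c * bfsPotential n m tgt (s'.arr .queue) (s'.reg .front) l) ?_ ?_ ?_)).mono ?_ ?_
  · simp
  · obtain ⟨h1, h2, h3, h4⟩ := hs₁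
    intro _
    refine ⟨h1.congr ?_ ?_ ?_ ?_ ?_ ?_, ?_, ?_, ?_, ?_⟩ <;> simp [h2, h3, h4]
  · simp
  · obtain ⟨h1, h2, h3, h4, h5⟩ := hs₂
    intro _
    refine ⟨h1.congr ?_ ?_ ?_ ?_ ?_ ?_, ?_, ?_, ?_, ?_, ?_⟩ <;> simp [h2, h3, h4, h5]
  · exact fun _ _ _ => ⟨trivial, trivial, trivial⟩
  · rintro b s' ⟨hg, hi, hz, l, hinv, hl, rfl⟩ hbd hlt
    have hw : (ArrExpr.reg .front).cost + (ArrExpr.add (.reg .back) (.reg .edge)).cost + 1 = 5 :=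
      rfl
    simp only [eval] at hlt
    rw [hw]
    have hbn := hinv.back_le
    cases l with
    | nil =>
      have he : s'.reg .edge = 0 := hl
      rw [he, add_zero] at hlt
      have hpot := bfsPotential_pop (m := m) (tgt := tgt) (hinv.queue_lt _ hlt)
        fun i hi => hinv.queue_inj i _ hi hlt
      have hqn := hinv.queue_lt _ hlt
      refine ⟨bfsStep.cost, c * bfsPotential n m tgt (s'.arr .queue) (s'.reg .front + 1)
        (edgesInto tgt m (s'.arr .queue (s'.reg .front))), ?_, .of_exec (by omega) ?_ ?_⟩
      · rw [← hpot, mul_add, mul_one, hc]; omega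
      · intro hbd
        have hhead := hbd.arr .head (s'.arr .queue (s'.reg .front))
        simp [bfsStep, he, inc]
        omega
      · intro _
        simp only [bfsStep, inc, exec, eval, he, lt_irrefl, if_false]
        refine ⟨hg.congr ?_ ?_ ?_ ?_ ?_ ?_, ?_, ?_, _, by simpa using hinv.pop hlt, ?_, ?_⟩ <;>
          simp [hi, hz, hg.linked _ hqn]
    | cons e l =>
      obtain ⟨he, hl⟩ := hl
      obtain ⟨hem, hev⟩ := hinv.edge e (by simp)
      have hsn := hsrc e hem
      have hsrcv : s'.inp (2 + s'.reg .n + (e + e)) = src e := by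
        rw [hg.reg_n]; exact hg.inp_src e hem
      have hnx := hbd.arr .next e
      have hdv : s'.arr .dist (s'.reg .cur) ≤ n := by
        obtain ⟨hf, hv⟩ := hinv.current (by simp)
        have := hinv.front_le
        rw [hv]
        exact hinv.dist_le_card (hinv.queue_lt _ (by omega))
      have hlt' : s'.reg .n = n := hg.reg_n
      by_cases hd : s'.arr .dist (src e) = 0
      · have hpot := bfsPotential_scan (n := n) (m := m) (tgt := tgt) (queue := s'.arr .queue)
          (queue' := Function.update (s'.arr .queue) (s'.reg .back) (src e))
          (front := s'.reg .front) (e := e) (l := l) fun i hi => by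
            have := hinv.front_le
            rw [Function.update_of_ne (by omega)]
        refine ⟨bfsStep.cost, c * bfsPotential n m tgt
          (Function.update (s'.arr .queue) (s'.reg .back) (src e)) (s'.reg .front) l, ?_,
          .of_exec (by omega) ?_ ?_⟩
        · rw [← hpot, mul_add, mul_one, hc]; omega
        · intro _
          simp [bfsStep, he, inc, srcAddr, hsrcv, hd]
          omega
        · intro _
          simp only [bfsStep, inc, exec, eval, he, srcAddr, Nat.add_sub_cancel, hsrcv,
            ArrState.setReg_reg, ArrState.setReg_arr, if_true]
          refine ⟨hg.congr ?_ ?_ ?_ ?_ ?_ ?_, ?_, ?_, l,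
            by simpa [hd] using hinv.scan_unvisited hsn (htgt e hem) hd, ?_, ?_⟩ <;>
            simp [hi, hz, hl, hd]
      · have hpot := bfsPotential_scan (n := n) (m := m) (tgt := tgt) (queue := s'.arr .queue)
          (queue' := s'.arr .queue) (front := s'.reg .front) (e := e) (l := l) fun i hi => rfl
        refine ⟨bfsStep.cost, c * bfsPotential n m tgt (s'.arr .queue) (s'.reg .front) l, ?_,
          .of_exec (by omega) ?_ ?_⟩
        · rw [← hpot, mul_add, mul_one, hc]; omega
        · intro _
          simp [bfsStep, he, inc, srcAddr, hsrcv, hd]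
          omega
        · intro _
          simp only [bfsStep, inc, exec, eval, he, srcAddr, Nat.add_sub_cancel, hsrcv,
            ArrState.setReg_reg, ArrState.setReg_arr, if_true, Nat.succ_pos]
          refine ⟨hg.congr ?_ ?_ ?_ ?_ ?_ ?_, ?_, ?_, l,
            by simpa [hd] using hinv.scan_visited hsn (by omega), ?_, ?_⟩ <;>
            simp [hi, hz, hl, hd]
  · obtain ⟨h1, h2, h3, h4, h5, h6⟩ := hs₃
    refine ⟨h1, h2, h3, [], ?_, h5, ?_⟩
    · rw [h4]
      exact { h6 with current := fun h => absurd rfl h, edge := by simp }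
    · rw [h4, bfsPotential_zero htgt]
  · have h1 := Nat.mul_le_mul_right (bfsInitBody.cost + 8) (show n + 1 ≤ n + m + 1 by omega)
    have h2 := Nat.mul_le_mul_left c (show n + m ≤ n + m + 1 by omega)
    have e1 : (ArrExpr.reg .n).cost = 1 := rfl
    have e2 : (ArrProg.assign .front (.const 0)).cost = 2 := rfl
    have e3 : (ArrProg.assign .edge (.const 0)).cost = 2 := rfl
    have e4 : (ArrExpr.reg .front).cost + (ArrExpr.add (.reg .back) (.reg .edge)).cost + 1 = 5 :=
      rfl
    have e5 : (bfsInitBody.cost + c + 30) * (n + m + 1) =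
        (n + m + 1) * (bfsInitBody.cost + 8) + c * (n + m + 1) + 22 * (n + m + 1) := by ring
    have e6 : bfsInitBody.cost + 1 + 7 = bfsInitBody.cost + 8 := rfl
    rw [e1, e2, e3, e4, e5, e6]
    omega
  · rintro s' - ⟨⟨b, hg, hi, hz, l, hinv, hl, -⟩, hlt⟩
    simp only [eval] at hlt
    have hfb := hinv.front_le
    have he : s'.reg .edge = 0 := by omega
    have hl0 : l = [] := by
      cases l with
      | nil => rfl
      | cons e l => rw [he] at hl; exact absurd hl.1 (by omega)
    subst hl0
    have hf : s'.reg .front = s'.reg .back := by omega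
    rw [hf] at hinv
    exact ⟨hg, hi, hz, fun u hu => ⟨hinv.dist_le_card hu, hinv.sound u hu,
      fun d hd => hinv.complete htgt hu hd⟩⟩

end BFS

/-! ### The remaining parts of the marking program -/

/-- Computation of the integer square root. -/
def rootProg : ArrProg :=
  .seq (.assign .root (.const 0)) (.seq (.assign .square (.const 0))
    (.loop (.add (.add (.reg .square) (.reg .root)) (.reg .root)) (.reg .n)
      (.seq (.assign .square
        (.add (.add (.add (.reg .square) (.reg .root)) (.reg .root)) (.const 1))) (inc .root))))

/-- Move the marks of the target states to the zero set. -/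
def copyBody : ArrProg :=
  .seq (.store .zero (.reg .idx) (.inp (.add (.const 2) (.reg .idx))))
    (.output (.add (.const 2) (.reg .idx)) (.const 0))

/-- Insert an edge into the list of its end. -/
def linkBody : ArrProg :=
  .seq (.store .next (.reg .idx) (.arr .head (.inp (tgtAddr (.reg .idx)))))
    (.store .head (.inp (tgtAddr (.reg .idx))) (.add (.reg .idx) (.const 1)))

/-- Read the input and build the lists of edges. -/
def setup : ArrProg :=
  .seq (.assign .n (.inp (.const 0))) (.seq (.assign .m (.inp (.const 1)))
    (.seq rootProg (.seq (forLoop .idx (.reg .n) copyBody) (forLoop .idx (.reg .m) linkBody))))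

/-- Add an unreached vertex to the zero set. -/
def unreachedBody : ArrProg :=
  .ite (.arr .dist (.reg .idx)) (.const 1) (.store .zero (.reg .idx) (.const 1)) .skip

/-- Clear a counter. -/
def clearBody : ArrProg := .store .count (.reg .idx) (.const 0)

/-- Count a vertex. -/
def countBody : ArrProg :=
  .seq (.store .count (.arr .dist (.reg .idx))
      (.add (.arr .count (.arr .dist (.reg .idx))) (.const 1)))
    (.ite (.reg .top) (.arr .dist (.reg .idx)) (.assign .top (.arr .dist (.reg .idx))) .skip)

/-- Three times the loop variable. -/
def tripleIdx : ArrExpr := .add (.add (.reg .idx) (.reg .idx)) (.reg .idx)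

/-- Compare a level in the middle third with the best one so far. -/
def bestBody : ArrProg :=
  .ite (.reg .top) (.add tripleIdx (.const 2))
    (.ite (.add tripleIdx (.const 1)) (.add (.reg .top) (.reg .top))
      (.ite (.reg .best) (.const 1)
        (.assign .best (.add (.reg .idx) (.const 1)))
        (.ite (.arr .count (.add (.reg .idx) (.const 1))) (.arr .count (.reg .best))
          (.assign .best (.add (.reg .idx) (.const 1))) .skip))
      .skip)
    .skip

/-- Compute the levels and a smallest level in the middle third. -/
def roundProg : ArrProg :=
  .seq bfs (.seq (forLoop .idx (.add (.reg .n) (.const 1)) clearBody)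
    (.seq (.assign .top (.const 0)) (.seq (forLoop .idx (.reg .n) countBody)
      (.seq (.assign .best (.const 0)) (forLoop .idx (.reg .top) bestBody)))))

/-- Mark a vertex if it belongs to the best level. -/
def markBody : ArrProg :=
  .ite (.arr .dist (.reg .idx)) (.add (.reg .best) (.const 1))
    (.ite (.reg .best) (.add (.arr .dist (.reg .idx)) (.const 1))
      (.seq (.store .zero (.reg .idx) (.const 1))
        (.output (.add (.const 2) (.reg .idx)) (.const 1)))
      .skip)
    .skip

section Setup

variable {n m : ℕ} {src tgt : ℕ → ℕ} {B : ℕ} {s : ArrState}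

/-- The test `root² + 2 * root < n` says that `(root + 1)² ≤ n`, so `square` never exceeds `n`. It
grows by at least one per turn, which makes the crude linear budget sufficient. -/
theorem runs_rootProg {D : ℕ} (hD : n ≤ D) (hD1 : 1 ≤ D) (hs : s.reg .n = n) :
    Runs B D rootProg s (20 * (n + 1)) fun s' => s'.reg .root = Nat.sqrt n ∧
      s'.reg .n = n ∧ s'.reg .m = s.reg .m ∧ s'.inp = s.inp ∧ s'.arr = s.arr := by
  refine ((Runs.of_exec hD1 (Q := fun s' => s'.reg .root = 0 ∧
      s'.reg .n = n ∧ s'.reg .m = s.reg .m ∧ s'.inp = s.inp ∧ s'.arr = s.arr) ?_ ?_).seq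
    fun s₁ hs₁ => (Runs.of_exec hD1 (Q := fun s' => s'.reg .square = 0 ∧ s'.reg .root = 0 ∧
      s'.reg .n = n ∧ s'.reg .m = s.reg .m ∧ s'.inp = s.inp ∧ s'.arr = s.arr) ?_ ?_).seq
    fun s₂ hs₂ => Runs.loop hD1 (b := 20 * n) (I := fun b s' => b = 20 * (n - s'.reg .square) ∧
      s'.reg .square = s'.reg .root * s'.reg .root ∧ s'.reg .square ≤ n ∧
      s'.reg .n = n ∧ s'.reg .m = s.reg .m ∧ s'.inp = s.inp ∧ s'.arr = s.arr)
      ?_ ?_ ?_).mono ?_ ?_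
  · simp
  · simp [hs]
  · simp
  · obtain ⟨h1, h2, h3, h4, h5⟩ := hs₁
    simp [h1, h2, h3, h4, h5]
  · simp
  · rintro b s' ⟨rfl, h1, h2, h3, h4, h5, h6⟩ - hlt
    simp only [eval, h3] at hlt
    refine ⟨12, 20 * (n - (s'.reg .square + s'.reg .root + s'.reg .root + 1)), ?_,
      .of_exec hD1 (fun hbd => ?_) fun _ => ?_⟩
    · have : (ArrExpr.add (.add (.reg .square) (.reg .root)) (.reg .root)).cost +
        (ArrExpr.reg .n).cost + 1 = 7 := rfl
      rw [this]
      omega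
    · have : s'.reg .root ≤ s'.reg .square := by
        rw [h1]; exact Nat.le_mul_self _
      simp [inc]
      omega
    · simp only [exec, inc, eval, ArrState.setReg_reg, ArrState.setReg_inp, ArrState.setReg_arr]
      simp only [reduceCtorEq, if_true, if_false]
      refine ⟨trivial, ?_, by omega, h3, h4, h5, h6⟩
      rw [h1]
      ring
  · obtain ⟨h1, h2, h3, h4, h5, h6⟩ := hs₂
    exact ⟨by rw [h1, Nat.sub_zero], by rw [h1, h2], by omega, h3, h4, h5, h6⟩
  · have e1 : (ArrProg.assign .root (.const 0)).cost = 2 := rfl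
    have e2 : (ArrProg.assign .square (.const 0)).cost = 2 := rfl
    have e3 : (ArrExpr.add (.add (.reg .square) (.reg .root)) (.reg .root)).cost +
        (ArrExpr.reg .n).cost + 1 = 7 := rfl
    rw [e1, e2, e3]
    omega
  · rintro s' - ⟨⟨b, -, h1, h2, h3, h4, h5, h6⟩, hlt⟩
    simp only [eval, h3] at hlt
    refine ⟨?_, h3, h4, h5, h6⟩
    rw [Nat.eq_sqrt]
    refine ⟨by omega, ?_⟩
    have : (s'.reg .root + 1) * (s'.reg .root + 1) =
      s'.reg .root * s'.reg .root + s'.reg .root + s'.reg .root + 1 := by ring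
    omega

/-- The input of the marking program. -/
structure IsInput (n m : ℕ) (src tgt : ℕ → ℕ) (s : ArrState) : Prop where
  inp_zero : s.inp 0 = n
  inp_one : s.inp 1 = m
  inp_src : ∀ e < m, s.inp (2 + n + (e + e)) = src e
  inp_tgt : ∀ e < m, s.inp (2 + n + (e + e) + 1) = tgt e
  head : ∀ v, s.arr .head v = 0

/-- The target marks move to the array `zero` because their input cells will collect the output,
starting from the empty set. Edge `i` is put in front of the list of its end; older lists only use
links below `i` and stay intact. -/
theorem exists_runs_setup : ∃ K, ∀ (n m B : ℕ) (src tgt : ℕ → ℕ) (s : ArrState),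
    IsInput n m src tgt s →
    Runs B (2 + n + 2 * m) setup s (K * (n + m + 1)) fun s' => HoldsGraph n m src tgt s' ∧
      (∀ u < n, s'.arr .zero u = s.inp (2 + u)) ∧ ∀ u < n, s'.inp (2 + u) = 0 := by
  refine ⟨copyBody.cost + linkBody.cost + 60, fun n m B src tgt s hs => ?_⟩
  refine ((Runs.of_exec (by omega) (Q := fun s' => s'.reg .n = n ∧ s'.inp = s.inp ∧
      s'.arr = s.arr) ?_ ?_).seq fun s₁ hs₁ =>
    (Runs.of_exec (by omega) (Q := fun s' => s'.reg .m = m ∧ s'.reg .n = n ∧ s'.inp = s.inp ∧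
      s'.arr = s.arr) ?_ ?_).seq fun s₂ hs₂ =>
    ((runs_rootProg (by omega) (by omega) hs₂.2.1).seq fun s₃ hs₃ =>
    ((Runs.forLoop (by omega) (N := n) (by omega) (I := fun i s' => s'.reg .idx = i ∧
      s'.reg .root = Nat.sqrt n ∧ s'.reg .m = m ∧ s'.reg .n = n ∧
      (∀ u < i, s'.arr .zero u = s.inp (2 + u)) ∧ (∀ u < i, s'.inp (2 + u) = 0) ∧
      (∀ u, i ≤ u → s'.inp (2 + u) = s.inp (2 + u)) ∧ s'.arr .head = s.arr .head)
      ?_ ?_ ?_).seq fun s₄ hs₄ =>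
    Runs.forLoop (by omega) (N := m) (by omega) (I := fun i s' => s'.reg .idx = i ∧
      s'.reg .root = Nat.sqrt n ∧ s'.reg .m = m ∧ s'.reg .n = n ∧
      (∀ u < n, s'.arr .zero u = s.inp (2 + u)) ∧ (∀ u < n, s'.inp (2 + u) = 0) ∧
      (∀ u, n ≤ u → s'.inp (2 + u) = s.inp (2 + u)) ∧
      ∀ v, IsLinked (s'.arr .next) (s'.arr .head v) (edgesInto tgt i v))
      ?_ ?_ ?_))).mono ?_ ?_
  · intro hbd
    simpa using hbd.inp 0
  · simp [hs.inp_zero]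
  · obtain ⟨h1, h2, h3⟩ := hs₁
    intro hbd
    have := hbd.inp 1
    simp
    omega
  · obtain ⟨h1, h2, h3⟩ := hs₁
    simp [h1, h2, h3, hs.inp_one]
  · rintro i s' ⟨h1, -, -, h2, -⟩
    exact ⟨h1, trivial, h2⟩
  · rintro i s' ⟨h1, h2, h3, h4, h5, h6, h7, h8⟩ hi hbd
    have := hbd.inp (2 + i)
    refine ⟨?_, ?_, ?_⟩
    · simp [copyBody, h1]; omega
    · simp [copyBody, h1]
    · simp only [copyBody, inc, exec, eval, h1]
      refine ⟨?_, ?_, ?_, ?_, ?_, ?_, ?_, ?_⟩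
      any_goals simp [h1, h2, h3, h4, h8]
      · intro u hu
        by_cases hui : u = i
        · simp [hui, h7]
        · simp [hui, h5 u (by omega)]
      · intro u hu
        by_cases hui : u = i
        · simp [hui]
        · simp [hui, h6 u (by omega)]
      · intro u hu
        have hui : u ≠ i := by omega
        simp [hui, h7 u (by omega)]
  · obtain ⟨h1, h2, h3, h4, h5⟩ := hs₃
    obtain ⟨g1, g2, g3, g4⟩ := hs₂
    simp [h1, h2, h3, h4, h5, g1, g3, g4]
  · rintro i s' ⟨h1, -, h2, -⟩
    exact ⟨h1, trivial, h2⟩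
  · rintro i s' ⟨h1, h2, h3, h4, h5, h6, h7, h8⟩ hi hbd
    have ht : s'.inp (2 + n + (i + i) + 1) = tgt i := by
      have e : 2 + n + (i + i) + 1 = 2 + (n + (i + i) + 1) := by ring
      rw [e, h7 _ (by omega), ← e, hs.inp_tgt i hi]
    have := hbd.arr .head (tgt i)
    refine ⟨?_, ?_, ?_⟩
    · simp [linkBody, tgtAddr, srcAddr, h1, h4, ht]; omega
    · simp [linkBody, h1]
    · simp only [linkBody, tgtAddr, srcAddr, inc, exec, eval, h1, h4, ht, ArrState.setArr_reg,
        ArrState.setArr_inp]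
      refine ⟨?_, ?_, ?_, ?_, ?_, ?_, ?_, ?_⟩
      any_goals simp [h2, h3, h4]
      · exact h5
      · exact h6
      · exact h7
      · intro v
        have hcongr : ∀ {h}, IsLinked (s'.arr .next) h (edgesInto tgt i v) →
            IsLinked (Function.update (s'.arr .next) i (s'.arr .head (tgt i))) h
              (edgesInto tgt i v) := fun h =>
          h.congr fun e he => by
            have := (mem_edgesInto.1 he).1
            rw [Function.update_of_ne (by omega)]
        by_cases hv : tgt i = v
        · subst hv
          simp only [Function.update_self, edgesInto, if_true, IsLinked, true_and]
          exact hcongr (h8 _)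
        · rw [Function.update_of_ne (Ne.symm hv)]
          simp only [edgesInto, if_neg hv]
          exact hcongr (h8 v)
  · obtain ⟨h1, h2, h3, h4, h5, h6, h7, h8⟩ := hs₄
    refine ⟨?_, ?_, ?_, ?_, ?_, ?_, ?_, ?_⟩
    any_goals simp [h2, h3, h4]
    · exact h5
    · exact h6
    · exact h7
    · intro v
      simp [h8, hs.head, edgesInto, IsLinked]
  · have e1 : (ArrProg.assign .n (.inp (.const 0))).cost = 3 := rfl
    have e2 : (ArrProg.assign .m (.inp (.const 1))).cost = 3 := rfl
    have e3 : (ArrExpr.reg .n).cost = 1 := rfl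
    have e4 : (ArrExpr.reg .m).cost = 1 := rfl
    rw [e1, e2, e3, e4]
    have h1 := Nat.mul_le_mul_right (copyBody.cost + 1 + 7) (show n + 1 ≤ n + m + 1 by omega)
    have h2 := Nat.mul_le_mul_right (linkBody.cost + 1 + 7) (show m + 1 ≤ n + m + 1 by omega)
    have e5 : (copyBody.cost + linkBody.cost + 60) * (n + m + 1) =
      (n + m + 1) * (copyBody.cost + 1 + 7) + (n + m + 1) * (linkBody.cost + 1 + 7) +
        44 * (n + m + 1) := by ring
    rw [e5]
    omega
  · rintro s' - ⟨h1, h2, h3, h4, h5, h6, h7, h8⟩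
    refine ⟨⟨h4, h3, h2, fun e he => ?_, fun v _ => h8 v⟩, h5, h6⟩
    have e' : 2 + n + (e + e) = 2 + (n + (e + e)) := by ring
    rw [e', h7 _ (by omega), ← e', hs.inp_src e he]

end Setup

section Round

variable {n m : ℕ} {src tgt : ℕ → ℕ} {B : ℕ} {s : ArrState}

/-- After a search from the targets, the entry 0 marks the states that cannot reach them. Together
with the targets these form level zero. -/
theorem runs_unreached (hs : HoldsGraph n m src tgt s) :
    Runs B (2 + n + 2 * m) (forLoop .idx (.reg .n) unreachedBody) s
      ((n + 1) * (unreachedBody.cost + 8)) fun s' => HoldsGraph n m src tgt s' ∧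
      s'.inp = s.inp ∧
      ∀ u < n, s'.arr .zero u = if s.arr .dist u = 0 then 1 else s.arr .zero u := by
  refine (Runs.forLoop (by omega) (N := n) (by omega) (I := fun i s' => s'.reg .idx = i ∧
      HoldsGraph n m src tgt s' ∧ s'.inp = s.inp ∧ s'.arr .dist = s.arr .dist ∧
      (∀ u < i, s'.arr .zero u = if s.arr .dist u = 0 then 1 else s.arr .zero u) ∧
      ∀ u, i ≤ u → s'.arr .zero u = s.arr .zero u) ?_ ?_ ?_).mono le_rfl ?_
  · rintro i s' ⟨h1, h2, -⟩
    exact ⟨h1, trivial, h2.reg_n⟩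
  · rintro i s' ⟨h1, h2, h3, h4, h5, h6⟩ hi hbd
    by_cases hd : s.arr .dist i = 0
    · refine ⟨?_, ?_, ?_⟩
      · simp [unreachedBody, h1, h4, hd]; omega
      · simp [unreachedBody, h1, h4, hd]
      · simp only [unreachedBody, inc, exec, eval, h1, h4, hd, Nat.zero_lt_one, if_true]
        refine ⟨?_, h2.congr ?_ ?_ ?_ ?_ ?_ ?_, ?_, ?_, ?_, ?_⟩
        any_goals simp [h1, h3, h4]
        · intro u hu
          by_cases hui : u = i
          · simp [hui, hd]
          · simp [hui, h5 u (by omega)]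
        · intro u hu
          have hui : u ≠ i := by omega
          simp [hui, h6 u (by omega)]
    · refine ⟨?_, ?_, ?_⟩
      · simp [unreachedBody, h1, h4, hd]
      · simp [unreachedBody, h1, h4, hd]
      · have hd' : ¬ s.arr .dist i < 1 := by omega
        simp only [unreachedBody, inc, exec, eval, h1, h4, hd', if_false]
        refine ⟨?_, h2.congr ?_ ?_ ?_ ?_ ?_ ?_, ?_, ?_, ?_, ?_⟩
        any_goals simp [h3, h4]
        · intro u hu
          by_cases hui : u = i
          · simp [hui, hd, h6]
          · simp [h5 u (by omega)]
        · intro u hu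
          exact h6 u (by omega)
  · refine ⟨?_, hs.congr ?_ ?_ ?_ ?_ ?_ ?_, ?_, ?_, ?_, ?_⟩ <;> simp
  · rintro s' - ⟨h1, h2, h3, h4, h5, h6⟩
    exact ⟨h2, h3, h5⟩

/-- The machine only has strict comparisons, so equality with `best` is tested by `dist < best + 1`
and `best < dist + 1`. -/
theorem runs_mark (hs : HoldsGraph n m src tgt s) :
    Runs B (2 + n + 2 * m) (forLoop .idx (.reg .n) markBody) s
      ((n + 1) * (markBody.cost + 8)) fun s' => HoldsGraph n m src tgt s' ∧
      (∀ u < n, s'.arr .zero u = if s.arr .dist u = s.reg .best then 1 else s.arr .zero u) ∧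
      ∀ u < n, s'.inp (2 + u) = if s.arr .dist u = s.reg .best then 1 else s.inp (2 + u) := by
  refine (Runs.forLoop (by omega) (N := n) (by omega) (I := fun i s' => s'.reg .idx = i ∧
      HoldsGraph n m src tgt s' ∧ s'.reg .best = s.reg .best ∧ s'.arr .dist = s.arr .dist ∧
      (∀ u < i, s'.arr .zero u = if s.arr .dist u = s.reg .best then 1 else s.arr .zero u) ∧
      (∀ u < i, s'.inp (2 + u) = if s.arr .dist u = s.reg .best then 1 else s.inp (2 + u)) ∧
      ∀ u, i ≤ u → s'.arr .zero u = s.arr .zero u ∧ s'.inp (2 + u) = s.inp (2 + u))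
      ?_ ?_ ?_).mono le_rfl ?_
  · rintro i s' ⟨h1, h2, -⟩
    exact ⟨h1, trivial, h2.reg_n⟩
  · rintro i s' ⟨h1, h2, h3, h4, h5, h6, h7⟩ hi hbd
    by_cases hd : s.arr .dist i = s.reg .best
    · refine ⟨?_, ?_, ?_⟩
      · simp [markBody, h1, h3, h4, hd]; omega
      · simp [markBody, h1, h3, h4, hd]
      · simp only [markBody, inc, exec, eval, h1, h3, h4, hd, Nat.lt_succ_self, if_true,
          ArrState.setArr_reg]
        refine ⟨?_, h2.congr ?_ ?_ ?_ ?_ ?_ ?_, ?_, ?_, ?_, ?_, ?_⟩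
        any_goals simp [h1, h3, h4]
        · intro a ha
          rw [Function.update_of_ne (by omega)]
        · intro u hu
          by_cases hui : u = i
          · simp [hui, hd]
          · simp [hui, h5 u (by omega)]
        · intro u hu
          by_cases hui : u = i
          · simp [hui, hd]
          · simp [hui, h6 u (by omega)]
        · intro u hu
          have hui : u ≠ i := by omega
          simp [hui, h7 u (by omega)]
    · have hsame : markBody.exec s' = s' := by
        simp only [markBody, exec, eval, h1, h3, h4]
        split_ifs <;> first | rfl | omega
      refine ⟨?_, by rw [hsame, h1], ?_⟩
      · simp only [markBody, Safe, Ok, eval, h1, h3, h4, true_and]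
        split_ifs; first | trivial | omega
      · rw [hsame]
        simp only [inc, exec, eval, h1]
        refine ⟨?_, h2.congr ?_ ?_ ?_ ?_ ?_ ?_, ?_, ?_, ?_, ?_, ?_⟩
        any_goals simp [h3, h4]
        · intro u hu
          by_cases hui : u = i
          · simp [hui, hd, h7]
          · simp [h5 u (by omega)]
        · intro u hu
          by_cases hui : u = i
          · simp [hui, hd, h7]
          · simp [h6 u (by omega)]
        · intro u hu
          exact h7 u (by omega)
  · refine ⟨?_, hs.congr ?_ ?_ ?_ ?_ ?_ ?_, ?_, ?_, ?_, ?_, ?_⟩ <;> simp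
  · rintro s' - ⟨h1, h2, h3, h4, h5, h6, h7⟩
    exact ⟨h2, h5, h6⟩

/-- The number of vertices with a given entry. -/
def entryCount (n : ℕ) (dist : ℕ → ℕ) (d : ℕ) : ℕ := ((Finset.range n).filter (dist · = d)).card

/-- Level `j` lies in the middle third of `top` levels, where level zero is included. -/
def InMiddle (top j : ℕ) : Prop := top < 3 * j + 2 ∧ 3 * j + 1 < 2 * top

instance (top j : ℕ) : Decidable (InMiddle top j) := inferInstanceAs (Decidable (_ ∧ _))

/-- The entry `best` describes a smallest level in the middle third. -/
def IsBest (n : ℕ) (dist : ℕ → ℕ) (top best : ℕ) : Prop :=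
  (0 < best → InMiddle top (best - 1)) ∧
    ∀ j, InMiddle top j → 0 < best ∧ entryCount n dist best ≤ entryCount n dist (j + 1)

theorem entryCount_succ (i : ℕ) (dist : ℕ → ℕ) (d : ℕ) :
    entryCount (i + 1) dist d = entryCount i dist d + if dist i = d then 1 else 0 := by
  unfold entryCount
  rw [Finset.range_add_one, Finset.filter_insert]
  split_ifs with h
  · rw [Finset.card_insert_of_notMem (by simp)]
  · rfl

theorem entryCount_le (i : ℕ) (dist : ℕ → ℕ) (d : ℕ) : entryCount i dist d ≤ i :=
  (Finset.card_filter_le _ _).trans_eq (Finset.card_range i)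

theorem runs_clear (hs : HoldsGraph n m src tgt s) :
    Runs B (2 + n + 2 * m) (forLoop .idx (.add (.reg .n) (.const 1)) clearBody) s
      ((n + 2) * (clearBody.cost + 10)) fun s' => HoldsGraph n m src tgt s' ∧
      s'.inp = s.inp ∧ s'.arr .zero = s.arr .zero ∧ s'.arr .dist = s.arr .dist ∧
      ∀ d ≤ n, s'.arr .count d = 0 := by
  refine (Runs.forLoop (by omega) (N := n + 1) (by omega) (I := fun i s' => s'.reg .idx = i ∧
      HoldsGraph n m src tgt s' ∧ s'.inp = s.inp ∧ s'.arr .zero = s.arr .zero ∧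
      s'.arr .dist = s.arr .dist ∧ ∀ d < i, s'.arr .count d = 0) ?_ ?_ ?_).mono le_rfl ?_
  · rintro i s' ⟨h1, h2, -⟩
    exact ⟨h1, ⟨trivial, trivial⟩, by simp [h2.reg_n]⟩
  · rintro i s' ⟨h1, h2, h3, h4, h5, h6⟩ hi hbd
    refine ⟨?_, ?_, ?_⟩
    · simp [clearBody]
    · simp [clearBody, h1]
    · simp only [clearBody, inc, exec, eval, h1]
      refine ⟨?_, h2.congr ?_ ?_ ?_ ?_ ?_ ?_, ?_, ?_, ?_, ?_⟩
      any_goals simp [h1, h3, h4, h5]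
      intro d hd
      by_cases hdi : d = i
      · simp [hdi]
      · simp [hdi, h6 d (by omega)]
  · refine ⟨?_, hs.congr ?_ ?_ ?_ ?_ ?_ ?_, ?_, ?_, ?_, ?_⟩ <;> simp
  · rintro s' - ⟨h1, h2, h3, h4, h5, h6⟩
    exact ⟨h2, h3, h4, h5, fun d hd => h6 d (by omega)⟩

theorem runs_count (hs : HoldsGraph n m src tgt s) (htop : s.reg .top = 0)
    (hcount : ∀ d ≤ n, s.arr .count d = 0) (hdist : ∀ u < n, s.arr .dist u ≤ n) :
    Runs B (2 + n + 2 * m) (forLoop .idx (.reg .n) countBody) s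
      ((n + 1) * (countBody.cost + 8)) fun s' => HoldsGraph n m src tgt s' ∧
      s'.inp = s.inp ∧ s'.arr .zero = s.arr .zero ∧ s'.arr .dist = s.arr .dist ∧
      (∀ d ≤ n, s'.arr .count d = entryCount n (s.arr .dist) d) ∧
      (∀ u < n, s.arr .dist u ≤ s'.reg .top) ∧
      (s'.reg .top = 0 ∨ ∃ u < n, s.arr .dist u = s'.reg .top) := by
  refine (Runs.forLoop (by omega) (N := n) (by omega) (I := fun i s' => s'.reg .idx = i ∧
      HoldsGraph n m src tgt s' ∧ s'.inp = s.inp ∧ s'.arr .zero = s.arr .zero ∧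
      s'.arr .dist = s.arr .dist ∧
      (∀ d ≤ n, s'.arr .count d = entryCount i (s.arr .dist) d) ∧
      (∀ u < i, s.arr .dist u ≤ s'.reg .top) ∧
      (s'.reg .top = 0 ∨ ∃ u < n, s.arr .dist u = s'.reg .top)) ?_ ?_ ?_).mono le_rfl ?_
  · rintro i s' ⟨h1, h2, -⟩
    exact ⟨h1, trivial, h2.reg_n⟩
  · rintro i s' ⟨h1, h2, h3, h4, h5, h6, h7, h8⟩ hi hbd
    have hdi := hdist i hi
    have hci := h6 _ hdi
    have hce := entryCount_le i (s.arr .dist) (s.arr .dist i)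
    have hcount' : ∀ d ≤ n, Function.update (s'.arr .count) (s.arr .dist i)
        (s'.arr .count (s.arr .dist i) + 1) d = entryCount (i + 1) (s.arr .dist) d := by
      intro d hd
      rw [entryCount_succ]
      by_cases hdd : d = s.arr .dist i
      · subst hdd
        simp [hci]
      · simp [hdd, h6 d hd, Ne.symm hdd]
    by_cases ht : s'.reg .top < s.arr .dist i
    · refine ⟨?_, ?_, ?_⟩
      · simp [countBody, h1, h5, ht]; omega
      · simp [countBody, h1, h5, ht]
      · simp only [countBody, inc, exec, eval, h1, h5, ArrState.setArr_reg, ArrState.setArr_arr,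
          reduceCtorEq, if_false, ht, if_true]
        refine ⟨?_, h2.congr ?_ ?_ ?_ ?_ ?_ ?_, ?_, ?_, ?_, ?_, ?_, ?_⟩
        any_goals simp [h1, h3, h4, h5]
        · exact hcount'
        · intro u hu
          rcases Nat.le_iff_lt_or_eq.1 hu with h' | rfl
          · exact (h7 u h').trans ht.le
          · exact le_rfl
        · exact Or.inr ⟨i, hi, rfl⟩
    · refine ⟨?_, ?_, ?_⟩
      · simp [countBody, h1, h5, ht]; omega
      · simp [countBody, h1, h5, ht]
      · simp only [countBody, inc, exec, eval, h1, h5, ArrState.setArr_reg, ArrState.setArr_arr,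
          reduceCtorEq, if_false, ht]
        refine ⟨?_, h2.congr ?_ ?_ ?_ ?_ ?_ ?_, ?_, ?_, ?_, ?_, ?_, ?_⟩
        any_goals simp [h3, h4, h5]
        · exact hcount'
        · intro u hu
          rcases Nat.le_iff_lt_or_eq.1 hu with h' | rfl
          · exact h7 u h'
          · omega
        · exact h8
  · refine ⟨?_, hs.congr ?_ ?_ ?_ ?_ ?_ ?_, ?_, ?_, ?_, ?_, ?_, ?_⟩
    any_goals simp
    · intro d hd
      simp [hcount d hd, entryCount]
    · exact Or.inl htop
  · rintro s' - ⟨h1, h2, h3, h4, h5, h6, h7, h8⟩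
    exact ⟨h2, h3, h4, h5, h6, h7, h8⟩

/-- The variable `best` holds a level plus one, which is also its index in `count`; the value 0
means that no level was found yet. For `top = k + 1` the condition `InMiddle` is `k ≤ 3j ≤ 2k`. -/
theorem runs_best (hs : HoldsGraph n m src tgt s) (hbest : s.reg .best = 0)
    (htop : s.reg .top ≤ n)
    (hcount : ∀ d ≤ n, s.arr .count d = entryCount n (s.arr .dist) d) :
    Runs B (2 + n + 2 * m) (forLoop .idx (.reg .top) bestBody) s
      ((s.reg .top + 1) * (bestBody.cost + 8)) fun s' => HoldsGraph n m src tgt s' ∧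
      s'.inp = s.inp ∧ s'.arr = s.arr ∧ s'.reg .top = s.reg .top ∧
      IsBest n (s.arr .dist) (s.reg .top) (s'.reg .best) := by
  refine (Runs.forLoop (by omega) (N := s.reg .top) (by omega) (I := fun i s' =>
      s'.reg .idx = i ∧ HoldsGraph n m src tgt s' ∧ s'.inp = s.inp ∧ s'.arr = s.arr ∧
      s'.reg .top = s.reg .top ∧ s'.reg .best ≤ i ∧
      (0 < s'.reg .best → InMiddle (s.reg .top) (s'.reg .best - 1)) ∧
      ∀ j < i, InMiddle (s.reg .top) j → 0 < s'.reg .best ∧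
        entryCount n (s.arr .dist) (s'.reg .best) ≤ entryCount n (s.arr .dist) (j + 1))
      ?_ ?_ ?_).mono le_rfl ?_
  · rintro i s' ⟨h1, -, -, -, h2, -⟩
    exact ⟨h1, trivial, h2⟩
  · rintro i s' ⟨h1, h2, h3, h4, h5, h6, h7, h8⟩ hi hbd
    have hmid : InMiddle (s.reg .top) i ↔ s.reg .top < i + i + i + 2 ∧
        i + i + i + 1 < s.reg .top + s.reg .top := by
      unfold InMiddle; omega
    have hex : bestBody.exec s' = if InMiddle (s.reg .top) i ∧
        (s'.reg .best = 0 ∨ entryCount n (s.arr .dist) (i + 1) <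
          entryCount n (s.arr .dist) (s'.reg .best)) then s'.setReg .best (i + 1) else s' := by
      simp only [bestBody, tripleIdx, exec, eval, h1, h4, h5, hmid]
      rw [hcount (i + 1) (by omega), hcount (s'.reg .best) (by omega)]
      split_ifs <;> first | rfl | omega
    refine ⟨?_, ?_, ?_⟩
    · simp only [bestBody, tripleIdx, Safe, Ok, eval, h1, true_and, and_true]
      split_ifs <;> omega
    · rw [hex]
      split_ifs <;> simp [h1]
    · rw [hex]
      split_ifs with hc
      · simp only [inc, exec, eval]
        refine ⟨?_, h2.congr ?_ ?_ ?_ ?_ ?_ ?_, ?_, ?_, ?_, ?_, ?_, ?_⟩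
        any_goals simp [h1, h3, h4, h5]
        · exact hc.1
        · intro j hj hjm
          rcases Nat.le_iff_lt_or_eq.1 hj with h' | rfl
          · obtain ⟨ha, hb⟩ := h8 j h' hjm
            omega
          · exact le_rfl
      · simp only [inc, exec, eval]
        refine ⟨?_, h2.congr ?_ ?_ ?_ ?_ ?_ ?_, ?_, ?_, ?_, ?_, ?_, ?_⟩
        any_goals simp [h1, h3, h4, h5]
        · omega
        · exact h7
        · intro j hj hjm
          rcases Nat.le_iff_lt_or_eq.1 hj with h' | rfl
          · exact h8 j h' hjm
          · rw [not_and, not_or] at hc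
            have := hc hjm
            omega
  · refine ⟨?_, hs.congr ?_ ?_ ?_ ?_ ?_ ?_, ?_, ?_, ?_, ?_, ?_, ?_⟩ <;> simp [hbest]
  · rintro s' - ⟨h1, h2, h3, h4, h5, h6, h7, h8⟩
    exact ⟨h2, h3, h4, h5, h7, fun j hj => h8 j (by unfold InMiddle at hj; omega) hj⟩

/-- The result of the computation of the levels. -/
structure HasLevels (n m : ℕ) (src tgt : ℕ → ℕ) (s : ArrState) : Prop where
  graph : HoldsGraph n m src tgt s
  dist : IsDist n m src tgt (fun u => 0 < s.arr .zero u) (s.arr .dist)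
  le_top : ∀ u < n, s.arr .dist u ≤ s.reg .top
  top_eq : s.reg .top = 0 ∨ ∃ u < n, s.arr .dist u = s.reg .top
  best : IsBest n (s.arr .dist) (s.reg .top) (s.reg .best)

theorem exists_runs_round : ∃ K, ∀ (n m B : ℕ) (src tgt : ℕ → ℕ) (s : ArrState),
    HoldsGraph n m src tgt s → (∀ e < m, src e < n) → (∀ e < m, tgt e < n) →
    Runs B (2 + n + 2 * m) roundProg s (K * (n + m + 1)) fun s' =>
      HasLevels n m src tgt s' ∧ s'.inp = s.inp ∧ s'.arr .zero = s.arr .zero := by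
  obtain ⟨K, hK⟩ := exists_runs_bfs
  refine ⟨K + 2 * clearBody.cost + countBody.cost + bestBody.cost + 50,
    fun n m B src tgt s hs hsrc htgt => ?_⟩
  refine ((hK n m B src tgt s hs hsrc htgt).seq fun s₁ hs₁ =>
    (runs_clear hs₁.1).seq fun s₂ hs₂ =>
    (Runs.of_exec (by omega) (Q := fun s' => HoldsGraph n m src tgt s' ∧
      s'.inp = s.inp ∧ s'.arr .zero = s.arr .zero ∧ s'.arr .dist = s₁.arr .dist ∧
      s'.reg .top = 0 ∧ ∀ d ≤ n, s'.arr .count d = 0) ?_ ?_).seq fun s₃ hs₃ =>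
    (runs_count hs₃.1 hs₃.2.2.2.2.1 hs₃.2.2.2.2.2 ?_).seq fun s₄ hs₄ =>
    (Runs.of_exec (by omega) (Q := fun s' => HoldsGraph n m src tgt s' ∧
      s'.inp = s.inp ∧ s'.arr = s₄.arr ∧ s'.reg .top = s₄.reg .top ∧ s'.reg .best = 0)
      ?_ ?_).seq fun s₅ hs₅ => (runs_best hs₅.1 hs₅.2.2.2.2 ?_ ?_).mono
        (c := (n + 1) * (bestBody.cost + 8)) (R := fun s' => HasLevels n m src tgt s' ∧
          s'.inp = s.inp ∧ s'.arr .zero = s.arr .zero) ?_ fun s' _ hs' => ?_).mono ?_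
        fun _ _ h => h
  · simp
  · obtain ⟨h1, h2, h3, h4⟩ := hs₁
    obtain ⟨g1, g2, g3, g4, g5⟩ := hs₂
    refine fun _ => ⟨g1.congr ?_ ?_ ?_ ?_ ?_ ?_, ?_, ?_, ?_, ?_, ?_⟩
    any_goals simp [h2, h3, g2, g3, g4]
    exact g5
  · rw [hs₃.2.2.2.1]
    exact fun u hu => (hs₁.2.2.2 u hu).1
  · simp
  · obtain ⟨f1, f2, f3, f4, f5, f6⟩ := hs₃
    obtain ⟨g1, g2, g3, g4, g5⟩ := hs₄
    refine fun _ => ⟨g1.congr ?_ ?_ ?_ ?_ ?_ ?_, ?_, ?_, ?_, ?_⟩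
    all_goals simp [f2, g2]
  · obtain ⟨h1, h2, h3, h4⟩ := hs₁
    obtain ⟨g1, g2, g3, g4, g5, g6, g7⟩ := hs₄
    obtain ⟨f1, f2, f3, f4, f5, f6⟩ := hs₃
    rw [hs₅.2.2.2.1]
    rcases g7 with h | ⟨u, hu, h⟩
    · omega
    · rw [← h, f4]
      exact (h4 u hu).1
  · obtain ⟨g1, g2, g3, g4, g5, g6, g7⟩ := hs₄
    rw [hs₅.2.2.1, g4]
    exact g5
  · have htop : s₅.reg .top ≤ n := by
      obtain ⟨h1, h2, h3, h4⟩ := hs₁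
      obtain ⟨g1, g2, g3, g4, g5, g6, g7⟩ := hs₄
      obtain ⟨f1, f2, f3, f4, f5, f6⟩ := hs₃
      rw [hs₅.2.2.2.1]
      rcases g7 with h | ⟨u, hu, h⟩
      · omega
      · rw [← h, f4]
        exact (h4 u hu).1
    gcongr
  · obtain ⟨h1, h2, h3, h4⟩ := hs₁
    obtain ⟨g1, g2, g3, g4, g5, g6, g7⟩ := hs₄
    obtain ⟨f1, f2, f3, f4, f5, f6⟩ := hs₃
    obtain ⟨e1, e2, e3, e4, e5⟩ := hs₅
    obtain ⟨c1, c2, c3, c4, c5⟩ := hs'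
    have hz : s'.arr .zero = s.arr .zero := by rw [c3, e3, g3, f3]
    have hd : s'.arr .dist = s₁.arr .dist := by rw [c3, e3, g4, f4]
    refine ⟨⟨c1, ?_, ?_, ?_, ?_⟩, by rw [c2, e2], hz⟩
    · rw [hz, hd]; exact h4
    · rw [hd, c4, e4, ← f4]; exact g6
    · rw [hd, c4, e4, ← f4]; exact g7
    · rwa [hd, c4, ← f4, ← g4, ← e3]
  · have e1 : (ArrProg.assign .top (.const 0)).cost = 2 := rfl
    have e2 : (ArrProg.assign .best (.const 0)).cost = 2 := rfl
    rw [e1, e2]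
    have h1 := Nat.mul_le_mul_right (clearBody.cost + 10)
      (show n + 2 ≤ 2 * (n + m + 1) by omega)
    have h2 := Nat.mul_le_mul_right (countBody.cost + 8) (show n + 1 ≤ n + m + 1 by omega)
    have h3 := Nat.mul_le_mul_right (bestBody.cost + 8) (show n + 1 ≤ n + m + 1 by omega)
    have e3 : (K + 2 * clearBody.cost + countBody.cost + bestBody.cost + 50) * (n + m + 1) =
      K * (n + m + 1) + 2 * (n + m + 1) * (clearBody.cost + 10) +
        (n + m + 1) * (countBody.cost + 8) + (n + m + 1) * (bestBody.cost + 8) +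
        14 * (n + m + 1) := by ring
    rw [e3]
    omega

end Round

/-! ### Correctness of the marking program -/

/-- The edge list `src`, `tgt` enumerates the edges of `E`. -/
structure ListsEdges {n : ℕ} (E : Finset (Fin n × Fin n)) (m : ℕ) (src tgt : ℕ → ℕ) : Prop where
  src_lt : ∀ e < m, src e < n
  tgt_lt : ∀ e < m, tgt e < n
  mem_iff : ∀ i j : Fin n, (i, j) ∈ E ↔ ∃ e < m, src e = i ∧ tgt e = j

section Levels

variable {n m : ℕ} {src tgt : ℕ → ℕ} {E : Finset (Fin n × Fin n)} {T : Finset (Fin n)}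
  {A : ℕ → Prop} {dist : ℕ → ℕ}

theorem ListsEdges.edgePath_iff (hE : ListsEdges E m src tgt) {X : Set (Fin n)}
    (hA : ∀ i : Fin n, A i ↔ i ∈ X) (d : ℕ) (i : Fin n) :
    EdgePath m src tgt A d i ↔ PathOfLength E X d i := by
  induction d generalizing i with
  | zero => exact hA i
  | succ d ih =>
    constructor
    · rintro ⟨e, he, hs, hp⟩
      let j : Fin n := ⟨tgt e, hE.tgt_lt e he⟩
      exact ⟨j, (hE.mem_iff i j).2 ⟨e, he, hs, rfl⟩, (ih j).1 hp⟩
    · rintro ⟨j, hj, hp⟩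
      obtain ⟨e, he, hs, ht⟩ := (hE.mem_iff i j).1 hj
      exact ⟨e, he, hs, by rw [ht]; exact (ih j).2 hp⟩

theorem IsDist.eq_zero_iff (hd : IsDist n m src tgt A dist) (hE : ListsEdges E m src tgt)
    {X : Set (Fin n)} (hA : ∀ i : Fin n, A i ↔ i ∈ X) (i : Fin n) :
    dist i = 0 ↔ ∀ d, ¬ PathOfLength E X d i := by
  obtain ⟨-, h1, h2⟩ := hd i i.2
  constructor
  · intro h d hp
    have := h2 d ((hE.edgePath_iff hA d i).2 hp)
    omega
  · intro h
    by_contra h0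
    exact h _ ((hE.edgePath_iff hA _ i).1 (h1 (by omega)))

/-- Every state has a path to level zero, so a search from there leaves no entry 0, and the shift by
one is uniform. -/
theorem IsDist.eq_level (hd : IsDist n m src tgt A dist) (hE : ListsEdges E m src tgt)
    (hA : ∀ i : Fin n, A i ↔ i ∈ levelZero E T) (i : Fin n) : dist i = level E T i + 1 := by
  obtain ⟨-, h1, h2⟩ := hd i i.2
  obtain ⟨h3, h4⟩ := h2 _ ((hE.edgePath_iff hA _ i).2 (pathOfLength_level E T i))
  have := level_le E T ((hE.edgePath_iff hA _ i).1 (h1 h3))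
  omega

theorem entryCount_eq_card_levelSet (hd : ∀ i : Fin n, dist i = level E T i + 1) (j : ℕ) :
    entryCount n dist (j + 1) = (levelSet E T j).card := by
  symm
  refine Finset.card_nbij (fun i : Fin n => (i : ℕ)) ?_ ?_ ?_
  · intro i hi
    have : level E T i = j := by simpa [levelSet] using hi
    simp [hd, this]
  · exact fun i _ j _ h => Fin.ext h
  · intro u hu
    obtain ⟨hu, hj⟩ : u < n ∧ dist u = j + 1 := by simpa using hu
    refine ⟨⟨u, hu⟩, ?_, rfl⟩
    have := hd ⟨u, hu⟩
    simp only at this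
    simp [levelSet]
    omega

theorem HasLevels.dist_eq {s : ArrState} (h : HasLevels n m src tgt s)
    (hE : ListsEdges E m src tgt) (hz : ∀ i : Fin n, 0 < s.arr .zero i ↔ i ∈ levelZero E T)
    (i : Fin n) : s.arr .dist i = level E T i + 1 :=
  h.dist.eq_level hE hz i

theorem HasLevels.top_eq_numLevels {s : ArrState} (h : HasLevels n m src tgt s)
    (hE : ListsEdges E m src tgt) (hz : ∀ i : Fin n, 0 < s.arr .zero i ↔ i ∈ levelZero E T)
    (hn : 0 < n) : s.reg .top = numLevels E T + 1 := by
  have hd := h.dist_eq hE hz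
  refine le_antisymm ?_ ?_
  · rcases h.top_eq with h0 | ⟨u, hu, h0⟩
    · omega
    · have h1 := hd ⟨u, hu⟩
      have h2 := level_le_numLevels E T ⟨u, hu⟩
      simp only at h1
      omega
  · have h1 : ∀ i, level E T i ≤ s.reg .top - 1 := fun i => by
      have h1 := hd i
      have h2 := h.le_top i i.2
      omega
    have h2 := numLevels_le E T h1
    have h3 := hd ⟨0, hn⟩
    have h4 := h.le_top 0 hn
    simp only at h3
    omega

end Levels

/-- A bound on the number of rounds if there are `k` levels. -/
noncomputable def roundBound (k : ℕ) : ℕ := ⌊Real.logb (3 / 2) k⌋₊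

/-- The factor 2/3 lowers the logarithm to base 3/2 by at least one. For `k' = 0` the logarithm has
the default value 0, and `k ≥ 2 > 3/2` suffices. -/
theorem roundBound_add_one_le {k k' : ℕ} (hk : 2 ≤ k) (h : 3 * k' ≤ 2 * k) :
    roundBound k' + 1 ≤ roundBound k := by
  have hb : (1 : ℝ) < 3 / 2 := by norm_num
  have hk2 : (2 : ℝ) ≤ k := by exact_mod_cast hk
  unfold roundBound
  rcases Nat.eq_zero_or_pos k' with rfl | hk'
  · simp only [Nat.cast_zero, Real.logb_zero, Nat.floor_zero, zero_add]
    refine Nat.le_floor ?_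
    rw [Nat.cast_one, Real.le_logb_iff_rpow_le hb (by linarith), Real.rpow_one]
    linarith
  · have hk'' : (0 : ℝ) < k' := by exact_mod_cast hk'
    have h1 : Real.logb (3 / 2) k' + 1 ≤ Real.logb (3 / 2) k := by
      rw [Real.le_logb_iff_rpow_le hb (by linarith), Real.rpow_add (by norm_num),
        Real.rpow_logb (by norm_num) (by norm_num) hk'', Real.rpow_one]
      have : (3 : ℝ) * k' ≤ 2 * k := by exact_mod_cast h
      linarith
    have h0 : 0 ≤ Real.logb (3 / 2) k' := Real.logb_nonneg hb (by exact_mod_cast hk')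
    rw [← Nat.floor_add_one h0]
    exact Nat.floor_le_floor h1

theorem roundBound_mono {k k' : ℕ} (h : k ≤ k') : roundBound k ≤ roundBound k' := by
  rcases Nat.eq_zero_or_pos k with rfl | hk
  · simp [roundBound]
  · refine Nat.floor_le_floor (Real.logb_le_logb_of_le (by norm_num) ?_ ?_)
    · exact_mod_cast hk
    · exact_mod_cast h

theorem roundBound_le (n : ℕ) : (roundBound n : ℝ) ≤ 3 * Real.log (max 2 (n : ℝ)) := by
  have h2 : (1 : ℝ) ≤ max 2 (n : ℝ) := le_max_of_le_left one_le_two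
  have hlog : (1 : ℝ) / 3 ≤ Real.log (3 / 2) := by
    have := Real.one_sub_inv_le_log_of_pos (show (0 : ℝ) < 3 / 2 by norm_num)
    linarith
  have hle : Real.logb (3 / 2) n ≤ Real.logb (3 / 2) (max 2 (n : ℝ)) := by
    rcases Nat.eq_zero_or_pos n with rfl | hn
    · simp only [Nat.cast_zero, Real.logb_zero]
      exact Real.logb_nonneg (by norm_num) (le_max_of_le_left one_le_two)
    · exact Real.logb_le_logb_of_le (by norm_num) (by exact_mod_cast hn) (le_max_right _ _)
  have h0 : 0 ≤ Real.logb (3 / 2) (max 2 (n : ℝ)) := Real.logb_nonneg (by norm_num) h2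
  refine (Nat.cast_le.2 (Nat.floor_le_floor hle)).trans ((Nat.floor_le h0).trans ?_)
  rw [← Real.log_div_log, div_le_iff₀ (by linarith)]
  nlinarith [Real.log_nonneg h2]

/-- Mark a level and recompute the levels. -/
def markRound : ArrProg := .seq (forLoop .idx (.reg .n) markBody) roundProg

/-- The marking program. -/
def markProg : ArrProg :=
  .seq setup (.seq bfs (.seq (forLoop .idx (.reg .n) unreachedBody) (.seq roundProg
    (.loop (.add (.reg .root) (.const 1)) (.reg .top) markRound))))

open Classical in
/-- The state of the marking program when the levels in `J` are marked and `T'` is the current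
target set. -/
structure Tracks {n : ℕ} (m : ℕ) (src tgt : ℕ → ℕ) (E : Finset (Fin n × Fin n))
    (T T' J : Finset (Fin n)) (s : ArrState) : Prop where
  levels : HasLevels n m src tgt s
  zero : ∀ i : Fin n, 0 < s.arr .zero i ↔ i ∈ levelZero E T'
  out : ∀ i : Fin n, (i ∈ J → s.inp (2 + i) = 1) ∧ (i ∉ J → s.inp (2 + i) = 0)
  extend : ∀ I, MarkToGuess E T' I → MarkToGuess E T (I ∪ J)

/-- By `levelZero_union` the zero set only has to be enlarged by the marked level itself before the
levels are computed again. -/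
theorem exists_runs_markRound : ∃ K, ∀ (n m B : ℕ) (src tgt : ℕ → ℕ) (E : Finset (Fin n × Fin n))
    (T T' J : Finset (Fin n)) (s : ArrState), ListsEdges E m src tgt → 0 < n →
    Tracks m src tgt E T T' J s → Nat.sqrt n < numLevels E T' →
    Runs B (2 + n + 2 * m) markRound s (K * (n + m + 1)) fun s' => ∃ T'' J',
      Tracks m src tgt E T T'' J' s' ∧
        roundBound (numLevels E T'') + 1 ≤ roundBound (numLevels E T') := by
  classical
  obtain ⟨K, hK⟩ := exists_runs_round
  refine ⟨K + markBody.cost + 8, fun n m B src tgt E T T' J s hE hn hs hlt => ?_⟩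
  have : Nonempty (Fin n) := ⟨⟨0, hn⟩⟩
  have hd := hs.levels.dist_eq hE hs.zero
  have htop := hs.levels.top_eq_numLevels hE hs.zero hn
  have hsqrt : √(Fintype.card (Fin n) : ℝ) < (numLevels E T' : ℝ) := by
    rw [Fintype.card_fin, Real.sqrt_lt' (by exact_mod_cast (Nat.zero_le _).trans_lt hlt)]
    have := Nat.sqrt_lt'.1 hlt
    exact_mod_cast this
  have hk := MarkToGuess.two_le_of_sqrt_lt hsqrt
  set k := numLevels E T' with hkdef
  obtain ⟨hb1, hb2⟩ := hs.levels.best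
  -- For `k ≥ 2` the middle third contains the level ⌈k/3⌉, so a best level was found.
  have hpos : 0 < s.reg .best := (hb2 ((k + 2) / 3) (by unfold InMiddle; omega)).1
  obtain ⟨i, hi⟩ : ∃ i, s.reg .best = i + 1 := ⟨s.reg .best - 1, by omega⟩
  have hmid : k ≤ 3 * i ∧ 3 * i ≤ 2 * k := by
    have := hb1 hpos
    rw [hi, htop] at this
    unfold InMiddle at this
    omega
  have hmin : ∀ j, k ≤ 3 * j → 3 * j ≤ 2 * k →
      (levelSet E T' i).card ≤ (levelSet E T' j).card := by
    intro j h1 h2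
    have := (hb2 j (by unfold InMiddle; omega)).2
    rwa [hi, entryCount_eq_card_levelSet hd, entryCount_eq_card_levelSet hd] at this
  have hmem : ∀ u : Fin n, s.arr .dist u = s.reg .best ↔ u ∈ levelSet E T' i := by
    intro u
    rw [hd, hi]
    simp [levelSet]
  obtain ⟨T'', hunion, hthree, hext⟩ : ∃ T'' : Finset (Fin n),
      levelZero E T'' = levelZero E T' ∪ levelSet E T' i ∧ 3 * numLevels E T'' ≤ 2 * k ∧
      ∀ I, MarkToGuess E T'' I → MarkToGuess E T' (I ∪ levelSet E T' i) :=
    ⟨_, levelZero_union E T' (by omega),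
      three_mul_numLevels_union_le E T' (by omega) hmid.1 hmid.2, fun I hI => by
        convert MarkToGuess.many T' I i hsqrt hmid hmin hI⟩
  refine ((runs_mark hs.levels.graph).seq fun s₁ h₁ =>
    (hK n m B src tgt s₁ h₁.1 hE.src_lt hE.tgt_lt).mono (c := K * (n + m + 1))
      (R := fun s' => Tracks m src tgt E T T'' (J ∪ levelSet E T' i) s')
      le_rfl fun s' _ h' => ?_).mono ?_ fun s' _ h => ⟨_, _, h,
        roundBound_add_one_le hk hthree⟩
  · obtain ⟨-, h2, h3⟩ := h₁
    obtain ⟨h4, h5, h6⟩ := h'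
    refine ⟨h4, fun u => ?_, fun u => ?_, fun I hI => ?_⟩
    · rw [hunion, h6, h2 u u.2]
      by_cases hu : u ∈ levelSet E T' i
      · rw [if_pos ((hmem u).2 hu)]
        simp [hu]
      · rw [if_neg fun h => hu ((hmem u).1 h), hs.zero u]
        simp [hu]
    · rw [h5, h3 u u.2]
      by_cases hu : u ∈ levelSet E T' i
      · rw [if_pos ((hmem u).2 hu)]
        simp [hu]
      · rw [if_neg fun h => hu ((hmem u).1 h)]
        simpa [hu] using hs.out u
    · have := hs.extend _ (hext I hI)
      convert this using 1
      ext u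
      simp only [Finset.mem_union]
      tauto
  · have h1 := Nat.mul_le_mul_right (markBody.cost + 8) (show n + 1 ≤ n + m + 1 by omega)
    have e1 : (K + markBody.cost + 8) * (n + m + 1) = K * (n + m + 1) +
      (n + m + 1) * (markBody.cost + 8) := by ring
    rw [e1]
    omega

/-- As `top` is one more than the number of levels k, the test `root + 1 < top` says ⌊√n⌋ < k, which
is equivalent to √n < k. The field `extend` of `Tracks` collects the uses of `many`; on exit `few`
supplies the empty set at the end of the recursion. -/
theorem exists_runs_markProg : ∃ K, ∀ (n m B : ℕ) (src tgt : ℕ → ℕ) (E : Finset (Fin n × Fin n))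
    (T : Finset (Fin n)) (s : ArrState), ListsEdges E m src tgt → 0 < n →
    IsInput n m src tgt s → (∀ i : Fin n, s.inp (2 + i) = if i ∈ T then 1 else 0) →
    Runs B (2 + n + 2 * m) markProg s (K * (n + m + 1) * (roundBound n + 1)) fun s' => ∃ I,
      MarkToGuess E T I ∧ ∀ i : Fin n, s'.inp (2 + i) = if i ∈ I then 1 else 0 := by
  classical
  obtain ⟨K₁, hK₁⟩ := exists_runs_setup
  obtain ⟨K₂, hK₂⟩ := exists_runs_bfs
  obtain ⟨K₃, hK₃⟩ := exists_runs_round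
  obtain ⟨K₄, hK₄⟩ := exists_runs_markRound
  refine ⟨K₁ + K₂ + K₃ + K₄ + unreachedBody.cost + 20,
    fun n m B src tgt E T s hE hn hs hT => ?_⟩
  set L := n + m + 1 with hL
  have hcost : (ArrExpr.add (.reg .root) (.const 1)).cost + (ArrExpr.reg .top).cost + 1 = 5 := rfl
  refine ((hK₁ n m B src tgt s hs).seq fun s₁ hs₁ =>
    (hK₂ n m B src tgt s₁ hs₁.1 hE.src_lt hE.tgt_lt).seq fun s₂ hs₂ =>
    (runs_unreached hs₂.1).seq fun s₃ hs₃ =>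
    ((hK₃ n m B src tgt s₃ hs₃.1 hE.src_lt hE.tgt_lt).mono (c := K₃ * L)
      (R := fun s' => Tracks m src tgt E T T ∅ s') le_rfl fun s₄ _ hs₄ => ?_).seq fun s₄ hs₄ =>
    Runs.loop (b := (K₄ * L + 5) * roundBound n) (by omega) (I := fun b s' => ∃ T' J,
      Tracks m src tgt E T T' J s' ∧ (K₄ * L + 5) * roundBound (numLevels E T') ≤ b)
      ?_ ?_ ?_).mono ?_ ?_
  · obtain ⟨h1, h2, h3⟩ := hs₁
    obtain ⟨g1, g2, g3, g4⟩ := hs₂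
    obtain ⟨f1, f2, f3⟩ := hs₃
    obtain ⟨e1, e2, e3⟩ := hs₄
    have hA : ∀ i : Fin n, 0 < s₁.arr .zero i ↔ i ∈ (T : Set (Fin n)) := fun i => by
      rw [h2 i i.2, hT i]
      split_ifs with h <;> simp [h]
    refine ⟨e1, fun i => ?_, fun i => ?_, fun I hI => by simpa using hI⟩
    · have hz := g4.eq_zero_iff hE hA i
      rw [e3, f3 i i.2, g3]
      simp only [levelZero, Set.mem_ofPred_eq, ← hz]
      split_ifs with h
      · simp [h]
      · rw [hA i]
        simp [h]
    · rw [e2, f2, g2, h3 i i.2]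
      simp
  · rintro b s' -
    exact ⟨⟨trivial, trivial⟩, trivial⟩
  · rintro b s' ⟨T', J, hs', hb⟩ - hlt
    have htop := hs'.levels.top_eq_numLevels hE hs'.zero hn
    simp only [eval, hs'.levels.graph.reg_root, htop] at hlt
    have hrun := hK₄ n m B src tgt E T T' J s' hE hn hs' (by omega)
    obtain ⟨r, hr⟩ | h0 : (∃ r, roundBound (numLevels E T') = r + 1) ∨
        roundBound (numLevels E T') = 0 := by
      rcases roundBound (numLevels E T') with _ | r
      · exact Or.inr rfl
      · exact Or.inl ⟨r, rfl⟩
    · refine ⟨K₄ * L, (K₄ * L + 5) * r, ?_, hrun.mono le_rfl ?_⟩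
      · rw [hcost]
        refine le_trans (le_of_eq ?_) hb
        rw [hr]
        ring
      · rintro s'' - ⟨T'', J', hs'', hle⟩
        exact ⟨T'', J', hs'', Nat.mul_le_mul_left _ (by omega)⟩
    -- A round only starts with more than ⌊√n⌋ ≥ 1 levels, where `roundBound` is positive, so the
    -- budget cannot be used up.
    · have hpos := roundBound_add_one_le (k := numLevels E T') (k' := 0)
        (by have := Nat.sqrt_pos.2 hn; omega) (by omega)
      omega
  · refine ⟨T, ∅, hs₄, Nat.mul_le_mul_left _ (roundBound_mono ?_)⟩
    refine numLevels_le _ _ fun i => ?_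
    simpa using (level_lt_card E T i).le
  · have h1 := Nat.mul_le_mul_right (unreachedBody.cost + 8) (show n + 1 ≤ L by omega)
    rw [hcost, ← hL]
    have h2 : K₁ * L + (K₂ * L + (L * (unreachedBody.cost + 8) + (K₃ * L +
        (5 * L + 5 * L)))) + (K₄ * L + 5 * L) * roundBound n ≤
        (K₁ + K₂ + K₃ + K₄ + unreachedBody.cost + 20) * L * (roundBound n + 1) := by
      have : (K₁ + K₂ + K₃ + K₄ + unreachedBody.cost + 20) * L * (roundBound n + 1) =
        K₁ * L + (K₂ * L + (L * (unreachedBody.cost + 8) + (K₃ * L + (5 * L + 5 * L)))) +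
        (K₄ * L + 5 * L) * roundBound n + (K₄ + 2) * L +
        (K₁ + K₂ + K₃ + unreachedBody.cost + 15) * L * roundBound n := by ring
      rw [this]
      omega
    have h3 : (K₄ * L + 5) * roundBound n ≤ (K₄ * L + 5 * L) * roundBound n :=
      Nat.mul_le_mul_right _ (by omega)
    omega
  · rintro s' - ⟨⟨b, T', J, hs', -⟩, hlt⟩
    have htop := hs'.levels.top_eq_numLevels hE hs'.zero hn
    simp only [eval, hs'.levels.graph.reg_root, htop] at hlt
    refine ⟨J, ?_, fun i => ?_⟩
    · have hfew : MarkToGuess E T' ∅ := by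
        refine MarkToGuess.few T' ?_
        rw [Fintype.card_fin]
        refine Real.le_sqrt_of_sq_le ?_
        have := Nat.le_sqrt'.1 (show numLevels E T' ≤ Nat.sqrt n by omega)
        exact_mod_cast this
      simpa using hs'.extend ∅ hfew
    · split_ifs with h
      · exact (hs'.out i).1 h
      · exact (hs'.out i).2 h

/-! ### The marking program on the word RAM -/

section Input

variable {n : ℕ} (T : Finset (Fin n)) (edges : List (Fin n × Fin n))

/-- The sources of the edges. -/
def listSrc (e : ℕ) : ℕ := (edges.map fun e => (e.1 : ℕ)).getD e 0

/-- The ends of the edges. -/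
def listTgt (e : ℕ) : ℕ := (edges.map fun e => (e.2 : ℕ)).getD e 0

theorem getD_flatMap_pair (l : List (Fin n × Fin n)) (e : ℕ) :
    (l.flatMap fun e : Fin n × Fin n => [(e.1 : ℕ), (e.2 : ℕ)]).getD (e + e) 0 = listSrc l e ∧
    (l.flatMap fun e : Fin n × Fin n => [(e.1 : ℕ), (e.2 : ℕ)]).getD (e + e + 1) 0 =
      listTgt l e := by
  induction l generalizing e with
  | nil => simp [listSrc, listTgt]
  | cons a l ih =>
    cases e with
    | zero => simp [listSrc, listTgt]
    | succ e =>
      have h := ih e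
      have e1 : e + 1 + (e + 1) = e + e + 1 + 1 := by ring
      simp only [listSrc, listTgt, e1, List.flatMap_cons, List.cons_append, List.nil_append,
        List.map_cons, List.getD_cons_succ] at h ⊢
      exact h

theorem length_flatMap_pair (l : List (Fin n × Fin n)) :
    (l.flatMap fun e : Fin n × Fin n => [(e.1 : ℕ), (e.2 : ℕ)]).length = 2 * l.length := by
  induction l with
  | nil => rfl
  | cons a l ih =>
    simp only [List.flatMap_cons, List.length_append, ih, List.length_cons, List.length_nil]
    ring

theorem graphInput_mem_zero : (graphInput T edges).mem 0 = n := by simp [graphInput]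

theorem graphInput_mem_one : (graphInput T edges).mem 1 = edges.length := by simp [graphInput]

theorem graphInput_mem_mark (i : Fin n) :
    (graphInput T edges).mem (2 + i) = if i ∈ T then 1 else 0 := by
  have : (2 : ℕ) + i = i + 1 + 1 := by ring
  simp only [graphInput, this, List.cons_append, List.nil_append, List.getD_cons_succ]
  rw [List.getD_append _ _ _ _ (by simp)]
  simp [List.getD_eq_getElem?_getD]

theorem graphInput_mem_edge (a : ℕ) : (graphInput T edges).mem (2 + n + a) =
    (edges.flatMap fun e : Fin n × Fin n => [(e.1 : ℕ), (e.2 : ℕ)]).getD a 0 := by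
  have : 2 + n + a = n + a + 1 + 1 := by ring
  simp only [graphInput, this, List.cons_append, List.nil_append, List.getD_cons_succ]
  rw [List.getD_append_right _ _ _ _ (by simp)]
  simp

theorem graphInput_mem_of_ge {a : ℕ} (ha : 2 + n + 2 * edges.length ≤ a) :
    (graphInput T edges).mem a = 0 := by
  obtain ⟨b, rfl⟩ := Nat.exists_eq_add_of_le ha
  have : 2 + n + 2 * edges.length + b = 2 + n + (2 * edges.length + b) := by ring
  rw [this, graphInput_mem_edge, List.getD_eq_default]
  rw [length_flatMap_pair]
  omega

theorem listSrc_lt {e : ℕ} (he : e < edges.length) : listSrc edges e = edges[e].1 ∧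
    listTgt edges e = edges[e].2 := by
  simp [listSrc, listTgt, List.getD_eq_getElem?_getD, he]

theorem graphInput_mem_le (a : ℕ) :
    (graphInput T edges).mem a ≤ 2 + n + 2 * edges.length := by
  have h : ∀ x ∈ [n, edges.length] ++ List.ofFn (fun i : Fin n => if i ∈ T then (1 : ℕ) else 0) ++
      edges.flatMap (fun e : Fin n × Fin n => [(e.1 : ℕ), (e.2 : ℕ)]),
      x ≤ 2 + n + 2 * edges.length := by
    intro x hx
    simp only [List.mem_append, List.mem_flatMap, List.mem_cons, List.not_mem_nil, or_false,
      List.mem_ofFn] at hx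
    rcases hx with ((rfl | rfl) | ⟨i, rfl⟩) | ⟨e, -, rfl | rfl⟩
    · omega
    · omega
    · split_ifs <;> omega
    · omega
    · omega
  simp only [graphInput, List.getD_eq_getElem?_getD]
  rcases h' : (_ : List ℕ)[a]? with _ | x
  · simp
  · exact h x (List.mem_of_getElem? h')

theorem listsEdges {E : Finset (Fin n × Fin n)} (hE : ∀ e, e ∈ edges ↔ e ∈ E) :
    ListsEdges E edges.length (listSrc edges) (listTgt edges) := by
  refine ⟨fun e he => ?_, fun e he => ?_, fun i j => ?_⟩
  · rw [(listSrc_lt edges he).1]; exact Fin.is_lt _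
  · rw [(listSrc_lt edges he).2]; exact Fin.is_lt _
  · rw [← hE, List.mem_iff_getElem]
    constructor
    · rintro ⟨e, he, h⟩
      refine ⟨e, he, ?_⟩
      simp [listSrc_lt edges he, h]
    · rintro ⟨e, he, h1, h2⟩
      rw [(listSrc_lt edges he).1] at h1
      rw [(listSrc_lt edges he).2] at h2
      exact ⟨e, he, Prod.ext (Fin.ext h1) (Fin.ext h2)⟩

/-- The array state at the start of the marking program. -/
def initialState : ArrState where
  reg := fun _ => 0
  inp := (graphInput T edges).mem
  arr := fun _ _ => 0

/-- The memory beyond the input is 0, so all arrays start as zero; the only difference to the raw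
input is that register 0 holds the length. -/
theorem toRAM_initialState {D : ℕ} (hD : 2 + n + 2 * edges.length = D) :
    (initialState T edges).toRAM D = { graphInput T edges with
      reg := Function.update (graphInput T edges).reg 0 D } := by
  unfold ArrState.toRAM initialState
  congr 1
  · funext x
    by_cases h : ∃ z, RegName.toNat z = x
    · obtain ⟨z, rfl⟩ := h
      rw [RegName.toNat_injective.extend_apply, Function.update_of_ne z.toNat_ne_zero]
      rfl
    · rw [Function.extend_apply' _ _ _ h, Function.update_apply]
      rfl
  · funext a
    by_cases h : ∃ z, cellAddr D z = a
    · obtain ⟨z, rfl⟩ := h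
      rw [(cellAddr_injective D).extend_apply, graphInput_mem_of_ge]
      unfold cellAddr
      omega
    · rw [Function.extend_apply' _ _ _ h]

theorem isInput_initialState :
    IsInput n edges.length (listSrc edges) (listTgt edges) (initialState T edges) where
  inp_zero := graphInput_mem_zero T edges
  inp_one := graphInput_mem_one T edges
  inp_src e _ := (graphInput_mem_edge T edges _).trans (getD_flatMap_pair edges e).1
  inp_tgt e _ := (graphInput_mem_edge T edges _).trans (getD_flatMap_pair edges e).2
  head _ := rfl

theorem bounded_initialState :
    (initialState T edges).Bounded (2 + n + 2 * edges.length) :=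
  ⟨fun _ => Nat.zero_le _, graphInput_mem_le T edges, fun _ _ => Nat.zero_le _⟩

end Input

/-- The length of the input, `2 + n + 2m`. -/
def inputLength : RAMExpr :=
  .add (.const 2) (.add (.load (.const 0)) (.add (.load (.const 1)) (.load (.const 1))))

/-- MarkToGuess on the word RAM. -/
def markToGuessRAM : RAMProg := .seq (.assign 0 inputLength) markProg.compile

theorem exists_ramRuns_markToGuess : ∃ C₀ : ℕ, ∀ C : ℕ, C₀ ≤ C → ∀ n : ℕ, 0 < n →
    ∀ (E : Finset (Fin n × Fin n)) (T : Finset (Fin n)) (edges : List (Fin n × Fin n)),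
      edges.Nodup → (∀ e, e ∈ edges ↔ e ∈ E) →
      ∃ (I : Finset (Fin n)) (σ : RAMState) (steps : ℕ),
        RAMRuns (C * (n + E.card)) markToGuessRAM (graphInput T edges) σ steps ∧
        (steps : ℝ) ≤ C * ((n + E.card : ℕ) : ℝ) * Real.log (max 2 (n : ℝ)) ∧
        IsOutput σ I ∧ MarkToGuess E T I := by
  obtain ⟨K, hK⟩ := exists_runs_markProg
  -- The first summand serves memory, since `2 + n + 2 * m ≤ 4 * (n + m)` for `n ≥ 1`; the others
  -- serve time.
  refine ⟨4 * markProg.req + 10 * K + 30, fun C hC n hn E T edges hnodup hE => ?_⟩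
  have hcard : E.card = edges.length := by
    rw [← List.toFinset_card_of_nodup hnodup]
    congr 1
    ext e
    rw [List.mem_toFinset, hE]
  rw [hcard]
  set m := edges.length with hm
  have hB : (4 * markProg.req + 10 * K + 30) * (n + m) ≤ C * (n + m) :=
    Nat.mul_le_mul_right _ hC
  have hB1 : 4 * (n + m) ≤ C * (n + m) := Nat.mul_le_mul_right _ (by omega)
  have hB2 : markProg.req * (2 + n + 2 * m) ≤ C * (n + m) :=
    calc markProg.req * (2 + n + 2 * m) ≤ markProg.req * (4 * (n + m)) :=
        Nat.mul_le_mul_left _ (by omega)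
      _ = 4 * markProg.req * (n + m) := by ring
      _ ≤ C * (n + m) := Nat.mul_le_mul_right _ (by omega)
  have h0 := graphInput_mem_zero T edges
  have h1 := graphInput_mem_one T edges
  obtain ⟨s', t, hrun, ht, -, I, hI, hout⟩ := hK n m (C * (n + m)) (listSrc edges)
    (listTgt edges) E T (initialState T edges) (listsEdges edges hE) hn
    (isInput_initialState T edges) (graphInput_mem_mark T edges) hB2
    (bounded_initialState T edges)
  rw [toRAM_initialState T edges rfl] at hrun
  have heval : inputLength.eval (graphInput T edges) = 2 + n + 2 * m := by
    simp only [inputLength, RAMExpr.eval, h0, h1]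
    ring
  have hfits : inputLength.Fits (C * (n + m)) (graphInput T edges) := by
    simp only [inputLength, RAMExpr.Fits, RAMExpr.eval, h0, h1]
    omega
  have hassign := RAMRuns.assign (graphInput T edges) 0 inputLength hfits
  rw [heval] at hassign
  have hcost : inputLength.cost + 1 = 11 := rfl
  refine ⟨I, _, _, .seq _ _ _ _ _ _ _ hassign hrun, ?_, fun i => ?_, hI⟩
  · have hL := roundBound_le n
    set L := Real.log (max 2 (n : ℝ)) with hLdef
    have hL2 : (1 : ℝ) / 2 ≤ L := by
      have h3 : Real.log 2 ≤ L := Real.log_le_log two_pos (le_max_left _ _)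
      have h4 := Real.log_two_gt_d9
      linarith
    have hn1 : (1 : ℝ) ≤ ((n + m : ℕ) : ℝ) := by
      exact_mod_cast (show 1 ≤ n + m by omega)
    have ht' : ((inputLength.cost + 1 + t : ℕ) : ℝ) ≤
        11 + K * (((n + m : ℕ) : ℝ) + 1) * (roundBound n + 1) := by
      rw [hcost]
      have : ((t : ℕ) : ℝ) ≤ ((K * (n + m + 1) * (roundBound n + 1) : ℕ) : ℝ) := by
        exact_mod_cast ht
      push_cast at this ⊢
      linarith
    have hC' : ((10 * K + 30 : ℕ) : ℝ) ≤ C := by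
      exact_mod_cast (show 10 * K + 30 ≤ C by omega)
    push_cast at hC'
    set N := ((n + m : ℕ) : ℝ)
    have hK0 : (0 : ℝ) ≤ K := Nat.cast_nonneg K
    refine ht'.trans ?_
    -- Here `N + 1 ≤ 2 * N`, and `roundBound n + 1 ≤ 3 * L + 2 * L` because `L ≥ 1 / 2`.
    calc (11 : ℝ) + K * (N + 1) * (roundBound n + 1) ≤ 30 * (N * L) + K * (2 * N) * (5 * L) := by
          refine add_le_add (by nlinarith) ?_
          gcongr <;> linarith
      _ = (10 * K + 30) * N * L := by ring
      _ ≤ C * N * L := by gcongr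
  · rw [ArrState.toRAM_mem_of_lt _ _ (by have := i.2; omega), hout]

theorem theorem1 :
    ∃ (markToGuess : RAMProg) (C : ℕ), ∀ n : ℕ, 0 < n →
      -- the preprocessing: its input is the graph with its target set, nothing else
      (∀ (E : Finset (Fin n × Fin n)) (T : Finset (Fin n)) (edges : List (Fin n × Fin n)),
        edges.Nodup → (∀ e, e ∈ edges ↔ e ∈ E) →
        ∃ (I : Finset (Fin n)) (σ : RAMState) (steps : ℕ),
          RAMRuns (C * (n + E.card)) markToGuess (graphInput T edges) σ steps ∧
          (steps : ℝ) ≤ C * ((n + E.card : ℕ) : ℝ) * Real.log (max 2 (n : ℝ)) ∧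
          IsOutput σ I ∧ MarkToGuess E T I) ∧
      -- guessing value iteration after the preprocessing
      (∀ (M : MarkovChain (Fin n)) (O : Objective (Fin n)) (ε : ℝ),
        O.IsObjectiveOn M → O.HasUniqueFixpoint M → 0 < ε →
        ∀ (I : Finset (Fin n)), MarkToGuess M.edges O.T I →
        ∀ (L : List (Fin n)), L.Nodup → (∀ s, s ∈ L ↔ s ∈ I) →
          (∃ (l u : Fin n → ℝ) (N : ℕ), SolveWithGuessingSet M L O ε l u N) ∧
          ∀ (l u : Fin n → ℝ) (N : ℕ), SolveWithGuessingSet M L O ε l u N →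
            (∀ s, O.value M s ≠ ⊤ ∧ l s ≤ (O.value M s).toReal ∧ (O.value M s).toReal ≤ u s ∧
              u s - l s ≤ ε) ∧
            (N : ℝ) ≤ ((n : ℝ) * Real.log (max 2 (O.wMax / ε)) / M.pmin) ^ (C * √(n : ℝ))) := by
  obtain ⟨C₀, hC₀⟩ := exists_ramRuns_markToGuess
  refine ⟨markToGuessRAM, max C₀ 253, fun n hn => ⟨hC₀ _ (le_max_left _ _) n hn, ?_⟩⟩
  intro M O ε hO hu hε I hI L hL hLI
  exact guessingVI_spec hn M O hO hu hε hI hL hLI (le_max_right _ _)
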